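/- **Algebra.** Let $H$ be a finite-dimensional Hopf algebra over $\mathbb C$ with $S^2=\mathrm{id}$ (equivalently, semisimple), with Sweedler notation $\Delta(a)=a_1\otimes a_2$, etc. On $H^*$ use the product $(fg)(x)=f(x_1)g(x_2)$ and the coproduct $f_1(x)f_2(y)=f(xy)$. The Drinfeld double $D(H)$ is $H^*\otimes H$ with $$(f\otimes a)(g\otimes b)=f\,g(S(a_3)\,?\,a_1)\otimes a_2b ,\qquad 1=\varepsilon\otimes 1,\qquad S(f\otimes a)=(\varepsilon\otimes S(a))(f\circ S\otimes 1).$$ Identify $D(H)^*$ with $H\otimes H^*$ through $(h\otimes f)(g\otimes a)=g(h)f(a)$; then $$\Delta(h\otimes f)=\sum_i (h_1\otimes g_i)\otimes\big(S(i_3)h_2i_1\otimes f(i_2\,?)\big),\qquad \varepsilon(h\otimes f)=\varepsilon(h)f(1),$$ where $i$ runs over a basis of $H$ and $g_i$ over the dual basis. $D(H)$ acts on $D(H)^*$ by $L(m)\xi=\xi(S(m)\,?)$ and by $R(m)\xi=\xi(?\,m)$. **Lattice.** Let $\Gamma$ be a finite lattice (cell decomposition) on a closed oriented surface, with directed edges,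 such that every edge has two distinct end points and two distinct adjacent faces. A site $s=(v,p)$ is a corner: a vertex $v$ together with an adjacent face $p$, drawn as the segment from $v$ to the centre of $p$. The state space is $\mathcal H=\bigotimes_{\text{edges}}H$. On one tensor factor put $$L_+^a x=ax,\quad L_-^a x=xS(a),\quad T_+^f x=f(x_2)x_1,\quad T_-^f x=f(S(x_1))x_2 .$$ $A_a(s)$ applies $L^{a_1},\dots,L^{a_n}$ to the edges at $v$, counterclockwise starting from $s$, with sign $+$ for edges leaving $v$ and $-$ for edges entering $v$. $B_f(s)$ applies $T^{f_1},\dots,T^{f_n}$ to the edges around $p$, counterclockwise starting from $s$, with sign $+$ for edges directed counterclockwise around $p$ and $-$ otherwise. Let $h_0\in H$ and $\phi\in H^*$ be the (normalized, two-sided) Haar integrals. A ground state is a nonzero $|GS\rangle\in\mathcal H$ with $A_{h_0}(s)|GS\rangle=|GS\rangle=B_\phi(s)|GS\rangle$ for all sites $s$. **Ribbons.** A directed triangle goes from a site to a neighbouring site. It is direct if the two sites share the face (its third side is then an edge of $\Gamma$) and dual if they share the vertex (its third side is then a dual edge, crossing an edge of $\Gamma$). Its local orientation is clockwise or counterclockwise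 according to which rotation of the initial site about its face centre immediately sweeps through the triangle. A ribbon $\tau$ is a nonempty sequence of mutually nonoverlapping directed triangles, each starting where its predecessor ends; all of them then have the same local orientation. Its initial and terminal sites are $s_0=\partial_0\tau$ and $s_1=\partial_1\tau$. The operator $F^{h\otimes f}(t)$ of a triangle $t$ acts on the factor $x$ of the edge of $\Gamma$ belonging to $t$: * direct, clockwise: $\varepsilon(h)f(x_1)x_2$ if $t$ runs along the direction of the edge, $\varepsilon(h)f(S(x_2))x_1$ if it runs against it; * direct, counterclockwise: $\varepsilon(h)f(x_2)x_1$, respectively $\varepsilon(h)f(S(x_1))x_2$; * dual, clockwise: $f(1)\,hx$ if the edge leaves the vertex of $t$, $f(1)\,xS(h)$ if it enters it; * dual, counterclockwise: $f(1)\,S(h)x$, respectively $f(1)\,xh$. For a ribbon put $F^{\xi}(t\,\tau')=F^{\xi_1}(t)F^{\xi_2}(\tau')$, where $t$ is the first triangle, $\tau'$ is the rest, and $\xi_1\otimes\xi_2$ is the coproduct of $D(H)^*$; the empty sequence gives $\varepsilon(\xi)\,\mathrm{id}$. **Proposition.** Let $|GS\rangle$ be a ground state and $\tau$ a ribbon of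 either local orientation, with ends $s_0=(v_0,p_0)$ and $s_1=(v_1,p_1)$ such that $v_0\ne v_1$ and $p_0\neq p_1$. Let $$V_\tau=\mathrm{span}_{\mathbb C}\{F^{h\otimes f}(\tau)|GS\rangle : h\in H,\ f\in H^*\}\subseteq\mathcal H .$$ 1. The map $h\otimes f\mapsto F^{h\otimes f}(\tau)|GS\rangle$ is a linear isomorphism $\Phi: D(H)^*\to V_\tau$. 2. The operators $B_t(s_0)A_a(s_0)$ and $B_t(s_1)A_a(s_1)$ preserve $V_\tau$, and $t\otimes a\mapsto B_t(s_0)A_a(s_0)|_{V_\tau}$ and $t\otimes a\mapsto B_t(s_1)A_a(s_1)|_{V_\tau}$ are representations $\rho_0,\rho_1$ of the algebra $D(H)$ on $V_\tau$. 3. Under $\Phi$ they are the actions $L$ and $R$: $\rho_0(m)\Phi(\xi)=\Phi(L(m)\xi)$ and $\rho_1(m)\Phi(\xi)=\Phi(R(m)\xi)$ for all $m\in D(H)$, $\xi\in D(H)^*$. 4. There are a finite complete list $\mu_1,\dots,\mu_n$ of pairwise nonisomorphic irreducible finite-dimensional representations of $D(H)$ and a linear isomorphism $V_\tau\cong\bigoplus_i\mu_i\otimes\mu_i^*$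 under which $\rho_0$ acts on the first factors and $\rho_1$ on the second factors (by the dual representation $m\cdot\lambda=\lambda\circ\mu_i(S(m))$). The minimal nonzero subspaces of $V_\tau$ invariant under both $\rho_0$ and $\rho_1$ (the excitation types) are exactly the summands $\mu_i\otimes\mu_i^*$; hence they correspond to the irreducible representations of $D(H)$. -/

import Mathlib

open scoped TensorProduct
open Coalgebra HopfAlgebra

namespace KitaevHopf

noncomputable section

/-! ## Preliminaries on Hopf algebras

Throughout, `H` is a Hopf algebra over the complex numbers, `H*` is its linear dual, and in
comments `a₁ ⊗ a₂ ⊗ a₃` is Sweedler notation for the iterated comultiplication of `a`. -/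

section Preliminaries

variable {H : Type*} [Ring H] [HopfAlgebra ℂ H]

theorem comul_antipode_aux₁ : TensorProduct.map .id (TensorProduct.map ((LinearMap.mul' ℂ H) ∘ₗ TensorProduct.map (antipode ℂ) .id) .id) ∘ₗ
   TensorProduct.map .id (TensorProduct.map comul .id ∘ₗ comul) ∘ₗ comul (R := ℂ) (A := H)
  = TensorProduct.map .id (TensorProduct.mk ℂ H H 1) ∘ₗ comul := by
  have h : (LinearMap.mul' ℂ H) ∘ₗ TensorProduct.map (antipode ℂ) .id ∘ₗ comul = Algebra.linearMap ℂ H ∘ₗ counit := by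
    have := HopfAlgebra.mul_antipode_rTensor_comul (R := ℂ) (A := H)
    simpa [LinearMap.rTensor] using this
  have h2 : TensorProduct.map (counit (R := ℂ) (A := H)) .id ∘ₗ comul = (TensorProduct.mk ℂ ℂ H 1) := by
    exact Coalgebra.rTensor_counit_comp_comul
  have h3 : TensorProduct.map ((LinearMap.mul' ℂ H) ∘ₗ TensorProduct.map (antipode ℂ) .id) .id ∘ₗ TensorProduct.map comul .id ∘ₗ comul = TensorProduct.mk ℂ H H 1 := by
    rw [← LinearMap.comp_assoc, ← TensorProduct.map_comp, LinearMap.comp_assoc, h]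
    rw [LinearMap.id_comp, ← LinearMap.id_comp (LinearMap.id (R := ℂ) (M := H)), TensorProduct.map_comp, LinearMap.comp_assoc, h2]
    ext x; simp
  rw [← LinearMap.comp_assoc, ← TensorProduct.map_comp, h3, LinearMap.id_comp]

/-- The map `p ⊗ ((q ⊗ r) ⊗ s) ↦ S q * r ⊗ S p * s`. -/
def antipodeAux : H ⊗[ℂ] ((H ⊗[ℂ] H) ⊗[ℂ] H) →ₗ[ℂ] H ⊗[ℂ] H :=
  LinearMap.mul' ℂ _ ∘ₗ TensorProduct.map (TensorProduct.map (antipode ℂ) (antipode ℂ) ∘ₗ (TensorProduct.comm ℂ H H).toLinearMap) .id ∘ₗ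
   (TensorProduct.assoc ℂ H H _).symm.toLinearMap ∘ₗ TensorProduct.map .id (TensorProduct.assoc ℂ H H H).toLinearMap

theorem comul_antipode_aux₂ : TensorProduct.map .id (TensorProduct.assoc ℂ H H H).toLinearMap ∘ₗ
   TensorProduct.map .id (TensorProduct.map comul .id ∘ₗ comul) ∘ₗ comul (R := ℂ) (A := H)
   = (TensorProduct.assoc ℂ H H _).toLinearMap ∘ₗ TensorProduct.map comul comul ∘ₗ comul := by
  simp only [coassoc_simps]

theorem antipodeAux_eq : antipodeAux = TensorProduct.comm ℂ H H ∘ₗ TensorProduct.map (LinearMap.mul' ℂ H ∘ₗ TensorProduct.map (antipode ℂ) .id) .id ∘ₗ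
    (TensorProduct.assoc ℂ H H H).symm.toLinearMap ∘ₗ TensorProduct.map .id (TensorProduct.comm ℂ H H).toLinearMap ∘ₗ
    TensorProduct.map .id (TensorProduct.map ((LinearMap.mul' ℂ H) ∘ₗ TensorProduct.map (antipode ℂ) .id) .id) := by
  ext p q r s
  simp [antipodeAux]

/-- The antipode reverses the comultiplication: `Δ (S a) = S a₂ ⊗ S a₁`. -/
theorem comul_antipode (a : H) : comul (R := ℂ) (antipode ℂ a) =
    TensorProduct.map (antipode ℂ) (antipode ℂ) (TensorProduct.comm ℂ H H (comul a)) := by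
  have key : WithConv.toConv (TensorProduct.map (antipode ℂ) (antipode ℂ) ∘ₗ (TensorProduct.comm ℂ H H).toLinearMap ∘ₗ comul (R := ℂ) (A := H)) *
     WithConv.toConv (comul (R := ℂ) (A := H)) = 1 := by
    apply WithConv.ofConv_injective
    have e1 : (WithConv.toConv (TensorProduct.map (antipode ℂ) (antipode ℂ) ∘ₗ (TensorProduct.comm ℂ H H).toLinearMap ∘ₗ comul (R := ℂ) (A := H)) *
     WithConv.toConv (comul (R := ℂ) (A := H))).ofConv = antipodeAux ∘ₗ TensorProduct.map .id (TensorProduct.map comul .id ∘ₗ comul) ∘ₗ comul (R := ℂ) (A := H) := by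
      simp only [antipodeAux, LinearMap.comp_assoc, comul_antipode_aux₂]
      simp only [LinearMap.convMul_def, ← LinearMap.comp_assoc]
      congr 1
      simp only [LinearMap.comp_assoc]
      congr 1
      ext x y
      simp
    rw [e1, antipodeAux_eq]
    simp only [LinearMap.comp_assoc]
    rw [comul_antipode_aux₁]
    ext x
    have := HopfAlgebra.mul_antipode_rTensor_comul_apply (R := ℂ) x
    have e2 : (TensorProduct.map (LinearMap.mul' ℂ H ∘ₗ TensorProduct.map (antipode ℂ) .id) .id ∘ₗ
    (TensorProduct.assoc ℂ H H H).symm.toLinearMap ∘ₗ TensorProduct.map .id (TensorProduct.comm ℂ H H).toLinearMap ∘ₗ TensorProduct.map .id (TensorProduct.mk ℂ H H 1))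
     = (TensorProduct.mk ℂ H H).flip 1 ∘ₗ LinearMap.mul' ℂ H ∘ₗ TensorProduct.map (antipode ℂ) .id := by
      ext; simp
    have e3 := congrArg (fun f => f (comul x)) e2
    simp only [LinearMap.comp_apply] at e3 ⊢
    rw [e3]
    have h4 : LinearMap.mul' ℂ H (TensorProduct.map (antipode ℂ) .id (comul x)) = algebraMap ℂ H (counit x) := this
    rw [h4]
    simp [LinearMap.convOne_def, Algebra.algebraMap_eq_smul_one, Algebra.TensorProduct.one_def]
  have := left_inv_eq_right_inv key (LinearMap.comul_right_inv (R := ℂ) (C := H))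
  have := congrArg (fun f => f.ofConv a) this
  simpa using this.symm

/-- The iterated comultiplication `a ↦ a₁ ⊗ (a₂ ⊗ a₃)`. -/
abbrev comul₃ : H →ₗ[ℂ] H ⊗[ℂ] (H ⊗[ℂ] H) := TensorProduct.map .id comul ∘ₗ comul

/-- The linear map on a threefold tensor product given by a trilinear function. -/
def trilin {H₁ H₂ H₃ M : Type*} [AddCommGroup H₁] [Module ℂ H₁] [AddCommGroup H₂] [Module ℂ H₂]
    [AddCommGroup H₃] [Module ℂ H₃] [AddCommGroup M] [Module ℂ M] (T : H₁ → H₂ → H₃ → M)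
    (h₁ : ∀ x x' y z, T (x + x') y z = T x y z + T x' y z) (h₁' : ∀ (c : ℂ) x y z, T (c • x) y z = c • T x y z)
    (h₂ : ∀ x y y' z, T x (y + y') z = T x y z + T x y' z) (h₂' : ∀ (c : ℂ) x y z, T x (c • y) z = c • T x y z)
    (h₃ : ∀ x y z z', T x y (z + z') = T x y z + T x y z') (h₃' : ∀ (c : ℂ) x y z, T x y (c • z) = c • T x y z) :
    H₁ ⊗[ℂ] (H₂ ⊗[ℂ] H₃) →ₗ[ℂ] M :=
  TensorProduct.lift
    { toFun := fun x => TensorProduct.lift (LinearMap.mk₂ ℂ (T x) (h₂ x) (fun c y z => h₂' c x y z) (h₃ x) (fun c y z => h₃' c x y z))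
      map_add' := fun x x' => by ext y z; simp [h₁]
      map_smul' := fun c x => by ext y z; simp [h₁'] }

/-- `twist x z f` is the functional `f (S z ? x)`, that is, `w ↦ f (S z * w * x)`. -/
def twist (x z : H) : Module.Dual ℂ H →ₗ[ℂ] Module.Dual ℂ H :=
  (LinearMap.mulLeft ℂ (antipode ℂ z) ∘ₗ LinearMap.mulRight ℂ x).dualMap

@[simp] theorem twist_apply (x z : H) (f : Module.Dual ℂ H) (w : H) : twist x z f w = f (antipode ℂ z * (w * x)) := rfl

/-- The map `x ⊗ (y ⊗ z) ↦ (g ⊗ b ↦ g (S z ? x) ⊗ y b)`. -/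
def adTriple : H ⊗[ℂ] (H ⊗[ℂ] H) →ₗ[ℂ] Module.End ℂ (Module.Dual ℂ H ⊗[ℂ] H) :=
  trilin (fun x y z => TensorProduct.map (twist x z) (LinearMap.mulLeft ℂ y))
    (fun x x' y z => by ext f b; simp [← TensorProduct.add_tmul]; congr 1; ext w; simp [mul_add])
    (fun c x y z => by ext f b; simp; congr 1; ext w; simp)
    (fun x y y' z => by ext f b; simp [add_mul, TensorProduct.tmul_add])
    (fun c x y z => by ext f b; simp)
    (fun x y z z' => by ext f b; simp [← TensorProduct.add_tmul]; congr 1; ext w; simp [add_mul])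
    (fun c x y z => by ext f b; simp; congr 1; ext w; simp)

@[simp] theorem trilin_tmul {H₁ H₂ H₃ M : Type*} [AddCommGroup H₁] [Module ℂ H₁] [AddCommGroup H₂] [Module ℂ H₂]
    [AddCommGroup H₃] [Module ℂ H₃] [AddCommGroup M] [Module ℂ M] (T : H₁ → H₂ → H₃ → M)
   (h₁ h₁' h₂ h₂' h₃ h₃') (x y z) : trilin T h₁ h₁' h₂ h₂' h₃ h₃' (x ⊗ₜ (y ⊗ₜ z)) = T x y z := by
  simp [trilin]

/-- The product of `H*`: `(f g) x = f x₁ * g x₂`. -/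
def convProd : Module.Dual ℂ H →ₗ[ℂ] Module.Dual ℂ H →ₗ[ℂ] Module.Dual ℂ H :=
  LinearMap.mk₂ ℂ (fun f g => LinearMap.mul' ℂ ℂ ∘ₗ TensorProduct.map f g ∘ₗ comul)
    (fun f f' g => by ext x; simp [TensorProduct.map_add_left])
    (fun c f g => by ext x; simp [TensorProduct.map_smul_left])
    (fun f g g' => by ext x; simp [TensorProduct.map_add_right])
    (fun c f g => by ext x; simp [TensorProduct.map_smul_right])

theorem convProd_eq (f g : Module.Dual ℂ H) : convProd f g =
   (WithConv.toConv f * WithConv.toConv g).ofConv := rfl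

theorem convProd_assoc (f g h : Module.Dual ℂ H) : convProd (convProd f g) h = convProd f (convProd g h) := by
  simp [convProd_eq, mul_assoc]

theorem convProd_counit (f : Module.Dual ℂ H) : convProd f counit = f := by
  have : WithConv.toConv (counit : H →ₗ[ℂ] ℂ) = 1 := rfl
  simp [convProd_eq, this]

theorem counit_convProd (f : Module.Dual ℂ H) : convProd counit f = f := by
  have : WithConv.toConv (counit : H →ₗ[ℂ] ℂ) = 1 := rfl
  simp [convProd_eq, this]

/-- Left multiplication by `f ⊗ 1` on the Drinfeld double: `g ⊗ b ↦ f g ⊗ b`. -/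
def mulFunctional : Module.Dual ℂ H →ₗ[ℂ] Module.End ℂ (Module.Dual ℂ H ⊗[ℂ] H) :=
  LinearMap.rTensorHom H ∘ₗ convProd

/-- Left multiplication by `ε ⊗ a` on the Drinfeld double:
`g ⊗ b ↦ g (S a₃ ? a₁) ⊗ a₂ b`. -/
def mulElement : H →ₗ[ℂ] Module.End ℂ (Module.Dual ℂ H ⊗[ℂ] H) := adTriple ∘ₗ comul₃

@[simp] theorem mulFunctional_tmul (f g : Module.Dual ℂ H) (a : H) : mulFunctional f (g ⊗ₜ a) = convProd f g ⊗ₜ a := rfl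

theorem adTriple_mul (s t : H ⊗[ℂ] (H ⊗[ℂ] H)) : adTriple (s * t) = adTriple s ∘ₗ adTriple t := by
  have : (LinearMap.mul ℂ _).compr₂ adTriple = ((LinearMap.mul ℂ (Module.End ℂ _)).compl₁₂ adTriple adTriple : H ⊗[ℂ] (H ⊗[ℂ] H) →ₗ[ℂ] _ →ₗ[ℂ] Module.End ℂ (Module.Dual ℂ H ⊗[ℂ] H)) := by
    ext x y z x' y' z' f b
    simp [adTriple]
    congr 1
    ext w
    simp [HopfAlgebra.antipode_mul_antidistrib, mul_assoc]
  exact congrArg (fun F => F s t) this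

theorem mulElement_mul (a b : H) : mulElement (a * b) = mulElement a ∘ₗ mulElement b := by
  change adTriple _ = adTriple _ ∘ₗ adTriple _
  rw [← adTriple_mul]
  congr 1
  have : ∀ s t : H ⊗[ℂ] H, TensorProduct.map .id comul (s * t) = TensorProduct.map .id comul s * TensorProduct.map .id (comul (R := ℂ) (A := H)) t := by
    intro s t
    exact map_mul (Algebra.TensorProduct.map (AlgHom.id ℂ H) (Bialgebra.comulAlgHom ℂ H)) s t
  simp [this]

theorem mulElement_one : mulElement (1 : H) = 1 := by
  ext f b
  simp [mulElement, Algebra.TensorProduct.one_def, adTriple]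
  congr 1
  ext w
  simp


theorem twist_add_left (x x' z : H) : twist (x + x') z = twist x z + twist x' z := by
  ext f w; simp [mul_add]
theorem twist_smul_left (c : ℂ) (x z : H) : twist (c • x) z = c • twist x z := by
  ext f w; simp
theorem twist_add_right (x z z' : H) : twist x (z + z') = twist x z + twist x z' := by
  ext f w; simp [add_mul]
theorem twist_smul_right (c : ℂ) (x z : H) : twist x (c • z) = c • twist x z := by
  ext f w; simp

/-- The map `x ⊗ (Y ⊗ z) ↦ mulFunctional (g (S z ? x)) ∘ adTriple Y`. -/
def straightenAux (g : Module.Dual ℂ H) : H ⊗[ℂ] ((H ⊗[ℂ] (H ⊗[ℂ] H)) ⊗[ℂ] H) →ₗ[ℂ] Module.End ℂ (Module.Dual ℂ H ⊗[ℂ] H) :=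
  trilin (fun x Y z => mulFunctional (twist x z g) ∘ₗ adTriple Y)
    (fun x x' y z => by simp [twist_add_left, LinearMap.add_comp])
    (fun c x y z => by simp [twist_smul_left, LinearMap.smul_comp])
    (fun x y y' z => by simp [LinearMap.comp_add])
    (fun c x y z => by simp [LinearMap.comp_smul])
    (fun x y z z' => by simp [twist_add_right, LinearMap.add_comp])
    (fun c x y z => by simp [twist_smul_right, LinearMap.smul_comp])

/-- A reassociation of a fivefold tensor product. -/
def reassoc : (H ⊗[ℂ] H) ⊗[ℂ] (H ⊗[ℂ] (H ⊗[ℂ] H)) →ₗ[ℂ] H ⊗[ℂ] ((H ⊗[ℂ] (H ⊗[ℂ] H)) ⊗[ℂ] H) :=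
  TensorProduct.map .id ((TensorProduct.assoc ℂ H (H ⊗[ℂ] H) H).symm.toLinearMap ∘ₗ 
   (TensorProduct.map .id (TensorProduct.assoc ℂ H H H).symm.toLinearMap)) ∘ₗ (TensorProduct.assoc ℂ H H _).toLinearMap

theorem comul_five : TensorProduct.map .id (TensorProduct.map comul₃ .id) ∘ₗ comul₃ (H := H)
  = reassoc ∘ₗ TensorProduct.map comul (TensorProduct.map .id comul) ∘ₗ comul₃ := by
  simp only [reassoc, comul₃, coassoc_simps]

theorem straightenAux_aux (g k : Module.Dual ℂ H) (y b : H) (s t : H ⊗[ℂ] H) :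
    straightenAux g (reassoc (s ⊗ₜ (y ⊗ₜ t))) (k ⊗ₜ b) = (LinearMap.mul' ℂ ℂ ∘ₗ TensorProduct.map g k ∘ₗ
      LinearMap.mulLeft ℂ (TensorProduct.map (antipode ℂ) (antipode ℂ) (TensorProduct.comm ℂ H H t)) ∘ₗ LinearMap.mulRight ℂ s ∘ₗ comul) ⊗ₜ (y * b) := by
  induction s with
  | zero => simp
  | add s s' h h' => 
    rw [TensorProduct.add_tmul, map_add, map_add, LinearMap.add_apply, h, h', ← TensorProduct.add_tmul]
    congr 1; ext w; simp [mul_add]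
  | tmul x₁ x₂ =>
    induction t with
    | zero => simp
    | add t t' h h' => 
      rw [TensorProduct.tmul_add, TensorProduct.tmul_add, map_add, map_add, LinearMap.add_apply, h, h', ← TensorProduct.add_tmul]
      congr 1; ext w; simp [add_mul]
    | tmul z₁ z₂ =>
      simp [straightenAux, reassoc, adTriple, convProd]
      congr 1
      simp only [← LinearMap.comp_assoc]
      congr 1
      ext u v
      simp

theorem straighten_aux (g : Module.Dual ℂ H) (w : H ⊗[ℂ] (H ⊗[ℂ] H)) :
    adTriple w ∘ₗ mulFunctional g = straightenAux g (reassoc (TensorProduct.map comul (TensorProduct.map .id comul) w)) := by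
  have : LinearMap.lcomp ℂ _ (mulFunctional g) ∘ₗ adTriple = straightenAux g ∘ₗ reassoc ∘ₗ TensorProduct.map comul (TensorProduct.map .id comul) := by
    ext x y z k b
    simp [straightenAux_aux]
    simp [adTriple]
    congr 1
    ext w
    simp [convProd, ← comul_antipode]
  exact congrArg (fun F => F w) this

theorem straighten (g : Module.Dual ℂ H) (a : H) :
    mulElement a ∘ₗ mulFunctional g = straightenAux g (TensorProduct.map .id (TensorProduct.map comul₃ .id) (comul₃ a)) := by
  have := congrArg (fun F => F a) (comul_five (H := H))
  simp only [LinearMap.comp_apply] at this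
  change adTriple (comul₃ a) ∘ₗ mulFunctional g = _
  rw [straighten_aux]
  simp [this]

/-- The multiplication of the Drinfeld double, given by the straightening equation
`(f ⊗ a) (g ⊗ b) = f g (S a₃ ? a₁) ⊗ a₂ b` (here `S⁻¹ = S`). -/
def doubleMul : (Module.Dual ℂ H ⊗[ℂ] H) →ₗ[ℂ] Module.End ℂ (Module.Dual ℂ H ⊗[ℂ] H) :=
  LinearMap.mul' ℂ _ ∘ₗ TensorProduct.map mulFunctional mulElement

theorem straightenAux_mul (g : Module.Dual ℂ H) (b : H) (w : H ⊗[ℂ] (H ⊗[ℂ] H)) :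
   doubleMul (adTriple w (g ⊗ₜ b)) = straightenAux g (TensorProduct.map .id (TensorProduct.map comul₃ .id) w) ∘ₗ mulElement b := by
  have : doubleMul ∘ₗ LinearMap.applyₗ (g ⊗ₜ b) ∘ₗ adTriple = LinearMap.lcomp ℂ _ (mulElement b) ∘ₗ straightenAux g ∘ₗ TensorProduct.map .id (TensorProduct.map comul₃ .id) := by
    apply TensorProduct.ext'
    intro x yz
    induction yz with
    | zero => simp
    | add s t h h' => simp only [TensorProduct.tmul_add, map_add, h, h']
    | tmul y z =>
      have hy : adTriple (TensorProduct.map .id comul (comul y)) = mulElement y := rfl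
      simp [adTriple, doubleMul, straightenAux, mulElement_mul]
      rw [← adTriple, hy]
      rfl
  exact congrArg (fun F => F w) this

theorem mulFunctional_mul (f g : Module.Dual ℂ H) : mulFunctional (convProd f g) = mulFunctional f ∘ₗ mulFunctional g := by
  ext k b
  simp [convProd_assoc]

theorem mulFunctional_doubleMul (f : Module.Dual ℂ H) (y) : doubleMul (mulFunctional f y) = mulFunctional f ∘ₗ doubleMul y := by
  induction y with
  | zero => simp
  | add s t h h' => simp only [map_add, h, h', LinearMap.comp_add]
  | tmul g b => simp [doubleMul, mulFunctional_mul]; rfl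

theorem doubleMul_assoc (x y) : doubleMul (doubleMul x y) = doubleMul (H := H) x ∘ₗ doubleMul y := by
  induction x with
  | zero => simp
  | add s t h h' => simp only [map_add, LinearMap.add_apply, h, h', LinearMap.add_comp]
  | tmul f a =>
    induction y with
    | zero => simp
    | add s t h h' => simp only [map_add, h, h', LinearMap.comp_add]
    | tmul g b =>
      have h1 : doubleMul (f ⊗ₜ a) = mulFunctional f ∘ₗ mulElement a := by simp [doubleMul]; rfl
      have h2 : doubleMul (g ⊗ₜ b) = mulFunctional g ∘ₗ mulElement b := by simp [doubleMul]; rfl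
      rw [h1, h2, LinearMap.comp_apply, mulFunctional_doubleMul, LinearMap.comp_assoc, ← LinearMap.comp_assoc (mulElement b), straighten, ← straightenAux_mul]
      rfl

theorem doubleMul_one_left (y) : doubleMul (counit ⊗ₜ (1 : H)) y = y := by
  induction y with
  | zero => simp
  | add s t h h' => simp only [map_add, h, h']
  | tmul g b => simp [doubleMul, mulElement_one, counit_convProd]


theorem mulElement_unit (b : H) : mulElement b (counit ⊗ₜ (1 : H)) = counit ⊗ₜ b := by
  have h1 : LinearMap.applyₗ ((counit ⊗ₜ (1 : H)) : Module.Dual ℂ H ⊗[ℂ] H) ∘ₗ adTriple =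
      TensorProduct.mk ℂ (Module.Dual ℂ H) H counit ∘ₗ (TensorProduct.lid ℂ H).toLinearMap ∘ₗ
        TensorProduct.map counit ((TensorProduct.rid ℂ H).toLinearMap ∘ₗ TensorProduct.map .id counit) := by
    ext x y z
    simp only [adTriple]
    simp
    rw [smul_smul, TensorProduct.smul_tmul']
    congr 1
    ext w
    simp
    ring
  have h2 := congrArg (fun F => F (comul₃ b)) h1
  have h3 : (TensorProduct.rid ℂ H).toLinearMap ∘ₗ TensorProduct.map .id counit ∘ₗ comul = (.id : H →ₗ[ℂ] H) := by
    have := Coalgebra.lTensor_counit_comp_comul (R := ℂ) (A := H)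
    rw [LinearMap.lTensor] at this
    rw [this]; ext; simp
  have h4 : (TensorProduct.lid ℂ H).toLinearMap ∘ₗ TensorProduct.map counit .id ∘ₗ comul = (.id : H →ₗ[ℂ] H) := by
    have := Coalgebra.rTensor_counit_comp_comul (R := ℂ) (A := H)
    rw [LinearMap.rTensor] at this
    rw [this]; ext; simp
  have h5 : TensorProduct.map counit ((TensorProduct.rid ℂ H).toLinearMap ∘ₗ TensorProduct.map .id counit) ∘ₗ comul₃ (H := H)
     = TensorProduct.map counit .id ∘ₗ comul := by
    rw [comul₃, ← LinearMap.comp_assoc, ← TensorProduct.map_comp, LinearMap.comp_assoc, h3]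
    rfl
  have h6 := congrArg (fun F => F b) h5
  have h7 := congrArg (fun F => F b) h4
  simp only [LinearMap.comp_apply, LinearMap.id_apply, LinearEquiv.coe_coe] at h2 h6 h7
  change adTriple (comul₃ b) _ = _
  rw [LinearMap.applyₗ_apply_apply] at h2
  simp only [LinearMap.comp_apply, comul₃] at h2 h6 ⊢
  rw [h2, h6, h7]
  rfl

theorem doubleMul_one_right (y) : doubleMul y (counit ⊗ₜ (1 : H)) = y := by
  induction y with
  | zero => simp
  | add s t h h' => simp only [map_add, LinearMap.add_apply, h, h']
  | tmul g b => simp [doubleMul, mulElement_unit, convProd_counit]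

end Preliminaries

/-! ## The Drinfeld double and its dual -/

section Double

/-- The Drinfeld double `D(H)` of a finite-dimensional Hopf algebra with involutive antipode.
As a vector space it is `H* ⊗ H`. -/
def DrinfeldDouble (H : Type*) [Ring H] [HopfAlgebra ℂ H] : Type _ := Module.Dual ℂ H ⊗[ℂ] H

variable {H : Type*} [Ring H] [HopfAlgebra ℂ H]

instance : AddCommGroup (DrinfeldDouble H) :=
  inferInstanceAs (AddCommGroup (Module.Dual ℂ H ⊗[ℂ] H))

instance : Module ℂ (DrinfeldDouble H) :=
  inferInstanceAs (Module ℂ (Module.Dual ℂ H ⊗[ℂ] H))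

/-- The underlying vector space of `D(H)` is `H* ⊗ H`. -/
def DrinfeldDouble.of : (Module.Dual ℂ H ⊗[ℂ] H) ≃ₗ[ℂ] DrinfeldDouble H := LinearEquiv.refl ℂ _

/-- The element `f ⊗ a` of `D(H)`. -/
def DrinfeldDouble.mk (f : Module.Dual ℂ H) (a : H) : DrinfeldDouble H :=
  DrinfeldDouble.of (f ⊗ₜ[ℂ] a)

instance : Mul (DrinfeldDouble H) :=
  ⟨fun x y => DrinfeldDouble.of (doubleMul (DrinfeldDouble.of.symm x) (DrinfeldDouble.of.symm y))⟩

instance : One (DrinfeldDouble H) := ⟨DrinfeldDouble.mk counit 1⟩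

theorem DrinfeldDouble.mul_def (x y : DrinfeldDouble H) :
    x * y = DrinfeldDouble.of
      (doubleMul (DrinfeldDouble.of.symm x) (DrinfeldDouble.of.symm y)) := rfl

instance : Ring (DrinfeldDouble H) :=
  { (inferInstance : AddCommGroup (DrinfeldDouble H)) with
    mul := (· * ·)
    one := 1
    mul_assoc := fun x y z =>
      congrArg (fun F : Module.End ℂ (Module.Dual ℂ H ⊗[ℂ] H) => F z) (doubleMul_assoc (H := H) x y)
    one_mul := fun x => doubleMul_one_left (H := H) x
    mul_one := fun x => doubleMul_one_right (H := H) x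
    zero_mul := fun x => by simp [DrinfeldDouble.mul_def]
    mul_zero := fun x => by simp [DrinfeldDouble.mul_def]
    left_distrib := fun x y z => by simp [DrinfeldDouble.mul_def]
    right_distrib := fun x y z => by simp [DrinfeldDouble.mul_def] }

instance : Algebra ℂ (DrinfeldDouble H) :=
  Algebra.ofModule (fun c x y => by simp [DrinfeldDouble.mul_def])
    (fun c x y => by simp [DrinfeldDouble.mul_def])

/-- The antipode of `D(H)`: `S (f ⊗ a) = (ε ⊗ S a) (f ∘ S ⊗ 1)`. -/
def DrinfeldDouble.antipode : DrinfeldDouble H →ₗ[ℂ] DrinfeldDouble H :=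
  LinearMap.mul' ℂ (DrinfeldDouble H) ∘ₗ
    TensorProduct.map
      (DrinfeldDouble.of.toLinearMap ∘ₗ TensorProduct.mk ℂ (Module.Dual ℂ H) H counit ∘ₗ
        HopfAlgebra.antipode ℂ)
      (DrinfeldDouble.of.toLinearMap ∘ₗ (TensorProduct.mk ℂ (Module.Dual ℂ H) H).flip 1 ∘ₗ
        (HopfAlgebra.antipode ℂ (A := H)).dualMap) ∘ₗ
    (TensorProduct.comm ℂ (Module.Dual ℂ H) H).toLinearMap ∘ₗ DrinfeldDouble.of.symm.toLinearMap

/-- The identification `H ⊗ H* → D(H)*`, with `(h ⊗ f) (g ⊗ a) = g h * f a`. -/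
def toDualDouble : H ⊗[ℂ] Module.Dual ℂ H →ₗ[ℂ] Module.Dual ℂ (DrinfeldDouble H) :=
  (DrinfeldDouble.of (H := H)).symm.dualMap.toLinearMap ∘ₗ
    TensorProduct.dualDistrib ℂ (Module.Dual ℂ H) H ∘ₗ
    TensorProduct.map (Module.Dual.eval ℂ H) .id

/-- The action `L` on `D(H)*` induced by left multiplication: `L m ξ = ξ (S m ?)`. -/
def actL (m : DrinfeldDouble H) : Module.End ℂ (Module.Dual ℂ (DrinfeldDouble H)) :=
  (LinearMap.mulLeft ℂ (DrinfeldDouble.antipode m)).dualMap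

/-- The action `R` on `D(H)*` induced by right multiplication: `R m ξ = ξ (? m)`. -/
def actR (m : DrinfeldDouble H) : Module.End ℂ (Module.Dual ℂ (DrinfeldDouble H)) :=
  (LinearMap.mulRight ℂ m).dualMap

/-- The map `x ⊗ (y ⊗ z) ↦ (k ⊗ f ↦ S z * k * x ⊗ f (y ?))`. -/
def coadTriple : H ⊗[ℂ] (H ⊗[ℂ] H) →ₗ[ℂ] Module.End ℂ (H ⊗[ℂ] Module.Dual ℂ H) :=
  trilin (H₁ := H) (H₂ := H) (H₃ := H) (M := Module.End ℂ (H ⊗[ℂ] Module.Dual ℂ H))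
    (fun x y z => TensorProduct.map
      (LinearMap.mulLeft ℂ (HopfAlgebra.antipode ℂ z) ∘ₗ LinearMap.mulRight ℂ x)
      (LinearMap.mulLeft ℂ y).dualMap)
    (fun x x' y z => by ext k f; simp [mul_add, TensorProduct.add_tmul])
    (fun c x y z => by ext k f; simp [TensorProduct.smul_tmul'])
    (fun x y y' z => by
      ext k f; simp [← TensorProduct.tmul_add]; congr 1; ext w; simp [add_mul])
    (fun c x y z => by
      ext k f; simp [← TensorProduct.tmul_smul]; congr 1; ext w; simp)
    (fun x y z z' => by ext k f; simp [add_mul, TensorProduct.add_tmul])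
    (fun c x y z => by ext k f; simp [TensorProduct.smul_tmul'])

variable [FiniteDimensional ℂ H]

/-- The comultiplication of `D(H)* = H ⊗ H*`:
`Δ (h ⊗ f) = ∑ᵢ (h₁ ⊗ gᵢ) ⊗ (S i₃ * h₂ * i₁ ⊗ f (i₂ ?))`, where `i` runs over a basis of `H` and
`gᵢ` over the dual basis. (It does not depend on the basis.) -/
def dualDoubleComul : H ⊗[ℂ] Module.Dual ℂ H →ₗ[ℂ]
    (H ⊗[ℂ] Module.Dual ℂ H) ⊗[ℂ] (H ⊗[ℂ] Module.Dual ℂ H) :=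
  ∑ i, TensorProduct.map
      ((TensorProduct.mk ℂ H (Module.Dual ℂ H)).flip ((Module.finBasis ℂ H).coord i))
      (coadTriple (comul₃ (Module.finBasis ℂ H i))) ∘ₗ
    (TensorProduct.assoc ℂ H H (Module.Dual ℂ H)).toLinearMap ∘ₗ
    TensorProduct.map comul .id

/-- The counit of `D(H)* = H ⊗ H*`: `h ⊗ f ↦ ε h * f 1`. -/
def dualDoubleCounit : H ⊗[ℂ] Module.Dual ℂ H →ₗ[ℂ] ℂ :=
  LinearMap.mul' ℂ ℂ ∘ₗ TensorProduct.map counit (Module.Dual.eval ℂ H 1)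

end Double

/-! ## Representations of the Drinfeld double -/

section Reps

variable {H : Type*} [Ring H] [HopfAlgebra ℂ H]

/-- A representation of `D(H)` on `W`. -/
abbrev DoubleRep (H : Type*) [Ring H] [HopfAlgebra ℂ H] (W : Type*) [AddCommGroup W] [Module ℂ W] :=
  DrinfeldDouble H →ₐ[ℂ] Module.End ℂ W

variable {W W' : Type*} [AddCommGroup W] [Module ℂ W] [AddCommGroup W'] [Module ℂ W']

/-- Irreducibility: nonzero, and without proper nonzero invariant subspaces. -/
def DoubleRep.IsIrreducible (μ : DoubleRep H W) : Prop :=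
  Nontrivial W ∧ ∀ U : Submodule ℂ W, (∀ m, ∀ u ∈ U, μ m u ∈ U) → U = ⊥ ∨ U = ⊤

/-- Isomorphism of representations. -/
def DoubleRep.IsIso (μ : DoubleRep H W) (ν : DoubleRep H W') : Prop :=
  ∃ e : W ≃ₗ[ℂ] W', ∀ m w, e (μ m w) = ν m (e w)

/-- The action of `m` on the dual representation: `m . f = f ∘ μ (S m)`. -/
def DoubleRep.dualAction (μ : DoubleRep H W) (m : DrinfeldDouble H) :
    Module.End ℂ (Module.Dual ℂ W) :=
  (μ (DrinfeldDouble.antipode m)).dualMap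

/-- A finite family of finite-dimensional representations is a complete set of irreducible
representations if its members are irreducible and pairwise nonisomorphic and every
finite-dimensional irreducible representation is isomorphic to one of them. -/
def IsCompleteIrreps {n : ℕ} {d : Fin n → ℕ} (μ : ∀ i, DoubleRep H (Fin (d i) → ℂ)) : Prop :=
  (∀ i, (μ i).IsIrreducible) ∧
  (∀ i j, (μ i).IsIso (μ j) → i = j) ∧
  ∀ (k : ℕ) (ν : DoubleRep H (Fin k → ℂ)), ν.IsIrreducible → ∃ i, ν.IsIso (μ i)

/-- An excitation sector for two representations `ρ₀`, `ρ₁` of `D(H)` on the same space: a minimal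
nonzero subspace invariant under both. -/
def IsSector (ρ₀ ρ₁ : DoubleRep H W) (U : Submodule ℂ W) : Prop :=
  Minimal (fun U' : Submodule ℂ W =>
    U' ≠ ⊥ ∧ (∀ m, ∀ u ∈ U', ρ₀ m u ∈ U') ∧ ∀ m, ∀ u ∈ U', ρ₁ m u ∈ U') U

end Reps

/-! ## Lattices on closed oriented surfaces -/

/-- A dart: an edge together with one of its two directions; `(e, true)` is `e` traversed in its
given direction. -/
abbrev Dart (E : Type*) := E × Bool

/-- The opposite dart. -/
def Dart.rev {E : Type*} : Equiv.Perm (Dart E) :=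
  (Equiv.refl E).prodCongr Equiv.boolNot

/-- A lattice (cell decomposition of a closed oriented surface, with directed edges `E`), given
by its rotation system: `rot d` is the next dart after `d`, counterclockwise around the initial
vertex of `d`. Vertices are the cycles of `rot`. The face to the left of a dart `d` is traversed
counterclockwise by iterating `rot⁻¹ ∘ rev`, so faces are the cycles of that permutation.
Every edge has two distinct end points and two distinct adjacent faces. -/
structure Lattice (E : Type*) where
  rot : Equiv.Perm (Dart E)
  ends_ne : ∀ d, ¬ rot.SameCycle d (Dart.rev d)
  sides_ne : ∀ d, ¬ (rot⁻¹ * Dart.rev).SameCycle d (Dart.rev d)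

namespace Lattice

variable {E : Type*} (Γ : Lattice E)

/-- The next dart counterclockwise along the boundary of the face to the left. -/
def next : Equiv.Perm (Dart E) := Γ.rot⁻¹ * Dart.rev

/-- A site is a pair of a vertex and an adjacent face, that is, a corner of the lattice. It is
encoded by a dart `d`: the vertex is the initial vertex of `d`, the face is the one to the left of
`d`, and the corner lies between `d` and `rot d`. -/
abbrev Site (_Γ : Lattice E) := Dart E

/-- The two sites have the same vertex. -/
def SameVertex (s s' : Γ.Site) : Prop := Γ.rot.SameCycle s s'

/-- The two sites have the same face. -/
def SameFace (s s' : Γ.Site) : Prop := Γ.next.SameCycle s s'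

/-- The darts leaving the vertex of `s`, counterclockwise starting from the corner `s`. -/
def vertexDarts (s : Γ.Site) : List (Dart E) :=
  (List.range (Function.minimalPeriod Γ.rot s)).map fun k => (Γ.rot ^ (k + 1)) s

/-- The boundary of the face of `s`, counterclockwise starting from the corner `s`. -/
def faceDarts (s : Γ.Site) : List (Dart E) :=
  (List.range (Function.minimalPeriod Γ.next s)).map fun k => (Γ.next ^ k) s

end Lattice

/-- The type of a triangle: direct if its third side is an edge of the lattice (both sites share
the face), dual if it is an edge of the dual lattice (both sites share the vertex). -/
inductive TriangleType
  | direct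
  | dual

/-- Local orientation: whether a clockwise or a counterclockwise rotation of the initial site
around its face centre immediately sweeps through the triangle. -/
inductive LocalOrientation
  | clockwise
  | counterclockwise

/-- A directed triangle, determined by its initial site, its type and its local orientation. -/
structure Triangle {E : Type*} (Γ : Lattice E) where
  initial : Γ.Site
  type : TriangleType
  orientation : LocalOrientation

namespace Triangle

variable {E : Type*} {Γ : Lattice E}

/-- The terminal site. -/
def final (t : Triangle Γ) : Γ.Site :=
  match t.type, t.orientation with
  | .direct, .clockwise => Γ.next⁻¹ t.initial
  | .direct, .counterclockwise => Γ.next t.initial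
  | .dual, .clockwise => Γ.rot t.initial
  | .dual, .counterclockwise => Γ.rot⁻¹ t.initial

/-- The dart, leaving the initial vertex, of the edge on which the triangle acts. A direct triangle
runs along this dart, the third side of a dual triangle crosses it. -/
def dart (t : Triangle Γ) : Dart E :=
  match t.orientation with
  | .clockwise => Γ.rot t.initial
  | .counterclockwise => t.initial

/-- The region covered by a triangle. The two diagonals of the quadrangle spanned by an edge and its
dual edge cut it into four quarters; `(d, true)` and `(d, false)` are the quarters of the edge
of `d` at the initial vertex of `d` on the left and on the right of `d`. -/
def region (t : Triangle Γ) : Set (Dart E × Bool) :=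
  match t.type, t.orientation with
  | .direct, .clockwise => {(t.dart, false), (Dart.rev t.dart, true)}
  | .direct, .counterclockwise => {(t.dart, true), (Dart.rev t.dart, false)}
  | .dual, _ => {(t.dart, true), (t.dart, false)}

end Triangle

/-- A directed ribbon: a nonempty sequence of mutually nonoverlapping directed triangles, each
starting at the terminal site of its predecessor. (Then all triangles have the same local
orientation.) -/
structure Ribbon {E : Type*} (Γ : Lattice E) where
  triangles : List (Triangle Γ)
  ne_nil : triangles ≠ []
  chain : triangles.IsChain fun t t' => t.final = t'.initial
  nonoverlapping : triangles.Pairwise fun t t' => Disjoint t.region t'.region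

/-- The initial site of a ribbon. -/
def Ribbon.initial {E : Type*} {Γ : Lattice E} (τ : Ribbon Γ) : Γ.Site :=
  (τ.triangles.head τ.ne_nil).initial

/-- The terminal site of a ribbon. -/
def Ribbon.final {E : Type*} {Γ : Lattice E} (τ : Ribbon Γ) : Γ.Site :=
  (τ.triangles.getLast τ.ne_nil).final

/-! ## Operators on the state space -/

section EdgeOperators

variable {H : Type*} [Ring H] [HopfAlgebra ℂ H]

/-- `f ↦ (x ↦ f x₁ • x₂)`. -/
def readFst : Module.Dual ℂ H →ₗ[ℂ] Module.End ℂ H where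
  toFun f := (TensorProduct.lid ℂ H).toLinearMap ∘ₗ TensorProduct.map f .id ∘ₗ comul
  map_add' f g := by ext x; simp [TensorProduct.map_add_left]
  map_smul' c f := by ext x; simp [TensorProduct.map_smul_left]

/-- `f ↦ (x ↦ f x₂ • x₁)`. -/
def readSnd : Module.Dual ℂ H →ₗ[ℂ] Module.End ℂ H where
  toFun f := (TensorProduct.rid ℂ H).toLinearMap ∘ₗ TensorProduct.map .id f ∘ₗ comul
  map_add' f g := by ext x; simp [TensorProduct.map_add_right]
  map_smul' c f := by ext x; simp [TensorProduct.map_smul_right]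

/-- `f ↦ f ∘ S`. -/
def dualAntipode : Module.Dual ℂ H →ₗ[ℂ] Module.Dual ℂ H := (antipode ℂ (A := H)).dualMap

/-- `a ↦ (x ↦ a * x)`. -/
def mulLeftOp : H →ₗ[ℂ] Module.End ℂ H := LinearMap.mul ℂ H

/-- `a ↦ (x ↦ x * a)`. -/
def mulRightOp : H →ₗ[ℂ] Module.End ℂ H := (LinearMap.mul ℂ H).flip

/-- The edge operators `L₊ a x = a x` and `L₋ a x = x S(a)`. -/
def edgeL : Bool → H →ₗ[ℂ] Module.End ℂ H
  | true => mulLeftOp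
  | false => mulRightOp ∘ₗ antipode ℂ

/-- The edge operators `T₊ f x = f(x₂) x₁` and `T₋ f x = f(S x₁) x₂`. -/
def edgeT : Bool → Module.Dual ℂ H →ₗ[ℂ] Module.End ℂ H
  | true => readSnd
  | false => readFst ∘ₗ dualAntipode

/-- The part of the operator of a direct triangle depending on `f`; the flag says whether the edge
and the triangle are parallel (`true`) or opposite. -/
def directOp : LocalOrientation → Bool → Module.Dual ℂ H →ₗ[ℂ] Module.End ℂ H
  | .clockwise, true => readFst
  | .clockwise, false => readSnd ∘ₗ dualAntipode
  | .counterclockwise, true => readSnd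
  | .counterclockwise, false => readFst ∘ₗ dualAntipode

/-- The part of the operator of a dual triangle depending on `h`; the flag says whether the crossed
edge leaves (`true`) or enters the vertex of the triangle. -/
def dualOp : LocalOrientation → Bool → H →ₗ[ℂ] Module.End ℂ H
  | .clockwise, true => mulLeftOp
  | .clockwise, false => mulRightOp ∘ₗ antipode ℂ
  | .counterclockwise, true => mulLeftOp ∘ₗ antipode ℂ
  | .counterclockwise, false => mulRightOp

end EdgeOperators

/-- The total state space, one tensor factor `H` for every edge. -/
abbrev StateSpace (E H : Type*) [Ring H] [HopfAlgebra ℂ H] : Type _ := ⨂[ℂ] _ : E, H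

section Operators

variable {E : Type*} [DecidableEq E] {H : Type*} [Ring H] [HopfAlgebra ℂ H]

/-- An operator on the tensor factor of the edge `e`, extended by the identity. -/
def onEdge (e : E) : Module.End ℂ H →ₗ[ℂ] Module.End ℂ (StateSpace E H) :=
  (PiTensorProduct.mapMultilinear ℂ (fun _ : E => H) (fun _ : E => H)).toLinearMap
    (fun _ => LinearMap.id) e

/-- `a ↦ L(a₁) ⊗ ⋯ ⊗ L(aₙ)`, the edge operators acting on the edges of the given darts in order,
with sign `+` for darts in the direction of their edge. -/
def vertexOpList : List (Dart E) → H →ₗ[ℂ] Module.End ℂ (StateSpace E H)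
  | [] => (counit : H →ₗ[ℂ] ℂ).smulRight 1
  | d :: l => LinearMap.mul' ℂ (Module.End ℂ (StateSpace E H)) ∘ₗ
      TensorProduct.map (onEdge d.1 ∘ₗ edgeL d.2) (vertexOpList l) ∘ₗ comul

/-- The local operator `A_a(s)`. -/
def opA (Γ : Lattice E) (s : Γ.Site) : H →ₗ[ℂ] Module.End ℂ (StateSpace E H) :=
  vertexOpList (Γ.vertexDarts s)

variable [FiniteDimensional ℂ H]

/-- `f ↦ T(f₁) ⊗ ⋯ ⊗ T(fₙ)`, the edge operators acting on the edges of the given darts in order,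
with sign `+` for darts in the direction of their edge. Here the comultiplication of `H*`, which is
dual to the multiplication of `H`, is written as `f₁ ⊗ f₂ = ∑ᵢ gᵢ ⊗ f (i ?)` with a basis `i` of
`H` and its dual basis `gᵢ`. -/
def faceOpList : List (Dart E) → Module.Dual ℂ H →ₗ[ℂ] Module.End ℂ (StateSpace E H)
  | [] => (Module.Dual.eval ℂ H 1).smulRight 1
  | d :: l => ∑ i, LinearMap.mulLeft ℂ (onEdge d.1 (edgeT d.2 ((Module.finBasis ℂ H).coord i))) ∘ₗ
      faceOpList l ∘ₗ (LinearMap.mulLeft ℂ (Module.finBasis ℂ H i)).dualMap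

/-- The local operator `B_f(s)`. -/
def opB (Γ : Lattice E) (s : Γ.Site) : Module.Dual ℂ H →ₗ[ℂ] Module.End ℂ (StateSpace E H) :=
  faceOpList (Γ.faceDarts s)

/-- The operator of a triangle: `h ⊗ f ↦ ε(h) • directOp f` or `h ⊗ f ↦ f(1) • dualOp h`. -/
def triangleOp {Γ : Lattice E} (t : Triangle Γ) :
    H ⊗[ℂ] Module.Dual ℂ H →ₗ[ℂ] Module.End ℂ (StateSpace E H) :=
  match t.type with
  | .direct => onEdge t.dart.1 ∘ₗ directOp t.orientation t.dart.2 ∘ₗ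
      (TensorProduct.lid ℂ (Module.Dual ℂ H)).toLinearMap ∘ₗ TensorProduct.map counit .id
  | .dual => onEdge t.dart.1 ∘ₗ dualOp t.orientation t.dart.2 ∘ₗ
      (TensorProduct.rid ℂ H).toLinearMap ∘ₗ TensorProduct.map .id (Module.Dual.eval ℂ H 1)

/-- The operator of a sequence of triangles, `F^ξ(t τ) = F^{ξ₁}(t) F^{ξ₂}(τ)`, with the
comultiplication of `D(H)*`. -/
def ribbonOpList {Γ : Lattice E} : List (Triangle Γ) →
    H ⊗[ℂ] Module.Dual ℂ H →ₗ[ℂ] Module.End ℂ (StateSpace E H)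
  | [] => dualDoubleCounit.smulRight 1
  | t :: l => LinearMap.mul' ℂ (Module.End ℂ (StateSpace E H)) ∘ₗ
      TensorProduct.map (triangleOp t) (ribbonOpList l) ∘ₗ dualDoubleComul

/-- The ribbon operator `F^{h ⊗ f}(τ)`. -/
def ribbonOp {Γ : Lattice E} (τ : Ribbon Γ) :
    H ⊗[ℂ] Module.Dual ℂ H →ₗ[ℂ] Module.End ℂ (StateSpace E H) :=
  ribbonOpList τ.triangles

/-- The Haar integral of `H`. -/
def IsHaarIntegral (h₀ : H) : Prop :=
  (∀ a : H, a * h₀ = counit (R := ℂ) a • h₀ ∧ h₀ * a = counit (R := ℂ) a • h₀) ∧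
    counit (R := ℂ) h₀ = 1

/-- The Haar integral of `H*`. -/
def IsDualHaarIntegral (φ : Module.Dual ℂ H) : Prop :=
  (∀ f : Module.Dual ℂ H, convProd f φ = f 1 • φ ∧ convProd φ f = f 1 • φ) ∧ φ 1 = 1

/-- A ground state: a nonzero vector stabilized by all terms `A_{h₀}(s)` and `B_φ(s)` of the
Hamiltonian, where `h₀` and `φ` are the (unique) Haar integrals of `H` and `H*`. -/
def IsGroundState (Γ : Lattice E) (Ω : StateSpace E H) : Prop :=
  Ω ≠ 0 ∧ ∃ (h₀ : H) (φ : Module.Dual ℂ H), IsHaarIntegral h₀ ∧ IsDualHaarIntegral φ ∧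
    ∀ s : Γ.Site, opA Γ s h₀ Ω = Ω ∧ opB Γ s φ Ω = Ω

/-- The space `V_τ` spanned by the states `F^{h ⊗ f}(τ) Ω`. -/
def ribbonSpace {Γ : Lattice E} (τ : Ribbon Γ) (Ω : StateSpace E H) :
    Submodule ℂ (StateSpace E H) :=
  Submodule.span ℂ (Set.range fun p : H × Module.Dual ℂ H => ribbonOp τ (p.1 ⊗ₜ[ℂ] p.2) Ω)

end Operators

end

end KitaevHopf

/-!
# Excitation types of the Kitaev model of a semisimple Hopf algebra

*Universal ribbon operators.* The family `ξ ↦ F^ξ(τ)`, indexed by the functionals `ξ` on `D(H)`, is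
the same as one operator `ribbonElem` with coefficients in `D(H)`, to which `ξ` is applied
(`ribbonOpList_eq`). The comultiplication of `D(H)*` is dual to the product of `D(H)`, so the
universal operator of a ribbon is simply the product of those of its triangles. A counterclockwise
triangle is inverse to the clockwise triangle that runs back, hence every universal ribbon operator
is invertible (`ribbonElem_isUnit`), and both local orientations are covered by one computation.

*Local operators.* Viewed as elements of the convolution algebra of maps out of `H`, respectively of
a tensor product with `H`, the operators `A_a(s)` and `B_f(s)` are words with one letter for each
edge at the vertex, respectively around the face, of `s`. Commuting a triangle past such a word moves
a letter with values in `D(H)`, the leg, along the word, from the corner of the initial site of the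
triangle to the corner of its terminal site (`ForwardStep`, `BackwardStep`). The relations needed
for this on a single edge reduce to the exchange relation `a₁ g(a₂ ?) = g(? a₁) a₂` in `D(H)`.
Since triangles do not overlap, a ribbon visits each of its end sites only once, and therefore
its only effect on the words is to absorb a leg at the initial site and to emit one at the final
site. On a ground state the local operators act by the counits, and what remains is that local
operators at the two ends act on `F^ξ(τ) Ω` by left and right multiplication in `D(H)`
(`opB_opA_initial`, `opB_opA_final`).

*Injectivity.* If `F^ξ(τ) Ω = 0`, the same holds for all `L(m) ξ`. Inverting the universal ribbon
operator gives `ξ(n) Ω = 0` for all `n`, hence `ξ = 0` (`stateMap_injective`).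

*Decomposition.* So `V_τ` is `D(H)*` with the actions `L` and `R`. The Haar integrals compute the
trace of the regular representation of `D(H)` as `f ⊗ a ↦ f(h₀) φ(a)` up to a nonzero factor. Its
trace form is nondegenerate, and `D(H)` is semisimple (`isSemisimpleRing_double`). By Wedderburn's
theorem it is a product of matrix algebras, whose matrix coefficients `x ↦ l (μᵢ(S x) w)` identify
`⨁ μᵢ ⊗ μᵢ*` with `D(H)*` (`peterWeyl`). Matrix units acting on both sides show that an invariant
subspace contains every summand on which it does not vanish (`summand_le`).
-/

namespace KitaevHopf

noncomputable section

/-! ### Involutive antipodes and convolution inverses -/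

section Antipode

open WithConv

variable {H : Type*} [Ring H] [HopfAlgebra ℂ H]

theorem counit_smul_sum {ι : Type*} {a : H} (𝓡 : Coalgebra.Repr ℂ a ι) {M : Type*} [AddCommGroup M]
    [Module ℂ M] (g : H →ₗ[ℂ] M) :
    ∑ i ∈ 𝓡.index, counit (R := ℂ) (𝓡.left i) • g (𝓡.right i) = g a := by
  have := congrArg g (Coalgebra.sum_counit_smul 𝓡)
  simpa using this

theorem smul_counit_sum {ι : Type*} {a : H} (𝓡 : Coalgebra.Repr ℂ a ι) {M : Type*} [AddCommGroup M]
    [Module ℂ M] (g : H →ₗ[ℂ] M) :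
    ∑ i ∈ 𝓡.index, counit (R := ℂ) (𝓡.right i) • g (𝓡.left i) = g a := by
  have h := Coalgebra.lTensor_counit_comul (R := ℂ) a
  rw [← 𝓡.eq, map_sum] at h
  have := congrArg (g ∘ₗ (TensorProduct.rid ℂ H).toLinearMap) h
  simp only [map_sum] at this
  simpa using this

/-- The identity `a₂ S(a₁) = ε(a)`, which depends on `S² = id`. -/
theorem sum_right_mul_antipode_left (hS : ∀ a : H, antipode ℂ (antipode ℂ a) = a) {ι : Type*}
    {a : H} (𝓡 : Coalgebra.Repr ℂ a ι) :
    ∑ i ∈ 𝓡.index, 𝓡.right i * antipode ℂ (𝓡.left i) = counit (R := ℂ) a • (1 : H) := by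
  have := congrArg (antipode ℂ) (sum_mul_antipode_eq_smul (R := ℂ) 𝓡)
  simpa [antipode_mul_antidistrib, hS, antipode_one] using this

/-- The identity `S(a₂) a₁ = ε(a)`, which depends on `S² = id`. -/
theorem sum_antipode_right_mul_left (hS : ∀ a : H, antipode ℂ (antipode ℂ a) = a) {ι : Type*}
    {a : H} (𝓡 : Coalgebra.Repr ℂ a ι) :
    ∑ i ∈ 𝓡.index, antipode ℂ (𝓡.right i) * 𝓡.left i = counit (R := ℂ) a • (1 : H) := by
  have := congrArg (antipode ℂ) (sum_antipode_mul_eq_smul (R := ℂ) 𝓡)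
  simpa [antipode_mul_antidistrib, hS, antipode_one] using this

/-- The comultiplication of `S a`, from a representation of the comultiplication of `a`. -/
def antipodeRepr {ι : Type*} {a : H} (𝓡 : Coalgebra.Repr ℂ a ι) :
    Coalgebra.Repr ℂ (antipode ℂ a) ι where
  index := 𝓡.index
  left i := antipode ℂ (𝓡.right i)
  right i := antipode ℂ (𝓡.left i)
  eq := by rw [comul_antipode, ← 𝓡.eq]; simp

variable {X : Type*} [Ring X] [Algebra ℂ X]

/-- An algebra map `φ` is invertible under convolution, with inverse `φ ∘ S`. -/
theorem conv_mul_antipode (φ : H →ₐ[ℂ] X) :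
    toConv φ.toLinearMap * toConv (φ.toLinearMap ∘ₗ antipode ℂ) = 1 := by
  ext a
  rw [(ℛ ℂ a).convMul_apply]
  simp only [LinearMap.comp_apply, AlgHom.toLinearMap_apply, ← map_mul, ← map_sum]
  rw [sum_mul_antipode_eq_smul]
  simp [Algebra.algebraMap_eq_smul_one]

theorem conv_antipode_mul (φ : H →ₐ[ℂ] X) :
    toConv (φ.toLinearMap ∘ₗ antipode ℂ) * toConv φ.toLinearMap = 1 := by
  ext a
  rw [(ℛ ℂ a).convMul_apply]
  simp only [LinearMap.comp_apply, AlgHom.toLinearMap_apply, ← map_mul, ← map_sum]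
  rw [sum_antipode_mul_eq_smul]
  simp [Algebra.algebraMap_eq_smul_one]

/-- For an anti-homomorphism `φ`, the map `φ ∘ S` is still a convolution inverse when `S² = id`. -/
theorem conv_antipode_mul_of_anti (hS : ∀ a : H, antipode ℂ (antipode ℂ a) = a)
    (φ : H →ₗ[ℂ] X) (h1 : φ 1 = 1) (hm : ∀ a b, φ (a * b) = φ b * φ a) :
    toConv (φ ∘ₗ antipode ℂ) * toConv φ = 1 := by
  ext a
  rw [(ℛ ℂ a).convMul_apply]
  simp only [LinearMap.comp_apply, ← hm, ← map_sum]
  rw [sum_right_mul_antipode_left hS]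
  simp [Algebra.algebraMap_eq_smul_one, h1]

theorem conv_mul_cancel (u v w w' : WithConv (H →ₗ[ℂ] X)) (h : w * w' = 1) :
    u * (v * w) * w' = u * v := by
  rw [mul_assoc, mul_assoc, h, mul_one]

end Antipode

/-! ### The Drinfeld double as an algebra generated by `H` and `H*` -/

section DoubleGenerators

open WithConv

variable {H : Type*} [Ring H] [HopfAlgebra ℂ H]

theorem doubleMul_tmul (f : Module.Dual ℂ H) (a : H) :
    doubleMul (f ⊗ₜ[ℂ] a) = mulFunctional f ∘ₗ mulElement a := by
  simp [doubleMul]; rfl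

/-- The inclusion `a ↦ ε ⊗ a` of `H` into its double. -/
def inclH : H →ₐ[ℂ] DrinfeldDouble H :=
  AlgHom.ofLinearMap
    (DrinfeldDouble.of.toLinearMap ∘ₗ TensorProduct.mk ℂ (Module.Dual ℂ H) H counit)
    rfl (fun a b => by
      have h1 : mulFunctional (counit : H →ₗ[ℂ] ℂ) = LinearMap.id := by
        ext f b; simp [counit_convProd]
      change DrinfeldDouble.of _ = DrinfeldDouble.of _
      congr 1
      change counit ⊗ₜ[ℂ] (a * b) = doubleMul (counit ⊗ₜ[ℂ] a) (counit ⊗ₜ[ℂ] b)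
      rw [doubleMul_tmul, h1, LinearMap.id_comp, ← mulElement_unit, mulElement_mul,
        LinearMap.comp_apply, mulElement_unit])

/-- The inclusion `f ↦ f ⊗ 1` of `H*` into the double. -/
def inclDual : Module.Dual ℂ H →ₗ[ℂ] DrinfeldDouble H :=
  DrinfeldDouble.of.toLinearMap ∘ₗ (TensorProduct.mk ℂ (Module.Dual ℂ H) H).flip 1

theorem inclH_apply (a : H) : inclH a = DrinfeldDouble.mk counit a := rfl

theorem inclDual_apply (f : Module.Dual ℂ H) : inclDual f = DrinfeldDouble.mk f 1 := rfl

theorem inclDual_mul_mk (f g : Module.Dual ℂ H) (a : H) :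
    inclDual f * DrinfeldDouble.mk g a = DrinfeldDouble.mk (convProd f g) a := by
  change DrinfeldDouble.of (doubleMul (f ⊗ₜ[ℂ] 1) (g ⊗ₜ[ℂ] a)) = DrinfeldDouble.of _
  rw [doubleMul_tmul, mulElement_one]
  rfl

theorem inclH_mul (a : H) (x : DrinfeldDouble H) :
    inclH a * x = DrinfeldDouble.of (mulElement a (DrinfeldDouble.of.symm x)) := by
  change DrinfeldDouble.of (doubleMul (counit ⊗ₜ[ℂ] a) _) = DrinfeldDouble.of _
  have h1 : mulFunctional (counit : H →ₗ[ℂ] ℂ) = LinearMap.id := by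
    ext f b; simp [counit_convProd]
  rw [doubleMul_tmul, h1]
  rfl

theorem inclDual_mul_inclH (f : Module.Dual ℂ H) (a : H) :
    inclDual f * inclH a = DrinfeldDouble.mk f a := by
  rw [inclH_apply, inclDual_mul_mk, convProd_counit]

theorem inclDual_mul (f g : Module.Dual ℂ H) :
    inclDual (convProd f g) = inclDual f * inclDual g := by
  rw [inclDual_apply g, inclDual_mul_mk]; rfl

theorem inclDual_counit : inclDual (counit : H →ₗ[ℂ] ℂ) = 1 := rfl

/-- Induction over the double: it is spanned by the products of an element of `H*` with an element
of `H`. -/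
@[elab_as_elim]
theorem DrinfeldDouble.induction {p : DrinfeldDouble H → Prop}
    (mk : ∀ f a, p (inclDual f * inclH a)) (add : ∀ x y, p x → p y → p (x + y)) (x) : p x := by
  change p (DrinfeldDouble.of (DrinfeldDouble.of.symm x))
  induction DrinfeldDouble.of.symm x with
  | zero => simpa using mk 0 0
  | tmul f a => have := mk f a; rw [inclDual_mul_inclH] at this; exact this
  | add s t hs ht => rw [map_add]; exact add _ _ hs ht

/-- Linear maps out of the double agree if they agree on all products `f a`. -/
theorem DrinfeldDouble.hom_ext {M : Type*} [AddCommGroup M] [Module ℂ M]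
    {F G : DrinfeldDouble H →ₗ[ℂ] M}
    (h : ∀ f a, F (inclDual f * inclH a) = G (inclDual f * inclH a)) : F = G := by
  ext x
  induction x using DrinfeldDouble.induction with
  | mk f a => exact h f a
  | add x y hx hy => simp [hx, hy]

/-- `a ↦ (g ⊗ b ↦ g (? a) ⊗ b)`. -/
def shiftRight : H →ₗ[ℂ] Module.End ℂ (Module.Dual ℂ H ⊗[ℂ] H) where
  toFun a := TensorProduct.map (LinearMap.mulRight ℂ a).dualMap .id
  map_add' a b := by
    ext f c; simp [← TensorProduct.add_tmul]; congr 1; ext w; simp [mul_add]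
  map_smul' r a := by
    ext f c; simp [TensorProduct.smul_tmul']; congr 1; ext w; simp

/-- `a ↦ (g ⊗ b ↦ g (a ?) ⊗ b)`. -/
def shiftLeft : H →ₗ[ℂ] Module.End ℂ (Module.Dual ℂ H ⊗[ℂ] H) where
  toFun a := TensorProduct.map (LinearMap.mulLeft ℂ a).dualMap .id
  map_add' a b := by
    ext f c; simp [← TensorProduct.add_tmul]; congr 1; ext w; simp [add_mul]
  map_smul' r a := by
    ext f c; simp [TensorProduct.smul_tmul']; congr 1; ext w; simp

/-- The three legs of `mulElement` are separated into a convolution product. -/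
theorem mulElement_eq_conv :
    toConv (mulElement (H := H)) = toConv shiftRight *
      (toConv (LinearMap.lTensorHom (Module.Dual ℂ H) ∘ₗ LinearMap.mul ℂ H) *
        toConv (shiftLeft ∘ₗ antipode ℂ)) := by
  apply WithConv.ofConv_injective
  ext1 a
  have h : adTriple (H := H) = LinearMap.mul' ℂ _ ∘ₗ TensorProduct.map shiftRight
      (LinearMap.mul' ℂ _ ∘ₗ TensorProduct.map
        (LinearMap.lTensorHom (Module.Dual ℂ H) ∘ₗ LinearMap.mul ℂ H)
        (shiftLeft ∘ₗ antipode ℂ)) := by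
    ext x y z f b
    simp [adTriple, shiftRight, shiftLeft]
    congr 1
  change adTriple (comul₃ a) = LinearMap.mul' ℂ _ (TensorProduct.map _
    (LinearMap.mul' ℂ _ ∘ₗ (TensorProduct.map _ _ ∘ₗ comul)) (comul a))
  rw [h]
  simp only [comul₃, LinearMap.comp_apply]
  congr 1
  generalize comul (R := ℂ) a = z
  induction z with
  | zero => simp
  | add s t hs ht => simp only [map_add, hs, ht]
  | tmul p q => simp

/-- Convolution with `shiftLeft` cancels the antipode of the straightening formula, because the
third leg of `mulElement` is its convolution inverse. -/
theorem mulElement_conv_shiftLeft (hS : ∀ a : H, antipode ℂ (antipode ℂ a) = a) :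
    toConv (mulElement (H := H)) * toConv shiftLeft = toConv shiftRight *
      toConv (LinearMap.lTensorHom (Module.Dual ℂ H) ∘ₗ LinearMap.mul ℂ H) := by
  have h := conv_antipode_mul_of_anti (X := Module.End ℂ (Module.Dual ℂ H ⊗[ℂ] H)) hS shiftLeft
    (by ext f b; simp [shiftLeft])
    (by intro a b; ext f c; simp [shiftLeft]; rfl)
  rw [mulElement_eq_conv]
  exact conv_mul_cancel (X := Module.End ℂ (Module.Dual ℂ H ⊗[ℂ] H)) _ _ _ _ h

/-- The exchange relation `a₁ g(a₂ ?) = g(? a₁) a₂` of the double, which is the straightening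
equation without its antipode. -/
theorem exchange (hS : ∀ a : H, antipode ℂ (antipode ℂ a) = a) {ι : Type*} {a : H}
    (𝓡 : Coalgebra.Repr ℂ a ι) (g : Module.Dual ℂ H) :
    ∑ i ∈ 𝓡.index, inclH (𝓡.left i) * inclDual (g ∘ₗ LinearMap.mulLeft ℂ (𝓡.right i)) =
      ∑ i ∈ 𝓡.index, inclDual (g ∘ₗ LinearMap.mulRight ℂ (𝓡.left i)) * inclH (𝓡.right i) := by
  have h := congrArg (fun F : WithConv (H →ₗ[ℂ] Module.End ℂ (Module.Dual ℂ H ⊗[ℂ] H)) =>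
    DrinfeldDouble.of ((F a) (g ⊗ₜ[ℂ] 1))) (mulElement_conv_shiftLeft hS)
  simp only [𝓡.convMul_apply, LinearMap.sum_apply, map_sum] at h
  simp only [inclH_mul, inclDual_mul_inclH]
  convert h using 3 with i _ i _
  · rfl
  · simp [shiftRight]; rfl

end DoubleGenerators

/-! ### The canonical element of `H ⊗ H*` -/

section Canonical

variable {H : Type*} [Ring H] [HopfAlgebra ℂ H] [FiniteDimensional ℂ H]
  {V M : Type*} [AddCommGroup V] [Module ℂ V] [AddCommGroup M] [Module ℂ M]

local notation "𝐞" => Module.finBasis ℂ H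

theorem sum_coord_smul (x : H) : ∑ k, (𝐞.coord k) x • 𝐞 k = x := 𝐞.sum_repr x

theorem sum_smul_coord (f : Module.Dual ℂ H) : ∑ k, f (𝐞 k) • 𝐞.coord k = f := by
  apply 𝐞.ext
  intro j
  simp only [LinearMap.sum_apply, LinearMap.smul_apply, Module.Basis.coord_apply,
    Module.Basis.repr_self, Finsupp.single_apply]
  simp

/-- Transport of a linear map `u`, expanded as `u x = ∑ gₚ(x) vₚ`, across the canonical element. -/
theorem canonical_expand {P : Type*} (s : Finset P) (u : H →ₗ[ℂ] V) (v : P → V)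
    (g : P → Module.Dual ℂ H) (h : ∀ x, u x = ∑ p ∈ s, g p x • v p)
    (T : V →ₗ[ℂ] Module.Dual ℂ H →ₗ[ℂ] M) :
    ∑ k, T (u (𝐞 k)) (𝐞.coord k) = ∑ p ∈ s, T (v p) (g p) := by
  have h2 : ∀ p, T (v p) (g p) = ∑ k, g p (𝐞 k) • T (v p) (𝐞.coord k) := by
    intro p
    conv_lhs => rw [← sum_smul_coord (g p)]
    simp only [map_sum, map_smul]
  simp only [h, h2, map_sum, map_smul, LinearMap.sum_apply, LinearMap.smul_apply]
  exact Finset.sum_comm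

/-- The canonical element does not distinguish a map from its transpose:
`∑ φ(eₖ) ⊗ eᵏ = ∑ eₖ ⊗ φᵀ(eᵏ)`. -/
theorem canonical_transpose (φ : H →ₗ[ℂ] H) (T : H →ₗ[ℂ] Module.Dual ℂ H →ₗ[ℂ] M) :
    ∑ k, T (φ (𝐞 k)) (𝐞.coord k) = ∑ k, T (𝐞 k) (𝐞.coord k ∘ₗ φ) :=
  canonical_expand Finset.univ φ _ _ (fun x => (sum_coord_smul (φ x)).symm) T

theorem comul_eq_sum_coord (x : H) : comul (R := ℂ) x =
    ∑ p : Fin _ × Fin _, convProd (𝐞.coord p.1) (𝐞.coord p.2) x • (𝐞 p.1 ⊗ₜ[ℂ] 𝐞 p.2) := by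
  have h : ∀ z : H ⊗[ℂ] H, z = ∑ p : Fin _ × Fin _, LinearMap.mul' ℂ ℂ
      (TensorProduct.map (𝐞.coord p.1) (𝐞.coord p.2) z) • (𝐞 p.1 ⊗ₜ[ℂ] 𝐞 p.2) := by
    intro z
    induction z with
    | zero => simp
    | add s t hs ht =>
      conv_lhs => rw [hs, ht]
      simp only [map_add, add_smul, Finset.sum_add_distrib]
    | tmul a b =>
      conv_lhs => rw [← sum_coord_smul a, ← sum_coord_smul b, TensorProduct.sum_tmul]
      simp only [TensorProduct.tmul_sum, Fintype.sum_prod_type, TensorProduct.smul_tmul_smul]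
      simp
  exact h _

/-- The comultiplication of `H` is dual to the product of `H*`. -/
theorem canonical_comul (T : H ⊗[ℂ] H →ₗ[ℂ] Module.Dual ℂ H →ₗ[ℂ] M) :
    ∑ k, T (comul (R := ℂ) (𝐞 k)) (𝐞.coord k) =
      ∑ i, ∑ j, T (𝐞 i ⊗ₜ[ℂ] 𝐞 j) (convProd (𝐞.coord i) (𝐞.coord j)) := by
  rw [canonical_expand Finset.univ comul _ _ comul_eq_sum_coord T, Fintype.sum_prod_type]

variable {X : Type*} [Ring X] [Algebra ℂ X]

/-- The image `∑ ψ(eₖ) r(eᵏ)` of the canonical element in an algebra. -/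
def canon (ψ : H →ₗ[ℂ] X) (r : Module.Dual ℂ H →ₗ[ℂ] X) : X := ∑ k, ψ (𝐞 k) * r (𝐞.coord k)

theorem canon_comp_left (ψ : H →ₗ[ℂ] X) (r : Module.Dual ℂ H →ₗ[ℂ] X) (φ : H →ₗ[ℂ] H) :
    canon (ψ ∘ₗ φ) r = canon ψ (r ∘ₗ φ.dualMap) :=
  canonical_transpose φ ((LinearMap.mul ℂ X).compl₁₂ ψ r)

/-- Since the comultiplication of `H` is dual to the product of `H*`, products of images of the
canonical element are convolution products of the maps out of `H`. -/
theorem canon_mul_canon (ψ χ : H →ₗ[ℂ] X) (r : Module.Dual ℂ H →ₗ[ℂ] X)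
    (hc : ∀ f a, r f * χ a = χ a * r f) (hr : ∀ f g, r (convProd f g) = r f * r g) :
    canon ψ r * canon χ r = canon (WithConv.toConv ψ * WithConv.toConv χ).ofConv r := by
  have h := canonical_comul
    ((LinearMap.mul ℂ X).compl₁₂ (LinearMap.mul' ℂ X ∘ₗ TensorProduct.map ψ χ) r)
  simp only [LinearMap.compl₁₂_apply, LinearMap.comp_apply, TensorProduct.map_tmul,
    LinearMap.mul'_apply, LinearMap.mul_apply'] at h
  change _ = ∑ k, _
  rw [canon, canon, Finset.sum_mul_sum]
  refine Eq.trans ?_ h.symm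
  refine Finset.sum_congr rfl fun i _ => Finset.sum_congr rfl fun j _ => ?_
  rw [hr, mul_assoc, ← mul_assoc (r _), hc, mul_assoc, mul_assoc]

/-- The variant of `canon_mul_canon` for an anti-homomorphism `r`: the comultiplication is opposite.
-/
theorem canon_mul_canon_of_anti (ψ χ : H →ₗ[ℂ] X) (r : Module.Dual ℂ H →ₗ[ℂ] X)
    (hc : ∀ f a, r f * χ a = χ a * r f) (hr : ∀ f g, r (convProd f g) = r g * r f) :
    canon ψ r * canon χ r = canon (LinearMap.mul' ℂ X ∘ₗ TensorProduct.map ψ χ ∘ₗ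
      (TensorProduct.comm ℂ H H).toLinearMap ∘ₗ comul) r := by
  have h := canonical_comul
    ((LinearMap.mul ℂ X).compl₁₂ (LinearMap.mul' ℂ X ∘ₗ TensorProduct.map ψ χ ∘ₗ
      (TensorProduct.comm ℂ H H).toLinearMap) r)
  simp only [LinearMap.compl₁₂_apply, LinearMap.comp_apply, TensorProduct.map_tmul,
    LinearMap.mul'_apply, LinearMap.mul_apply', LinearEquiv.coe_coe, TensorProduct.comm_tmul] at h
  refine Eq.trans ?_ h.symm
  rw [canon, canon, Finset.sum_mul_sum, Finset.sum_comm]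
  refine Finset.sum_congr rfl fun i _ => Finset.sum_congr rfl fun j _ => ?_
  rw [hr, mul_assoc, ← mul_assoc (r _), hc, mul_assoc, mul_assoc]

theorem canon_one (r : Module.Dual ℂ H →ₗ[ℂ] X) (h1 : r counit = 1) :
    canon (1 : WithConv (H →ₗ[ℂ] X)).ofConv r = 1 := by
  have : canon (1 : WithConv (H →ₗ[ℂ] X)).ofConv r =
      r (∑ k, (counit : H →ₗ[ℂ] ℂ) (𝐞 k) • 𝐞.coord k) := by
    simp only [map_sum, map_smul]
    simp [canon, LinearMap.convOne_def, Algebra.algebraMap_eq_smul_one]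
  rw [this, sum_smul_coord, h1]

/-- For an algebra map `ψ` and a commuting algebra map `r`, the antipode inverts `∑ ψ(eₖ) r(eᵏ)`. -/
theorem canon_isUnit (ψ : H →ₐ[ℂ] X) (r : Module.Dual ℂ H →ₗ[ℂ] X)
    (hc : ∀ f a, r f * ψ a = ψ a * r f) (hr : ∀ f g, r (convProd f g) = r f * r g)
    (h1 : r counit = 1) :
    canon ψ.toLinearMap r * canon ψ.toLinearMap (r ∘ₗ dualAntipode) = 1 ∧
      canon ψ.toLinearMap (r ∘ₗ dualAntipode) * canon ψ.toLinearMap r = 1 := by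
  have h2 : canon ψ.toLinearMap (r ∘ₗ dualAntipode) =
      canon (ψ.toLinearMap ∘ₗ antipode ℂ) r := (canon_comp_left _ _ _).symm
  rw [h2, canon_mul_canon _ _ _ (fun f a => hc _ _) hr,
    canon_mul_canon _ _ _ (fun f a => hc _ _) hr,
    conv_mul_antipode, conv_antipode_mul, canon_one r h1]
  exact ⟨rfl, rfl⟩

/-- The variant of `canon_isUnit` for an anti-homomorphism `r`, where the antipode is still an
inverse because `S² = id`. -/
theorem canon_isUnit_of_anti (hS : ∀ a : H, antipode ℂ (antipode ℂ a) = a)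
    (ψ : H →ₐ[ℂ] X) (r : Module.Dual ℂ H →ₗ[ℂ] X)
    (hc : ∀ f a, r f * ψ a = ψ a * r f) (hr : ∀ f g, r (convProd f g) = r g * r f)
    (h1 : r counit = 1) :
    canon ψ.toLinearMap r * canon ψ.toLinearMap (r ∘ₗ dualAntipode) = 1 ∧
      canon ψ.toLinearMap (r ∘ₗ dualAntipode) * canon ψ.toLinearMap r = 1 := by
  have h2 : canon ψ.toLinearMap (r ∘ₗ dualAntipode) =
      canon (ψ.toLinearMap ∘ₗ antipode ℂ) r := (canon_comp_left _ _ _).symm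
  rw [h2, canon_mul_canon_of_anti _ _ _ (fun f a => hc _ _) hr,
    canon_mul_canon_of_anti _ _ _ (fun f a => hc _ _) hr]
  constructor
  · refine (congrArg (fun χ => canon χ r) (LinearMap.ext fun a => ?_)).trans (canon_one r h1)
    have h3 := congrArg ψ (sum_right_mul_antipode_left hS (ℛ ℂ a))
    simp only [LinearMap.comp_apply]
    rw [← (ℛ ℂ a).eq]
    simpa [Algebra.algebraMap_eq_smul_one] using h3
  · refine (congrArg (fun χ => canon χ r) (LinearMap.ext fun a => ?_)).trans (canon_one r h1)
    have h3 := congrArg ψ (sum_antipode_right_mul_left hS (ℛ ℂ a))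
    simp only [LinearMap.comp_apply]
    rw [← (ℛ ℂ a).eq]
    simpa [Algebra.algebraMap_eq_smul_one] using h3

end Canonical

/-! ### Operators on a single edge -/

section Edge

open WithConv

variable {H : Type*} [Ring H] [HopfAlgebra ℂ H]

/-- A functional viewed as a map to the scalars of `H`, as an element of the convolution algebra of
`H`. -/
def scalarConv (f : Module.Dual ℂ H) : WithConv (H →ₗ[ℂ] H) := toConv (Algebra.linearMap ℂ H ∘ₗ f)

theorem scalarConv_mul (f g : Module.Dual ℂ H) :
    scalarConv (convProd f g) = scalarConv f * scalarConv g := by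
  apply WithConv.ofConv_injective
  exact LinearMap.algHom_comp_convMul_distrib (Algebra.ofId ℂ H) (toConv f) (toConv g)

theorem readFst_repr {ι : Type*} {x : H} (𝓡 : Coalgebra.Repr ℂ x ι) (f : Module.Dual ℂ H) :
    readFst f x = ∑ i ∈ 𝓡.index, f (𝓡.left i) • 𝓡.right i := by
  simp [readFst, ← 𝓡.eq]

theorem readSnd_repr {ι : Type*} {x : H} (𝓡 : Coalgebra.Repr ℂ x ι) (f : Module.Dual ℂ H) :
    readSnd f x = ∑ i ∈ 𝓡.index, f (𝓡.right i) • 𝓡.left i := by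
  simp [readSnd, ← 𝓡.eq]

theorem scalarConv_mul_toConv (f : Module.Dual ℂ H) (u : Module.End ℂ H) :
    scalarConv f * toConv u = toConv (u ∘ₗ readFst f) := by
  ext x
  rw [(ℛ ℂ x).convMul_apply]
  simp [scalarConv, readFst_repr (ℛ ℂ x), Algebra.algebraMap_eq_smul_one]

theorem toConv_mul_scalarConv (f : Module.Dual ℂ H) (u : Module.End ℂ H) :
    toConv u * scalarConv f = toConv (u ∘ₗ readSnd f) := by
  ext x
  rw [(ℛ ℂ x).convMul_apply]
  simp [scalarConv, readSnd_repr (ℛ ℂ x), Algebra.algebraMap_eq_smul_one]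

theorem readSnd_convProd (f g : Module.Dual ℂ H) :
    readSnd (convProd f g) = readSnd f * readSnd g := by
  apply WithConv.toConv_injective
  have h1 := toConv_mul_scalarConv (convProd f g) LinearMap.id
  have h2 := toConv_mul_scalarConv f LinearMap.id
  have h3 := toConv_mul_scalarConv g (readSnd f)
  rw [LinearMap.id_comp] at h1 h2
  change _ = toConv (readSnd f ∘ₗ readSnd g)
  rw [← h1, ← h3, ← h2, scalarConv_mul, mul_assoc]

theorem readFst_convProd (f g : Module.Dual ℂ H) :
    readFst (convProd f g) = readFst g * readFst f := by
  apply WithConv.toConv_injective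
  have h1 := scalarConv_mul_toConv (convProd f g) LinearMap.id
  have h2 := scalarConv_mul_toConv g LinearMap.id
  have h3 := scalarConv_mul_toConv f (readFst g)
  rw [LinearMap.id_comp] at h1 h2
  change _ = toConv (readFst g ∘ₗ readFst f)
  rw [← h1, ← h3, ← h2, scalarConv_mul, mul_assoc]

theorem readFst_comm_readSnd (f g : Module.Dual ℂ H) :
    readFst f * readSnd g = readSnd g * readFst f := by
  apply WithConv.toConv_injective
  have h1 := scalarConv_mul_toConv f LinearMap.id
  have h2 := toConv_mul_scalarConv g LinearMap.id
  have h3 := scalarConv_mul_toConv f (readSnd g)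
  have h4 := toConv_mul_scalarConv g (readFst f)
  rw [LinearMap.id_comp] at h1 h2
  change toConv (readFst f ∘ₗ readSnd g) = toConv (readSnd g ∘ₗ readFst f)
  rw [← h3, ← h4, ← h2, ← h1, mul_assoc]

theorem readSnd_counit : readSnd (counit : H →ₗ[ℂ] ℂ) = 1 := by
  ext x
  rw [readSnd_repr (ℛ ℂ x)]
  exact smul_counit_sum (ℛ ℂ x) LinearMap.id

theorem readFst_counit : readFst (counit : H →ₗ[ℂ] ℂ) = 1 := by
  ext x
  rw [readFst_repr (ℛ ℂ x)]
  exact counit_smul_sum (ℛ ℂ x) LinearMap.id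

theorem comul_mul_repr {ι κ : Type*} {x y : H} (𝓡 : Coalgebra.Repr ℂ x ι)
    (𝓢 : Coalgebra.Repr ℂ y κ) : comul (R := ℂ) (x * y) = ∑ i ∈ 𝓡.index, ∑ j ∈ 𝓢.index,
      (𝓡.left i * 𝓢.left j) ⊗ₜ[ℂ] (𝓡.right i * 𝓢.right j) := by
  rw [Bialgebra.comul_mul, ← 𝓡.eq, ← 𝓢.eq, Finset.sum_mul_sum]
  simp

/-- `readFst f` applied to a product with `a` reads the first leg of `a` as well. -/
theorem readFst_mulLeft {ι : Type*} {a : H} (𝓡 : Coalgebra.Repr ℂ a ι) (f : Module.Dual ℂ H) :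
    readFst f * mulLeftOp a =
      ∑ i ∈ 𝓡.index, mulLeftOp (𝓡.right i) * readFst (f ∘ₗ LinearMap.mulLeft ℂ (𝓡.left i)) := by
  ext x
  simp only [Module.End.mul_apply, LinearMap.sum_apply, readFst_repr (ℛ ℂ x)]
  simp [readFst, mulLeftOp, comul_mul_repr 𝓡 (ℛ ℂ x)]

theorem readFst_mulRight {ι : Type*} {a : H} (𝓡 : Coalgebra.Repr ℂ a ι) (f : Module.Dual ℂ H) :
    readFst f * mulRightOp a =
      ∑ i ∈ 𝓡.index, mulRightOp (𝓡.right i) * readFst (f ∘ₗ LinearMap.mulRight ℂ (𝓡.left i)) := by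
  ext x
  simp only [Module.End.mul_apply, LinearMap.sum_apply, readFst_repr (ℛ ℂ x)]
  simp [readFst, mulRightOp, comul_mul_repr (ℛ ℂ x) 𝓡]
  exact Finset.sum_comm

theorem readSnd_mulLeft {ι : Type*} {a : H} (𝓡 : Coalgebra.Repr ℂ a ι) (f : Module.Dual ℂ H) :
    readSnd f * mulLeftOp a =
      ∑ i ∈ 𝓡.index, mulLeftOp (𝓡.left i) * readSnd (f ∘ₗ LinearMap.mulLeft ℂ (𝓡.right i)) := by
  ext x
  simp only [Module.End.mul_apply, LinearMap.sum_apply, readSnd_repr (ℛ ℂ x)]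
  simp [readSnd, mulLeftOp, comul_mul_repr 𝓡 (ℛ ℂ x)]

/-- The algebra map `a ↦ (x ↦ a x)`. -/
def mulLeftHom : H →ₐ[ℂ] Module.End ℂ H := Algebra.lmul ℂ H

theorem mulLeftHom_apply (a : H) : mulLeftHom a = mulLeftOp a := rfl

theorem mulRightOp_comm_mulLeftOp (a b : H) :
    mulRightOp a * mulLeftOp b = mulLeftOp b * mulRightOp a := by
  ext x; simp [mulRightOp, mulLeftOp, mul_assoc]

end Edge

/-! ### Triangle operators with values in the double, and the relations of vertex operators -/

/-!
Linear families of operators are multiplied in two algebras. A family `a ↦ x(a)` indexed by `H` is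
an element of the convolution algebra of maps `H → X`, in which `A_a(s)` is a product of one letter
for each edge. A family `f ↦ x(f)` indexed by `H*` is encoded as `∑ eₖ ⊗ x(eᵏ)` in `H ⊗ X`, in
which the same holds for `B_f(s)`. In both algebras the double contributes one further letter, the
leg, and the operator of a triangle, viewed as a constant, carries the leg past a letter or in or
out of the word. -/

section LocalRelations

open WithConv

variable {H : Type*} [Ring H] [HopfAlgebra ℂ H] [FiniteDimensional ℂ H]
  {X : Type*} [Ring X] [Algebra ℂ X]

local notation "𝐞" => Module.finBasis ℂ H

/-- An element of an algebra, viewed as the map `a ↦ ε(a) F` in the convolution algebra. -/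
def constConv : X →* WithConv (H →ₗ[ℂ] X) where
  toFun F := toConv ((counit : H →ₗ[ℂ] ℂ).smulRight F)
  map_one' := by ext a; simp [Algebra.algebraMap_eq_smul_one]
  map_mul' F G := by
    ext a
    rw [(ℛ ℂ a).convMul_apply]
    simp only [LinearMap.smulRight_apply, smul_mul_smul_comm]
    rw [← Finset.sum_smul]
    congr 1
    exact (counit_smul_sum (ℛ ℂ a) counit).symm

omit [FiniteDimensional ℂ H] in
theorem constConv_mul_apply (F : X) (u : WithConv (H →ₗ[ℂ] X)) (a : H) :
    (constConv F * u : WithConv (H →ₗ[ℂ] X)) a = F * u a := by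
  rw [(ℛ ℂ a).convMul_apply]
  have := counit_smul_sum (ℛ ℂ a) (LinearMap.mulLeft ℂ F ∘ₗ u.ofConv)
  simpa [constConv] using this

omit [FiniteDimensional ℂ H] in
theorem mul_constConv_apply (F : X) (u : WithConv (H →ₗ[ℂ] X)) (a : H) :
    (u * constConv F : WithConv (H →ₗ[ℂ] X)) a = u a * F := by
  rw [(ℛ ℂ a).convMul_apply]
  have := smul_counit_sum (ℛ ℂ a) (LinearMap.mulRight ℂ F ∘ₗ u.ofConv)
  simpa [constConv] using this

/-- The element `∑ eₖ ⊗ r(eᵏ)` of `H ⊗ X` which encodes the linear map `r : H* → X`. -/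
def encode (r : Module.Dual ℂ H →ₗ[ℂ] X) : H ⊗[ℂ] X := ∑ k, 𝐞 k ⊗ₜ[ℂ] r (𝐞.coord k)

theorem encode_eq_canon (r : Module.Dual ℂ H →ₗ[ℂ] X) : encode r =
    canon (Algebra.TensorProduct.includeLeft (R := ℂ) (S := ℂ) (A := H) (B := X)).toLinearMap
      ((Algebra.TensorProduct.includeRight (R := ℂ) (A := H) (B := X)).toLinearMap ∘ₗ r) := by
  simp [encode, canon]

variable (iD : DrinfeldDouble H →ₐ[ℂ] X) (T : Module.End ℂ H →ₐ[ℂ] X)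

/-- Leg of the double in the algebra of vertex operators: `a ↦ a ∈ D(H)`. -/
def legA : WithConv (H →ₗ[ℂ] X) := toConv (iD.toLinearMap ∘ₗ inclH.toLinearMap)

/-- Leg of the double in the algebra of face operators. -/
def legB : H ⊗[ℂ] X := encode (iD.toLinearMap ∘ₗ inclDual)

/-- The operators `L` on an edge leaving a vertex. -/
def outA : WithConv (H →ₗ[ℂ] X) := toConv (T.toLinearMap ∘ₗ mulLeftOp)

/-- The operators `L` on an edge entering a vertex. -/
def inA : WithConv (H →ₗ[ℂ] X) := toConv (T.toLinearMap ∘ₗ mulRightOp ∘ₗ antipode ℂ)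

/-- The operators `T` on an edge along the boundary of a face. -/
def alongB : H ⊗[ℂ] X := encode (T.toLinearMap ∘ₗ readSnd)

/-- The operators `T` on an edge against the boundary of a face. -/
def againstB : H ⊗[ℂ] X := encode (T.toLinearMap ∘ₗ readFst ∘ₗ dualAntipode)

/-- The universal operator of a clockwise direct triangle along the edge. -/
def directF : X := canon (iD.toLinearMap ∘ₗ inclH.toLinearMap) (T.toLinearMap ∘ₗ readFst)

/-- The universal operator of a clockwise dual triangle crossing an outgoing edge. -/
def dualF : X := canon (T.toLinearMap ∘ₗ mulLeftOp) (iD.toLinearMap ∘ₗ inclDual)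

variable {iD T} (hc : ∀ m t, iD m * T t = T t * iD m)
include hc

/-- The operator of a dual triangle exchanges the leg with the letter of the crossed edge. This is
the exchange relation of the double. -/
theorem legA_outA_dualF (hS : ∀ a : H, antipode ℂ (antipode ℂ a) = a) :
    legA iD * outA T * constConv (dualF iD T) = constConv (dualF iD T) * (outA T * legA iD) := by
  ext a
  rw [mul_constConv_apply, constConv_mul_apply, (ℛ ℂ a).convMul_apply, (ℛ ℂ a).convMul_apply]
  simp only [legA, outA, dualF, canon, LinearMap.comp_apply, AlgHom.toLinearMap_apply,
    Finset.sum_mul_sum]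
  have h1 : ∀ i ∈ (ℛ ℂ a).index,
      ∑ k, iD (inclH ((ℛ ℂ a).left i)) * T (mulLeftOp ((ℛ ℂ a).right i)) *
        (T (mulLeftOp (𝐞 k)) * iD (inclDual (𝐞.coord k))) =
      ∑ k, T (mulLeftOp (𝐞 k)) * iD (inclH ((ℛ ℂ a).left i) *
        inclDual (𝐞.coord k ∘ₗ LinearMap.mulLeft ℂ ((ℛ ℂ a).right i))) := by
    intro i _
    have := canonical_transpose (LinearMap.mulLeft ℂ ((ℛ ℂ a).right i))
      ((LinearMap.mul ℂ X).compl₁₂ (T.toLinearMap ∘ₗ mulLeftOp)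
        (iD.toLinearMap ∘ₗ LinearMap.mulLeft ℂ (inclH ((ℛ ℂ a).left i)) ∘ₗ inclDual))
    simp only [LinearMap.compl₁₂_apply, LinearMap.comp_apply, LinearMap.mul_apply',
      LinearMap.mulLeft_apply, AlgHom.toLinearMap_apply] at this
    rw [← this]
    refine Finset.sum_congr rfl fun k _ => ?_
    rw [← mulLeftHom_apply, ← mulLeftHom_apply, ← mulLeftHom_apply, map_mul, map_mul, map_mul,
      mul_assoc, mul_assoc, ← mul_assoc (iD _), hc, mul_assoc, ← mul_assoc (iD _), hc, mul_assoc]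
  have h2 : ∀ i ∈ (ℛ ℂ a).index, ∑ k, (T (mulLeftOp (𝐞 k)) * iD (inclDual (𝐞.coord k))) *
      (T (mulLeftOp ((ℛ ℂ a).left i)) * iD (inclH ((ℛ ℂ a).right i))) = ∑ k, T (mulLeftOp (𝐞 k)) *
        iD (inclDual (𝐞.coord k ∘ₗ LinearMap.mulRight ℂ ((ℛ ℂ a).left i)) *
          inclH ((ℛ ℂ a).right i)) := by
    intro i _
    have := canonical_transpose (LinearMap.mulRight ℂ ((ℛ ℂ a).left i))
      ((LinearMap.mul ℂ X).compl₁₂ (T.toLinearMap ∘ₗ mulLeftOp)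
        (iD.toLinearMap ∘ₗ LinearMap.mulRight ℂ (inclH ((ℛ ℂ a).right i)) ∘ₗ inclDual))
    simp only [LinearMap.compl₁₂_apply, LinearMap.comp_apply, LinearMap.mul_apply',
      LinearMap.mulRight_apply, AlgHom.toLinearMap_apply] at this
    rw [← this]
    refine Finset.sum_congr rfl fun k _ => ?_
    rw [← mulLeftHom_apply, ← mulLeftHom_apply, ← mulLeftHom_apply, map_mul, map_mul, map_mul,
      mul_assoc, mul_assoc, ← mul_assoc (iD _), hc, mul_assoc]
  rw [Finset.sum_congr rfl h1, Finset.sum_comm]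
  symm
  rw [Finset.sum_comm, Finset.sum_congr rfl h2, Finset.sum_comm]
  refine Finset.sum_congr rfl fun k _ => ?_
  rw [← Finset.mul_sum, ← Finset.mul_sum, ← map_sum, ← map_sum, exchange hS]

/-- The operator of a direct triangle absorbs the leg in front of the letter of its edge at the
initial vertex. -/
theorem legA_outA_directF :
    legA iD * outA T * constConv (directF iD T) = constConv (directF iD T) * outA T := by
  ext a
  rw [mul_constConv_apply, constConv_mul_apply, (ℛ ℂ a).convMul_apply]
  simp only [legA, outA, directF, canon, LinearMap.comp_apply, AlgHom.toLinearMap_apply,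
    Finset.sum_mul]
  have h1 : ∀ i ∈ (ℛ ℂ a).index, (iD (inclH ((ℛ ℂ a).left i)) * T (mulLeftOp ((ℛ ℂ a).right i))) *
      ∑ k, (iD (inclH (𝐞 k)) * T (readFst (𝐞.coord k))) = ∑ k, iD (inclH (𝐞 k)) *
      T (mulLeftOp ((ℛ ℂ a).right i) *
        readFst (𝐞.coord k ∘ₗ LinearMap.mulLeft ℂ ((ℛ ℂ a).left i))) := by
    intro i _
    have := canonical_transpose (LinearMap.mulLeft ℂ ((ℛ ℂ a).left i))
      ((LinearMap.mul ℂ X).compl₁₂ (iD.toLinearMap ∘ₗ inclH.toLinearMap)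
        (T.toLinearMap ∘ₗ LinearMap.mulLeft ℂ (mulLeftOp ((ℛ ℂ a).right i)) ∘ₗ readFst))
    simp only [LinearMap.compl₁₂_apply, LinearMap.comp_apply, LinearMap.mul_apply',
      LinearMap.mulLeft_apply, AlgHom.toLinearMap_apply] at this
    rw [← this, Finset.mul_sum]
    refine Finset.sum_congr rfl fun k _ => ?_
    rw [map_mul, map_mul, map_mul, mul_assoc, mul_assoc, ← mul_assoc (T _), ← hc, mul_assoc]
  rw [Finset.sum_congr rfl h1, Finset.sum_comm]
  refine Finset.sum_congr rfl fun k _ => ?_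
  rw [mul_assoc, ← map_mul, readFst_mulLeft (ℛ ℂ a), map_sum, Finset.mul_sum]

/-- The operator of a direct triangle emits the leg behind the letter of its edge at the terminal
vertex. -/
theorem inA_directF :
    inA T * constConv (directF iD T) = constConv (directF iD T) * (inA T * legA iD) := by
  have h : constConv (directF iD T) * inA T = inA T * constConv (directF iD T) *
      toConv (iD.toLinearMap ∘ₗ inclH.toLinearMap ∘ₗ antipode ℂ) := by
    ext a
    rw [constConv_mul_apply, (ℛ ℂ a).convMul_apply]
    simp only [mul_constConv_apply]
    simp only [inA, directF, canon, LinearMap.comp_apply, AlgHom.toLinearMap_apply,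
      Finset.sum_mul]
    have h1 : ∀ i ∈ (ℛ ℂ a).index, T (mulRightOp (antipode ℂ ((ℛ ℂ a).left i))) *
        (∑ k, iD (inclH (𝐞 k)) * T (readFst (𝐞.coord k))) *
        iD (inclH (antipode ℂ ((ℛ ℂ a).right i))) =
        ∑ k, iD (inclH (𝐞 k)) * T (mulRightOp (antipode ℂ ((ℛ ℂ a).left i)) *
          readFst (𝐞.coord k ∘ₗ LinearMap.mulRight ℂ (antipode ℂ ((ℛ ℂ a).right i)))) := by
      intro i _
      have := canonical_transpose (LinearMap.mulRight ℂ (antipode ℂ ((ℛ ℂ a).right i)))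
        ((LinearMap.mul ℂ X).compl₁₂ (iD.toLinearMap ∘ₗ inclH.toLinearMap)
          (T.toLinearMap ∘ₗ
            LinearMap.mulLeft ℂ (mulRightOp (antipode ℂ ((ℛ ℂ a).left i))) ∘ₗ readFst))
      simp only [LinearMap.compl₁₂_apply, LinearMap.comp_apply, LinearMap.mul_apply',
        LinearMap.mulLeft_apply, LinearMap.mulRight_apply, AlgHom.toLinearMap_apply] at this
      rw [← this, Finset.mul_sum, Finset.sum_mul]
      refine Finset.sum_congr rfl fun k _ => ?_
      rw [map_mul, map_mul, map_mul, ← mul_assoc, ← hc, mul_assoc, mul_assoc, ← hc,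
        ← mul_assoc (T _), ← hc]
      simp only [mul_assoc]
    rw [Finset.sum_congr rfl h1, Finset.sum_comm]
    refine Finset.sum_congr rfl fun k _ => ?_
    rw [mul_assoc, ← map_mul, readFst_mulRight (antipodeRepr (ℛ ℂ a)), map_sum, Finset.mul_sum]
    rfl
  have h2 := conv_antipode_mul (iD.comp (inclH (H := H)))
  rw [← mul_assoc, h, mul_assoc]
  exact ((congrArg _ h2).trans (mul_one _)).symm

theorem inA_dualF :
    inA T * constConv (dualF iD T) = constConv (dualF iD T) * inA T := by
  ext a
  rw [mul_constConv_apply, constConv_mul_apply]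
  simp only [inA, dualF, canon, LinearMap.comp_apply, AlgHom.toLinearMap_apply, Finset.sum_mul,
    Finset.mul_sum]
  refine Finset.sum_congr rfl fun k _ => ?_
  rw [mul_assoc, hc, ← mul_assoc, ← mul_assoc, ← map_mul, ← map_mul, mulRightOp_comm_mulLeftOp]

end LocalRelations

/-! ### Relations of face operators -/

section FaceRelations

variable {H : Type*} [Ring H] [HopfAlgebra ℂ H] [FiniteDimensional ℂ H]
  {X : Type*} [Ring X] [Algebra ℂ X]

local notation "𝐞" => Module.finBasis ℂ H

/-- An element of an algebra, as a constant in the algebra of face operators. -/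
def constTensor : X →ₐ[ℂ] H ⊗[ℂ] X := Algebra.TensorProduct.includeRight

omit [FiniteDimensional ℂ H] in
theorem constTensor_apply (F : X) : constTensor F = (1 : H) ⊗ₜ[ℂ] F := rfl

/-- Left multiplication in the factor `H` acts on the encoded family by transposition. -/
theorem tmul_mul_encode (a : H) (x : X) (r : Module.Dual ℂ H →ₗ[ℂ] X) :
    (a ⊗ₜ[ℂ] x) * encode r = ∑ k, 𝐞 k ⊗ₜ[ℂ] (x * r (𝐞.coord k ∘ₗ LinearMap.mulLeft ℂ a)) := by
  have := canonical_transpose (LinearMap.mulLeft ℂ a)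
    ((TensorProduct.mk ℂ H X).compl₂ (LinearMap.mulLeft ℂ x ∘ₗ r))
  simp only [LinearMap.compl₂_apply, LinearMap.comp_apply, LinearMap.mulLeft_apply,
    TensorProduct.mk_apply] at this
  simp [encode, Finset.mul_sum, this]

theorem encode_mul_tmul (a : H) (x : X) (r : Module.Dual ℂ H →ₗ[ℂ] X) :
    encode r * (a ⊗ₜ[ℂ] x) = ∑ k, 𝐞 k ⊗ₜ[ℂ] (r (𝐞.coord k ∘ₗ LinearMap.mulRight ℂ a) * x) := by
  have := canonical_transpose (LinearMap.mulRight ℂ a)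
    ((TensorProduct.mk ℂ H X).compl₂ (LinearMap.mulRight ℂ x ∘ₗ r))
  simp only [LinearMap.compl₂_apply, LinearMap.comp_apply, LinearMap.mulRight_apply,
    TensorProduct.mk_apply] at this
  simp [encode, Finset.sum_mul, this]

theorem constTensor_comm_encode (x : X) (r : Module.Dual ℂ H →ₗ[ℂ] X)
    (h : ∀ f, x * r f = r f * x) : constTensor x * encode r = encode r * constTensor x := by
  simp [encode, constTensor, Finset.mul_sum, Finset.sum_mul, h]

variable {iD : DrinfeldDouble H →ₐ[ℂ] X} {T : Module.End ℂ H →ₐ[ℂ] X}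

/-- The inverse of `againstB`. -/
def readB (T : Module.End ℂ H →ₐ[ℂ] X) : H ⊗[ℂ] X := encode (T.toLinearMap ∘ₗ readFst)

theorem readB_mul_againstB (hS : ∀ a : H, antipode ℂ (antipode ℂ a) = a) :
    readB T * againstB T = 1 ∧ againstB T * readB T = 1 := by
  have h := canon_isUnit_of_anti hS
    (Algebra.TensorProduct.includeLeft (R := ℂ) (S := ℂ) (A := H) (B := X))
    ((constTensor (H := H) (X := X)).toLinearMap ∘ₗ T.toLinearMap ∘ₗ readFst)
    (fun f a => by simp [constTensor]) (fun f g => by simp [readFst_convProd])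
    (by simp [readFst_counit])
  rw [readB, againstB, encode_eq_canon, encode_eq_canon]
  exact h

/-- Moving a left multiplication past `alongB` splits it by the opposite comultiplication. -/
theorem alongB_mul_const {ι : Type*} {a : H} (𝓡 : Coalgebra.Repr ℂ a ι) :
    alongB T * constTensor (T (mulLeftOp a)) =
      (∑ i ∈ 𝓡.index, 𝓡.right i ⊗ₜ[ℂ] T (mulLeftOp (𝓡.left i))) * alongB T := by
  simp only [alongB, Finset.sum_mul, tmul_mul_encode, constTensor_apply, encode_mul_tmul]
  rw [Finset.sum_comm]
  refine Finset.sum_congr rfl fun k _ => ?_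
  rw [← TensorProduct.tmul_sum]
  congr 1
  simp only [LinearMap.comp_apply, AlgHom.toLinearMap_apply, ← map_mul, ← map_sum]
  rw [← readSnd_mulLeft 𝓡]
  congr 3
  ext x; simp

/-- Moving a left multiplication past `readB` splits it by the comultiplication. -/
theorem readB_mul_const {ι : Type*} {a : H} (𝓡 : Coalgebra.Repr ℂ a ι) :
    readB T * constTensor (T (mulLeftOp a)) =
      (∑ i ∈ 𝓡.index, 𝓡.left i ⊗ₜ[ℂ] T (mulLeftOp (𝓡.right i))) * readB T := by
  simp only [readB, Finset.sum_mul, tmul_mul_encode, constTensor_apply, encode_mul_tmul]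
  rw [Finset.sum_comm]
  refine Finset.sum_congr rfl fun k _ => ?_
  rw [← TensorProduct.tmul_sum]
  congr 1
  simp only [LinearMap.comp_apply, AlgHom.toLinearMap_apply, ← map_mul, ← map_sum]
  rw [← readFst_mulLeft 𝓡]
  congr 3
  ext x; simp

/-- The exchange relation of the double, in the algebra of face operators. -/
theorem legB_exchange (hS : ∀ a : H, antipode ℂ (antipode ℂ a) = a) {ι : Type*} {a : H}
    (𝓡 : Coalgebra.Repr ℂ a ι) :
    legB iD * (∑ i ∈ 𝓡.index, 𝓡.left i ⊗ₜ[ℂ] iD (inclH (𝓡.right i))) =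
      (∑ i ∈ 𝓡.index, 𝓡.right i ⊗ₜ[ℂ] iD (inclH (𝓡.left i))) * legB iD := by
  simp only [legB, Finset.sum_mul, Finset.mul_sum, tmul_mul_encode, encode_mul_tmul]
  rw [Finset.sum_comm]
  symm
  rw [Finset.sum_comm]
  refine Finset.sum_congr rfl fun k _ => ?_
  rw [← TensorProduct.tmul_sum, ← TensorProduct.tmul_sum]
  congr 1
  simp only [LinearMap.comp_apply, AlgHom.toLinearMap_apply, ← map_mul, ← map_sum]
  rw [exchange hS]

variable (hc : ∀ m t, iD m * T t = T t * iD m)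
include hc

theorem alongB_directF : alongB T * constTensor (directF iD T) =
    constTensor (directF iD T) * alongB T := by
  refine (constTensor_comm_encode _ _ fun f => ?_).symm
  simp only [directF, canon, Finset.sum_mul, Finset.mul_sum]
  refine Finset.sum_congr rfl fun k _ => ?_
  simp only [LinearMap.comp_apply, AlgHom.toLinearMap_apply]
  rw [mul_assoc, ← map_mul, readFst_comm_readSnd, map_mul, ← mul_assoc, hc, mul_assoc]

omit hc in
/-- Moving a linear combination of left multiplications, split by the comultiplication, past
the operator of a dual triangle. -/
theorem dualF_split (e : H ⊗[ℂ] X) (ψ : H ⊗[ℂ] H →ₗ[ℂ] H ⊗[ℂ] X)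
    (h1 : ∀ a, e * constTensor (T (mulLeftOp a)) = ψ (comul a) * e)
    (h2 : ∀ f, constTensor (iD (inclDual f)) * e = e * constTensor (iD (inclDual f))) :
    e * constTensor (dualF iD T) = (∑ i, ∑ j, ψ (𝐞 i ⊗ₜ[ℂ] 𝐞 j) *
      (constTensor (iD (inclDual (𝐞.coord i))) * constTensor (iD (inclDual (𝐞.coord j))))) * e := by
  have h := canonical_comul ((LinearMap.mul ℂ (H ⊗[ℂ] X)).compl₁₂ ψ
    (constTensor.toLinearMap ∘ₗ iD.toLinearMap ∘ₗ inclDual))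
  simp only [LinearMap.compl₁₂_apply, LinearMap.comp_apply, LinearMap.mul_apply',
    AlgHom.toLinearMap_apply, inclDual_mul, map_mul] at h
  rw [← h]
  simp only [dualF, canon, LinearMap.comp_apply, AlgHom.toLinearMap_apply, map_sum, map_mul,
    Finset.mul_sum, Finset.sum_mul]
  refine Finset.sum_congr rfl fun k _ => ?_
  rw [← mul_assoc, h1, mul_assoc, ← h2, mul_assoc]

/-- The operator of a dual triangle emits the leg in front of the letter of the crossed edge in the
face of its terminal site. -/
theorem alongB_dualF : alongB T * constTensor (dualF iD T) =
    constTensor (dualF iD T) * (legB iD * alongB T) := by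
  rw [dualF_split (alongB T) (TensorProduct.map .id (T.toLinearMap ∘ₗ mulLeftOp) ∘ₗ
      (TensorProduct.comm ℂ H H).toLinearMap)
    (fun a => by rw [alongB_mul_const (ℛ ℂ a), ← (ℛ ℂ a).eq]; simp)
    (fun f => constTensor_comm_encode _ _ fun g => hc _ _), ← mul_assoc]
  congr 1
  simp only [legB, encode, dualF, canon, map_sum, Finset.sum_mul_sum]
  refine Finset.sum_congr rfl fun i _ => Finset.sum_congr rfl fun j _ => ?_
  simp [constTensor, mul_assoc]

theorem legB_dualF_readB : legB iD * constTensor (dualF iD T) * readB T =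
    readB T * constTensor (dualF iD T) := by
  rw [dualF_split (readB T) (TensorProduct.map .id (T.toLinearMap ∘ₗ mulLeftOp))
    (fun a => by rw [readB_mul_const (ℛ ℂ a), ← (ℛ ℂ a).eq]; simp)
    (fun f => constTensor_comm_encode _ _ fun g => hc _ _)]
  congr 1
  simp only [legB, encode, dualF, canon, map_sum, Finset.sum_mul_sum]
  refine Finset.sum_congr rfl fun i _ => Finset.sum_congr rfl fun j _ => ?_
  simp only [constTensor_apply, TensorProduct.map_tmul, LinearMap.id_apply, LinearMap.comp_apply,
    AlgHom.toLinearMap_apply, Algebra.TensorProduct.tmul_mul_tmul, mul_one]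
  rw [← mul_assoc, hc, mul_assoc, ← mul_assoc, ← hc, mul_assoc]

/-- The operator of a dual triangle absorbs the leg behind the letter of the crossed edge in the
face of its initial site. -/
theorem againstB_legB_dualF (hS : ∀ a : H, antipode ℂ (antipode ℂ a) = a) :
    againstB T * legB iD * constTensor (dualF iD T) = constTensor (dualF iD T) * againstB T := by
  obtain ⟨h1, h2⟩ := readB_mul_againstB (T := T) hS
  calc againstB T * legB iD * constTensor (dualF iD T)
      = againstB T * (legB iD * constTensor (dualF iD T) * readB T) * againstB T := by
        simp only [mul_assoc, h1, mul_one]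
    _ = _ := by rw [legB_dualF_readB hc, ← mul_assoc, h2, one_mul]

omit hc in
theorem directF_readB : constTensor (directF iD T) * readB T = ∑ k,
    TensorProduct.map .id (iD.toLinearMap ∘ₗ inclH.toLinearMap) (comul (R := ℂ) (𝐞 k)) *
      constTensor (T (readFst (𝐞.coord k))) := by
  have h := canonical_comul ((LinearMap.mul ℂ (H ⊗[ℂ] X)).compl₁₂
    (TensorProduct.map .id (iD.toLinearMap ∘ₗ inclH.toLinearMap))
    (constTensor.toLinearMap ∘ₗ T.toLinearMap ∘ₗ readFst))
  simp only [LinearMap.compl₁₂_apply, LinearMap.comp_apply, LinearMap.mul_apply',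
    AlgHom.toLinearMap_apply] at h
  rw [h]
  simp only [directF, canon, readB, encode, map_sum]
  rw [Finset.sum_mul_sum, Finset.sum_comm]
  refine Finset.sum_congr rfl fun i _ => Finset.sum_congr rfl fun j _ => ?_
  simp [constTensor, readFst_convProd, mul_assoc]

theorem readB_directF : readB T * constTensor (directF iD T) = ∑ k,
    TensorProduct.map .id (iD.toLinearMap ∘ₗ inclH.toLinearMap)
      (TensorProduct.comm ℂ H H (comul (R := ℂ) (𝐞 k))) *
      constTensor (T (readFst (𝐞.coord k))) := by
  have h := canonical_comul ((LinearMap.mul ℂ (H ⊗[ℂ] X)).compl₁₂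
    (TensorProduct.map .id (iD.toLinearMap ∘ₗ inclH.toLinearMap) ∘ₗ
      (TensorProduct.comm ℂ H H).toLinearMap)
    (constTensor.toLinearMap ∘ₗ T.toLinearMap ∘ₗ readFst))
  simp only [LinearMap.compl₁₂_apply, LinearMap.comp_apply, LinearMap.mul_apply',
    AlgHom.toLinearMap_apply, LinearEquiv.coe_coe] at h
  rw [h]
  simp only [directF, canon, readB, encode, map_sum]
  rw [Finset.sum_mul_sum, Finset.sum_comm]
  refine Finset.sum_congr rfl fun i _ => Finset.sum_congr rfl fun j _ => ?_
  simp [constTensor, readFst_convProd]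
  rw [← mul_assoc, ← hc, mul_assoc]

theorem legB_directF_readB (hS : ∀ a : H, antipode ℂ (antipode ℂ a) = a) :
    legB iD * constTensor (directF iD T) * readB T =
      readB T * constTensor (directF iD T) * legB iD := by
  rw [mul_assoc, directF_readB, readB_directF hc, Finset.mul_sum, Finset.sum_mul]
  refine Finset.sum_congr rfl fun k _ => ?_
  have h1 := legB_exchange (iD := iD) hS (ℛ ℂ (𝐞 k))
  have h2 : constTensor (T (readFst ((𝐞).coord k))) * legB iD =
      legB iD * constTensor (T (readFst ((𝐞).coord k))) :=
    constTensor_comm_encode _ _ fun f => (hc _ _).symm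
  rw [mul_assoc (TensorProduct.map _ _ _), h2, ← mul_assoc, ← mul_assoc]
  congr 1
  rw [← (ℛ ℂ (𝐞 k)).eq]
  simpa [legB] using h1

/-- The operator of a direct triangle exchanges the leg with the letter of its edge. -/
theorem againstB_legB_directF (hS : ∀ a : H, antipode ℂ (antipode ℂ a) = a) :
    againstB T * legB iD * constTensor (directF iD T) =
      constTensor (directF iD T) * (legB iD * againstB T) := by
  obtain ⟨h1, h2⟩ := readB_mul_againstB (T := T) hS
  calc againstB T * legB iD * constTensor (directF iD T)
      = againstB T * (legB iD * constTensor (directF iD T) * readB T) * againstB T := by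
        simp only [mul_assoc, h1, mul_one]
    _ = againstB T * readB T * constTensor (directF iD T) * legB iD * againstB T := by
        rw [legB_directF_readB hc hS]; simp only [mul_assoc]
    _ = _ := by rw [h2, one_mul, mul_assoc]

end FaceRelations

/-! ### Moving a leg around the cycles of a permutation -/

section CycleWords

variable {M S : Type*} [Monoid M] (π : Equiv.Perm S) (m : S → M) (ℓ : M)

/-- The letters `m (π s), m (π² s), …, m s` along the cycle of `s`. -/
def cycleWord (s : S) : List M :=
  (List.range (Function.minimalPeriod π s)).map fun k => m ((π ^ (k + 1)) s)

/-- The product of the letters along the cycle of `s`, with `ℓ` inserted after the first `k`. -/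
def insertLeg (s : S) (k : ℕ) : M :=
  ((cycleWord π m s).take k).prod * ℓ * ((cycleWord π m s).drop k).prod

/-- `F` takes the leg from the position after `σ` in a cycle of `π` to the position after `σ'`.
The leg either passes the letter of `π σ` and stays in its cycle, or it leaves its cycle by being
absorbed in front of the letter of `π σ` and is emitted behind the letter of `σ'`. -/
def ForwardStep (σ σ' : S) (F : M) : Prop :=
  (σ' = π σ ∧ ℓ * m (π σ) * F = F * (m (π σ) * ℓ) ∧ ∀ x, x ≠ π σ → m x * F = F * m x) ∨
  (¬ π.SameCycle σ σ' ∧ ℓ * m (π σ) * F = F * m (π σ) ∧ m σ' * F = F * (m σ' * ℓ) ∧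
    ∀ x, x ≠ π σ → x ≠ σ' → m x * F = F * m x)

/-- The mirror image of `ForwardStep`: the leg passes the letter of `σ`, or it is absorbed behind
the letter of `σ` and emitted in front of the letter of `π σ'`. -/
def BackwardStep (σ σ' : S) (F : M) : Prop :=
  (σ' = π⁻¹ σ ∧ m σ * ℓ * F = F * (ℓ * m σ) ∧ ∀ x, x ≠ σ → m x * F = F * m x) ∨
  (¬ π.SameCycle σ σ' ∧ m σ * ℓ * F = F * m σ ∧ m (π σ') * F = F * (ℓ * m (π σ')) ∧
    ∀ x, x ≠ σ → x ≠ π σ' → m x * F = F * m x)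

variable {π m ℓ}

/-- An intertwining relation for `F` is one for its inverse `G`, read backwards. -/
theorem inv_relation {a b F G : M} (hFG : F * G = 1) (hGF : G * F = 1) (h : a * F = F * b) :
    b * G = G * a := by
  calc b * G = G * (F * b) * G := by rw [← mul_assoc G, hGF, one_mul]
    _ = G * a := by rw [← h, ← mul_assoc, mul_assoc, hFG, mul_one]

theorem ForwardStep.inv {σ σ' : S} {F G : M} (hFG : F * G = 1) (hGF : G * F = 1)
    (h : ForwardStep π m ℓ σ σ' F) : BackwardStep π m ℓ σ' σ G := by
  rcases h with ⟨rfl, h1, h2⟩ | ⟨h0, h1, h2, h3⟩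
  · exact Or.inl ⟨by simp, inv_relation hFG hGF h1, fun x hx => inv_relation hFG hGF (h2 x hx)⟩
  · exact Or.inr ⟨fun h => h0 h.symm, inv_relation hFG hGF h2, inv_relation hFG hGF h1,
      fun x hx hx' => inv_relation hFG hGF (h3 x hx' hx)⟩

theorem BackwardStep.inv {σ σ' : S} {F G : M} (hFG : F * G = 1) (hGF : G * F = 1)
    (h : BackwardStep π m ℓ σ σ' F) : ForwardStep π m ℓ σ' σ G := by
  rcases h with ⟨rfl, h1, h2⟩ | ⟨h0, h1, h2, h3⟩
  · refine Or.inl ⟨by simp, ?_, fun x hx => inv_relation hFG hGF (h2 x (by simpa using hx))⟩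
    have := inv_relation hFG hGF h1
    simpa using this
  · exact Or.inr ⟨fun h => h0 h.symm, inv_relation hFG hGF h2, inv_relation hFG hGF h1,
      fun x hx hx' => inv_relation hFG hGF (h3 x hx' hx)⟩

theorem prod_mul_of_commutes {F : M} {l : List M} (h : ∀ x ∈ l, x * F = F * x) :
    l.prod * F = F * l.prod := by
  induction l with
  | nil => simp
  | cons a l ih =>
    rw [List.prod_cons, mul_assoc, ih fun x hx => h x (List.mem_cons_of_mem _ hx), ← mul_assoc,
      h a List.mem_cons_self, mul_assoc]

variable (π m ℓ)

omit [Monoid M] in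
theorem length_cycleWord (s : S) : (cycleWord π m s).length = Function.minimalPeriod π s := by
  simp [cycleWord]

omit [Monoid M] in
theorem getElem_cycleWord (s : S) (k : ℕ) (hk : k < (cycleWord π m s).length) :
    (cycleWord π m s)[k] = m ((π ^ (k + 1)) s) := by
  simp [cycleWord]

omit [Monoid M] in
theorem cycleWord_split (s : S) (k : ℕ) (hk : k < Function.minimalPeriod π s) :
    (cycleWord π m s).drop k = m ((π ^ (k + 1)) s) :: (cycleWord π m s).drop (k + 1) := by
  rw [← getElem_cycleWord π m s k (by rwa [length_cycleWord]), List.drop_eq_getElem_cons]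

theorem take_succ_cycleWord (s : S) (k : ℕ) (hk : k < Function.minimalPeriod π s) :
    ((cycleWord π m s).take (k + 1)).prod =
      ((cycleWord π m s).take k).prod * m ((π ^ (k + 1)) s) := by
  rw [← getElem_cycleWord π m s k (by rwa [length_cycleWord]), List.prod_take_succ]

theorem pow_injOn_period {s : S} {j k : ℕ} (hj : j < Function.minimalPeriod π s)
    (hk : k < Function.minimalPeriod π s) (h : (π ^ j) s = (π ^ k) s) : j = k := by
  apply Function.iterate_injOn_Iio_minimalPeriod (f := π) (x := s) hj hk
  simpa only [Equiv.Perm.iterate_eq_pow] using h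

/-- If `F` commutes with all letters of a cycle but one, it commutes with the parts of the word
before and behind that letter. -/
theorem commutes_take {F : M} {s σ : S} {k : ℕ} (hk : k < Function.minimalPeriod π s)
    (hσ : (π ^ (k + 1)) s = σ)
    (h : ∀ x, x ≠ σ → π.SameCycle s x → m x * F = F * m x) :
    ((cycleWord π m s).take k).prod * F = F * ((cycleWord π m s).take k).prod ∧
    ((cycleWord π m s).drop (k + 1)).prod * F = F * ((cycleWord π m s).drop (k + 1)).prod := by
  have key : ∀ j, j < Function.minimalPeriod π s → j ≠ k →
      m ((π ^ (j + 1)) s) * F = F * m ((π ^ (j + 1)) s) := by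
    intro j hj hjk
    refine h _ (fun h' => hjk ?_) ⟨(j + 1 : ℕ), by rw [zpow_natCast]⟩
    rw [← hσ, pow_succ', pow_succ', Equiv.Perm.mul_apply, Equiv.Perm.mul_apply] at h'
    exact pow_injOn_period π hj hk (π.injective h')
  constructor <;> refine prod_mul_of_commutes fun x hx => ?_
  · obtain ⟨i, hi, rfl⟩ := List.mem_take_iff_getElem.1 hx
    rw [getElem_cycleWord]
    rw [length_cycleWord] at hi
    exact key i (by omega) (by omega)
  · obtain ⟨i, hi, rfl⟩ := List.mem_drop_iff_getElem.1 hx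
    rw [getElem_cycleWord]
    rw [length_cycleWord] at hi
    exact key _ (by omega) (by omega)

/-- `w` is the word of the cycle of `s` with the leg inserted at the position after `σ`, where the
position at the base point `s` itself is the first one; without leg if `σ` is not in the cycle. -/
def LegBefore (s σ : S) (w : M) : Prop :=
  (∃ k < Function.minimalPeriod π s, (π ^ k) s = σ ∧ w = insertLeg π m ℓ s k) ∨
  (¬ π.SameCycle s σ ∧ w = (cycleWord π m s).prod)

/-- The same as `LegBefore`, where the position at the base point `s` is the last one. -/
def LegAfter (s σ : S) (w : M) : Prop :=
  (∃ k, 0 < k ∧ k ≤ Function.minimalPeriod π s ∧ (π ^ k) s = σ ∧ w = insertLeg π m ℓ s k) ∨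
  (¬ π.SameCycle s σ ∧ w = (cycleWord π m s).prod)

theorem pow_minimalPeriod (s : S) : (π ^ Function.minimalPeriod π s) s = s := by
  rw [← Equiv.Perm.iterate_eq_pow]
  exact Function.iterate_minimalPeriod

variable {π m ℓ}

theorem LegAfter.before {s σ : S} {w : M} (h : LegAfter π m ℓ s σ w) (hne : σ ≠ s) :
    LegBefore π m ℓ s σ w := by
  rcases h with ⟨k, _, hk, hσ, hw⟩ | h
  · refine Or.inl ⟨k, lt_of_le_of_ne hk ?_, hσ, hw⟩
    rintro rfl
    exact hne (hσ ▸ pow_minimalPeriod π s)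
  · exact Or.inr h

theorem LegBefore.after {s σ : S} {w : M} (h : LegBefore π m ℓ s σ w) (hne : σ ≠ s) :
    LegAfter π m ℓ s σ w := by
  rcases h with ⟨k, hk, hσ, hw⟩ | h
  · refine Or.inl ⟨k, Nat.pos_of_ne_zero ?_, hk.le, hσ, hw⟩
    rintro rfl
    exact hne (by simp [← hσ])
  · exact Or.inr h

/-- Every member of the cycle of `s` is `π^(k+1) s` for some `k` below the period. -/
theorem exists_pow_succ [Finite S] {s x : S} (h : π.SameCycle s x) :
    ∃ k < Function.minimalPeriod π s, (π ^ (k + 1)) s = x := by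
  have hpos : 0 < Function.minimalPeriod π s := by
    refine Function.minimalPeriod_pos_of_mem_periodicPts ?_
    obtain ⟨n, hn, h⟩ := (isOfFinOrder_of_finite π).exists_pow_eq_one
    exact ⟨n, hn, by rw [Function.IsPeriodicPt, Equiv.Perm.iterate_eq_pow, h]; rfl⟩
  obtain ⟨j, hj⟩ : ∃ j : ℕ, (π ^ (j + 1)) s = x := by
    obtain ⟨j, _, _, hj⟩ := h.exists_pow_eq''
    exact ⟨j - 1, by rw [Nat.sub_add_cancel (by omega)]; exact hj⟩
  refine ⟨j % Function.minimalPeriod π s, Nat.mod_lt _ hpos, ?_⟩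
  rw [← hj, pow_succ', pow_succ', Equiv.Perm.mul_apply, Equiv.Perm.mul_apply,
    ← Equiv.Perm.iterate_eq_pow, ← Equiv.Perm.iterate_eq_pow, Function.iterate_mod_minimalPeriod_eq]

/-- A forward step carries a word with the leg after `σ` into the word with the leg after `σ'`. At
the base point a forward step starts from the first position and arrives at the last one. -/
theorem ForwardStep.move [Finite S] {s σ σ' : S} {F w : M} (h : ForwardStep π m ℓ σ σ' F)
    (hw : LegBefore π m ℓ s σ w) : ∃ w', LegAfter π m ℓ s σ' w' ∧ w * F = F * w' := by
  have hcyc : ∀ k, π.SameCycle s ((π ^ k) s) := fun k => ⟨k, by simp⟩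
  have hprod : ∀ k, (cycleWord π m s).prod =
      ((cycleWord π m s).take k).prod * ((cycleWord π m s).drop k).prod := fun k => by
    rw [← List.prod_append, List.take_append_drop]
  rcases h with ⟨rfl, h1, h2⟩ | ⟨h0, h1, h2, h3⟩
  · rcases hw with ⟨k, hk, rfl, rfl⟩ | ⟨hn, rfl⟩
    · have e : π ((π ^ k) s) = (π ^ (k + 1)) s := by rw [pow_succ']; rfl
      rw [e] at h1 h2
      obtain ⟨c1, c2⟩ := commutes_take π m hk rfl (fun x hx _ => h2 x hx)
      refine ⟨_, Or.inl ⟨k + 1, by omega, hk, e.symm, rfl⟩, ?_⟩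
      rw [insertLeg, insertLeg, take_succ_cycleWord π m s k hk, cycleWord_split π m s k hk,
        List.prod_cons]
      calc _ = ((cycleWord π m s).take k).prod * (ℓ * m ((π ^ (k + 1)) s) *
            (((cycleWord π m s).drop (k + 1)).prod * F)) := by simp only [mul_assoc]
        _ = ((cycleWord π m s).take k).prod * (ℓ * m ((π ^ (k + 1)) s) * F) *
            ((cycleWord π m s).drop (k + 1)).prod := by rw [c2]; simp only [mul_assoc]
        _ = _ := by rw [h1, ← mul_assoc, c1]; simp only [mul_assoc]
    · have hn' : ¬ π.SameCycle s (π σ) := fun h => hn (Equiv.Perm.sameCycle_apply_right.1 h)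
      refine ⟨_, Or.inr ⟨hn', rfl⟩, prod_mul_of_commutes fun x hx => ?_⟩
      obtain ⟨k, _, rfl⟩ := List.mem_map.1 hx
      exact h2 _ fun h => hn' (h ▸ hcyc _)
  · rcases hw with ⟨k, hk, rfl, rfl⟩ | ⟨hn, rfl⟩
    · have e : π ((π ^ k) s) = (π ^ (k + 1)) s := by rw [pow_succ']; rfl
      rw [e] at h1 h3
      have hσ' : ¬ π.SameCycle s σ' := fun h => h0 ((hcyc k).symm.trans h)
      obtain ⟨c1, c2⟩ := commutes_take π m hk rfl (fun x hx hx' => h3 x hx fun h => hσ' (h ▸ hx'))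
      refine ⟨_, Or.inr ⟨hσ', rfl⟩, ?_⟩
      rw [hprod k, insertLeg, cycleWord_split π m s k hk, List.prod_cons]
      calc _ = ((cycleWord π m s).take k).prod * (ℓ * m ((π ^ (k + 1)) s) *
            (((cycleWord π m s).drop (k + 1)).prod * F)) := by simp only [mul_assoc]
        _ = ((cycleWord π m s).take k).prod * (ℓ * m ((π ^ (k + 1)) s) * F) *
            ((cycleWord π m s).drop (k + 1)).prod := by rw [c2]; simp only [mul_assoc]
        _ = _ := by rw [h1, ← mul_assoc, c1]; simp only [mul_assoc]
    · have hn' : ¬ π.SameCycle s (π σ) := fun h => hn (Equiv.Perm.sameCycle_apply_right.1 h)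
      by_cases hσ' : π.SameCycle s σ'
      · obtain ⟨k, hk, hk'⟩ := exists_pow_succ hσ'
        obtain ⟨c1, c2⟩ := commutes_take π m hk hk'
          (fun x hx hx' => h3 x (fun h => hn' (h ▸ hx')) hx)
        refine ⟨_, Or.inl ⟨k + 1, by omega, hk, hk', rfl⟩, ?_⟩
        rw [hprod k, insertLeg, take_succ_cycleWord π m s k hk, cycleWord_split π m s k hk,
          List.prod_cons, hk']
        calc _ = ((cycleWord π m s).take k).prod * (m σ' *
              (((cycleWord π m s).drop (k + 1)).prod * F)) := by simp only [mul_assoc]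
          _ = ((cycleWord π m s).take k).prod * (m σ' * F) *
              ((cycleWord π m s).drop (k + 1)).prod := by rw [c2]; simp only [mul_assoc]
          _ = _ := by rw [h2, ← mul_assoc, c1]; simp only [mul_assoc]
      · refine ⟨_, Or.inr ⟨hσ', rfl⟩, prod_mul_of_commutes fun x hx => ?_⟩
        obtain ⟨k, _, rfl⟩ := List.mem_map.1 hx
        exact h3 _ (fun h => hn' (h ▸ hcyc _)) fun h => hσ' (h ▸ hcyc _)

/-- A backward step starts from the last position at the base point and arrives at the first one. -/
theorem BackwardStep.move [Finite S] {s σ σ' : S} {F w : M} (h : BackwardStep π m ℓ σ σ' F)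
    (hw : LegAfter π m ℓ s σ w) : ∃ w', LegBefore π m ℓ s σ' w' ∧ w * F = F * w' := by
  have hcyc : ∀ k, π.SameCycle s ((π ^ k) s) := fun k => ⟨k, by simp⟩
  have hprod : ∀ k, (cycleWord π m s).prod =
      ((cycleWord π m s).take k).prod * ((cycleWord π m s).drop k).prod := fun k => by
    rw [← List.prod_append, List.take_append_drop]
  rcases h with ⟨rfl, h1, h2⟩ | ⟨h0, h1, h2, h3⟩
  · rcases hw with ⟨k, hk0, hk, rfl, rfl⟩ | ⟨hn, rfl⟩
    · obtain ⟨k, rfl⟩ : ∃ j, k = j + 1 := ⟨k - 1, by omega⟩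
      have e : π⁻¹ ((π ^ (k + 1)) s) = (π ^ k) s := by rw [pow_succ']; simp
      obtain ⟨c1, c2⟩ := commutes_take π m hk rfl (fun x hx _ => h2 x hx)
      refine ⟨_, Or.inl ⟨k, hk, e.symm, rfl⟩, ?_⟩
      rw [insertLeg, insertLeg, take_succ_cycleWord π m s k hk, cycleWord_split π m s k hk,
        List.prod_cons]
      calc _ = ((cycleWord π m s).take k).prod * (m ((π ^ (k + 1)) s) * ℓ *
            (((cycleWord π m s).drop (k + 1)).prod * F)) := by simp only [mul_assoc]
        _ = ((cycleWord π m s).take k).prod * (m ((π ^ (k + 1)) s) * ℓ * F) *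
            ((cycleWord π m s).drop (k + 1)).prod := by rw [c2]; simp only [mul_assoc]
        _ = _ := by rw [h1, ← mul_assoc, c1]; simp only [mul_assoc]
    · have hn' : ¬ π.SameCycle s (π⁻¹ σ) := fun h => hn (Equiv.Perm.sameCycle_symm_apply_right.1 h)
      refine ⟨_, Or.inr ⟨hn', rfl⟩, prod_mul_of_commutes fun x hx => ?_⟩
      obtain ⟨k, _, rfl⟩ := List.mem_map.1 hx
      exact h2 _ fun h => hn (h ▸ hcyc _)
  · rcases hw with ⟨k, hk0, hk, rfl, rfl⟩ | ⟨hn, rfl⟩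
    · obtain ⟨k, rfl⟩ : ∃ j, k = j + 1 := ⟨k - 1, by omega⟩
      have hσ' : ¬ π.SameCycle s σ' := fun h => h0 ((hcyc _).symm.trans h)
      obtain ⟨c1, c2⟩ := commutes_take π m hk rfl (fun x hx hx' => h3 x hx
        fun h => hσ' (Equiv.Perm.sameCycle_apply_right.1 (h ▸ hx')))
      refine ⟨_, Or.inr ⟨hσ', rfl⟩, ?_⟩
      rw [hprod (k + 1), insertLeg, take_succ_cycleWord π m s k hk]
      calc _ = ((cycleWord π m s).take k).prod * (m ((π ^ (k + 1)) s) * ℓ *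
            (((cycleWord π m s).drop (k + 1)).prod * F)) := by simp only [mul_assoc]
        _ = ((cycleWord π m s).take k).prod * (m ((π ^ (k + 1)) s) * ℓ * F) *
            ((cycleWord π m s).drop (k + 1)).prod := by rw [c2]; simp only [mul_assoc]
        _ = _ := by rw [h1, ← mul_assoc, c1]; simp only [mul_assoc]
    · by_cases hσ' : π.SameCycle s σ'
      · obtain ⟨k, hk, hk'⟩ := exists_pow_succ (Equiv.Perm.sameCycle_apply_right.2 hσ')
        have e : (π ^ k) s = σ' := by
          rw [pow_succ', Equiv.Perm.mul_apply] at hk'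
          exact π.injective hk'
        obtain ⟨c1, c2⟩ := commutes_take π m hk hk'
          (fun x hx hx' => h3 x (fun h => hn (h ▸ hx')) hx)
        refine ⟨_, Or.inl ⟨k, hk, e, rfl⟩, ?_⟩
        rw [hprod k, insertLeg, cycleWord_split π m s k hk, List.prod_cons, hk']
        calc _ = ((cycleWord π m s).take k).prod * (m (π σ') *
              (((cycleWord π m s).drop (k + 1)).prod * F)) := by simp only [mul_assoc]
          _ = ((cycleWord π m s).take k).prod * (m (π σ') * F) *
              ((cycleWord π m s).drop (k + 1)).prod := by rw [c2]; simp only [mul_assoc]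
          _ = _ := by rw [h2, ← mul_assoc, c1]; simp only [mul_assoc]
      · refine ⟨_, Or.inr ⟨hσ', rfl⟩, prod_mul_of_commutes fun x hx => ?_⟩
        obtain ⟨k, _, rfl⟩ := List.mem_map.1 hx
        exact h3 _ (fun h => hn (h ▸ hcyc _)) fun h => hσ'
          (Equiv.Perm.sameCycle_apply_right.1 (h ▸ hcyc _))

/-- Steps compose along a chain, provided the two conventions at the base point are only
interchanged away from it. -/
theorem move_chain {τ : Type*} (ini fin : τ → S) (op : τ → M) (P Q : S → M → Prop)
    (t : τ) (ts : List τ) (hch : (t :: ts).IsChain fun t t' => fin t = ini t')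
    (step : ∀ t' ∈ t :: ts, ∀ w, P (ini t') w → ∃ w', Q (fin t') w' ∧ w * op t' = op t' * w')
    (conv : ∀ t' ∈ ts, ∀ w, Q (ini t') w → P (ini t') w) (w : M) (hw : P (ini t) w) :
    ∃ w', Q (fin ((t :: ts).getLast (by simp))) w' ∧
      w * ((t :: ts).map op).prod = ((t :: ts).map op).prod * w' := by
  induction ts generalizing t w with
  | nil =>
    obtain ⟨w', h1, h2⟩ := step t (by simp) w hw
    exact ⟨w', h1, by simpa using h2⟩
  | cons t' ts ih =>
    obtain ⟨w₁, h1, h2⟩ := step t (by simp) w hw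
    rw [List.isChain_cons_cons] at hch
    rw [hch.1] at h1
    obtain ⟨w₂, h3, h4⟩ := ih t' hch.2 (fun t'' ht => step t'' (List.mem_cons_of_mem _ ht))
      (fun t'' ht => conv t'' (List.mem_cons_of_mem _ ht)) w₁ (conv t' (by simp) _ h1)
    refine ⟨w₂, by simpa using h3, ?_⟩
    rw [List.map_cons, List.prod_cons, ← mul_assoc, h2, mul_assoc, h4, mul_assoc]

theorem insertLeg_zero (s : S) : insertLeg π m ℓ s 0 = ℓ * (cycleWord π m s).prod := by
  simp [insertLeg]

theorem insertLeg_period (s : S) :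
    insertLeg π m ℓ s (Function.minimalPeriod π s) = (cycleWord π m s).prod * ℓ := by
  simp [insertLeg, ← length_cycleWord π m s]

theorem LegBefore.eq_of_not_sameCycle {s σ : S} {w : M} (h : LegBefore π m ℓ s σ w)
    (hn : ¬ π.SameCycle s σ) : w = (cycleWord π m s).prod := by
  rcases h with ⟨k, _, rfl, _⟩ | ⟨_, h⟩
  · exact absurd ⟨(k : ℤ), by simp⟩ hn
  · exact h

theorem LegAfter.eq_of_not_sameCycle {s σ : S} {w : M} (h : LegAfter π m ℓ s σ w)
    (hn : ¬ π.SameCycle s σ) : w = (cycleWord π m s).prod := by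
  rcases h with ⟨k, _, _, rfl, _⟩ | ⟨_, h⟩
  · exact absurd ⟨(k : ℤ), by simp⟩ hn
  · exact h

variable [Finite S]

theorem minimalPeriod_pos (s : S) : 0 < Function.minimalPeriod π s := by
  obtain ⟨k, hk, _⟩ := exists_pow_succ (Equiv.Perm.SameCycle.refl π s)
  omega

theorem LegBefore.self_eq {s : S} {w : M} (h : LegBefore π m ℓ s s w) :
    w = ℓ * (cycleWord π m s).prod := by
  rcases h with ⟨k, hk, hs, rfl⟩ | ⟨h, _⟩
  · have : k = 0 := pow_injOn_period π hk (minimalPeriod_pos s) (by simpa using hs)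
    rw [this, insertLeg_zero]
  · exact absurd (Equiv.Perm.SameCycle.refl π s) h

theorem LegAfter.self_eq {s : S} {w : M} (h : LegAfter π m ℓ s s w) :
    w = (cycleWord π m s).prod * ℓ := by
  rcases h with ⟨k, hk0, hk, hs, rfl⟩ | ⟨h, _⟩
  · rcases hk.lt_or_eq with hk | rfl
    · have : k = 0 := pow_injOn_period π hk (minimalPeriod_pos s) (by simpa using hs)
      omega
    · rw [insertLeg_period]
  · exact absurd (Equiv.Perm.SameCycle.refl π s) h

theorem LegBefore.self (s : S) : LegBefore π m ℓ s s (ℓ * (cycleWord π m s).prod) :=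
  Or.inl ⟨0, minimalPeriod_pos s, by simp, (insertLeg_zero s).symm⟩

theorem LegAfter.self (s : S) : LegAfter π m ℓ s s ((cycleWord π m s).prod * ℓ) :=
  Or.inl ⟨_, minimalPeriod_pos s, le_rfl, pow_minimalPeriod π s, (insertLeg_period s).symm⟩

variable {τ : Type*} {ini fin : τ → S} {op : τ → M} {t : τ} {ts : List τ}
  (hch : (t :: ts).IsChain fun t t' => fin t = ini t')

include hch

/-- A chain of forward steps removes a leg in front of the word at its initial site. -/
theorem forward_initial (step : ∀ t' ∈ t :: ts, ForwardStep π m ℓ (ini t') (fin t') (op t'))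
    (hne : ∀ t' ∈ ts, ini t' ≠ ini t)
    (hcyc : ¬ π.SameCycle (ini t) (fin ((t :: ts).getLast (by simp)))) :
    ℓ * (cycleWord π m (ini t)).prod * ((t :: ts).map op).prod =
      ((t :: ts).map op).prod * (cycleWord π m (ini t)).prod := by
  obtain ⟨w, h1, h2⟩ := move_chain ini fin op (LegBefore π m ℓ (ini t))
    (LegAfter π m ℓ (ini t)) t ts hch (fun t' ht w hw => (step t' ht).move hw)
    (fun t' ht w hw => hw.before (hne t' ht)) _
    (LegBefore.self _)
  rw [h2, h1.eq_of_not_sameCycle hcyc]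

/-- A chain of backward steps removes a leg behind the word at its initial site. -/
theorem backward_initial (step : ∀ t' ∈ t :: ts, BackwardStep π m ℓ (ini t') (fin t') (op t'))
    (hne : ∀ t' ∈ ts, ini t' ≠ ini t)
    (hcyc : ¬ π.SameCycle (ini t) (fin ((t :: ts).getLast (by simp)))) :
    (cycleWord π m (ini t)).prod * ℓ * ((t :: ts).map op).prod =
      ((t :: ts).map op).prod * (cycleWord π m (ini t)).prod := by
  obtain ⟨w, h1, h2⟩ := move_chain ini fin op (LegAfter π m ℓ (ini t))
    (LegBefore π m ℓ (ini t)) t ts hch (fun t' ht w hw => (step t' ht).move hw)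
    (fun t' ht w hw => hw.after (hne t' ht)) _
    (LegAfter.self _)
  rw [h2, h1.eq_of_not_sameCycle hcyc]

/-- A chain of forward steps leaves a leg behind the word at its final site. -/
theorem forward_final (step : ∀ t' ∈ t :: ts, ForwardStep π m ℓ (ini t') (fin t') (op t')) {s : S}
    (hs : fin ((t :: ts).getLast (by simp)) = s) (hne : ∀ t' ∈ ts, ini t' ≠ s)
    (hcyc : ¬ π.SameCycle (ini t) s) :
    (cycleWord π m s).prod * ((t :: ts).map op).prod =
      ((t :: ts).map op).prod * ((cycleWord π m s).prod * ℓ) := by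
  obtain ⟨w, h1, h2⟩ := move_chain ini fin op (LegBefore π m ℓ s) (LegAfter π m ℓ s) t ts
    hch (fun t' ht w hw => (step t' ht).move hw) (fun t' ht w hw => hw.before (hne t' ht)) _
    (Or.inr ⟨fun h => hcyc h.symm, rfl⟩)
  rw [hs] at h1
  rw [h2, h1.self_eq]

/-- A chain of backward steps leaves a leg in front of the word at its final site. -/
theorem backward_final (step : ∀ t' ∈ t :: ts, BackwardStep π m ℓ (ini t') (fin t') (op t')) {s : S}
    (hs : fin ((t :: ts).getLast (by simp)) = s) (hne : ∀ t' ∈ ts, ini t' ≠ s)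
    (hcyc : ¬ π.SameCycle (ini t) s) :
    (cycleWord π m s).prod * ((t :: ts).map op).prod =
      ((t :: ts).map op).prod * (ℓ * (cycleWord π m s).prod) := by
  obtain ⟨w, h1, h2⟩ := move_chain ini fin op (LegAfter π m ℓ s) (LegBefore π m ℓ s) t ts
    hch (fun t' ht w hw => (step t' ht).move hw) (fun t' ht w hw => hw.after (hne t' ht)) _
    (Or.inr ⟨fun h => hcyc h.symm, rfl⟩)
  rw [hs] at h1
  rw [h2, h1.self_eq]

end CycleWords

/-! ### Darts and edge operators -/

section Conj

variable {H : Type*} [Ring H] [HopfAlgebra ℂ H]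

/-- Conjugation of an operator on `H` by the antipode. It corresponds to reversing an edge. -/
def conjAntipode (hS : ∀ a : H, antipode ℂ (antipode ℂ a) = a) :
    Module.End ℂ H →ₐ[ℂ] Module.End ℂ H :=
  AlgHom.ofLinearMap
    { toFun := fun t => antipode ℂ ∘ₗ t ∘ₗ antipode ℂ
      map_add' := fun s t => by ext; simp
      map_smul' := fun c t => by ext; simp }
    (by ext x; simp [hS]) (fun s t => by ext x; simp [hS])

variable (hS : ∀ a : H, antipode ℂ (antipode ℂ a) = a)

theorem conjAntipode_apply (t : Module.End ℂ H) (x : H) :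
    conjAntipode hS t x = antipode ℂ (t (antipode ℂ x)) := rfl

theorem conjAntipode_conjAntipode (t : Module.End ℂ H) :
    conjAntipode hS (conjAntipode hS t) = t := by
  ext x; simp [conjAntipode_apply, hS]

theorem conjAntipode_mulLeftOp (a : H) :
    conjAntipode hS (mulLeftOp a) = mulRightOp (antipode ℂ a) := by
  ext x; simp [conjAntipode_apply, hS, mulLeftOp, mulRightOp, antipode_mul_antidistrib]

theorem dualAntipode_apply (f : Module.Dual ℂ H) (x : H) : dualAntipode f x = f (antipode ℂ x) :=
  rfl

include hS in
theorem dualAntipode_dualAntipode (f : Module.Dual ℂ H) : dualAntipode (dualAntipode f) = f := by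
  ext x; simp [dualAntipode_apply, hS]

theorem conjAntipode_readFst (f : Module.Dual ℂ H) :
    conjAntipode hS (readFst f) = readSnd (dualAntipode f) := by
  ext x
  rw [conjAntipode_apply, readFst_repr (antipodeRepr (ℛ ℂ x)), readSnd_repr (ℛ ℂ x)]
  simp [antipodeRepr, hS, dualAntipode_apply]

theorem conjAntipode_readSnd (f : Module.Dual ℂ H) :
    conjAntipode hS (readSnd f) = readFst (dualAntipode f) := by
  ext x
  rw [conjAntipode_apply, readSnd_repr (antipodeRepr (ℛ ℂ x)), readFst_repr (ℛ ℂ x)]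
  simp [antipodeRepr, hS, dualAntipode_apply]

end Conj

section Darts

variable {E : Type*}

theorem Dart.rev_rev (d : Dart E) : Dart.rev (Dart.rev d) = d := by
  obtain ⟨e, b⟩ := d
  simp [Dart.rev]

theorem Dart.eq_or_eq_rev {d d' : Dart E} (h : d'.1 = d.1) : d' = d ∨ d' = Dart.rev d := by
  obtain ⟨e, b⟩ := d
  obtain ⟨e', b'⟩ := d'
  obtain rfl : e' = e := h
  cases b <;> cases b' <;> simp [Dart.rev]

theorem Lattice.next_inv_apply (Γ : Lattice E) (d : Dart E) :
    Γ.next⁻¹ d = Dart.rev (Γ.rot d) := by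
  rw [Equiv.Perm.inv_eq_iff_eq]
  simp [Lattice.next, Dart.rev_rev]

theorem Lattice.next_apply (Γ : Lattice E) (d : Dart E) :
    Γ.next d = Γ.rot⁻¹ (Dart.rev d) := rfl

end Darts

section EdgeHom

variable {E : Type*} [DecidableEq E] {H : Type*} [Ring H] [HopfAlgebra ℂ H]

theorem onEdge_apply (e : E) (t : Module.End ℂ H) : (onEdge e t : Module.End ℂ (StateSpace E H)) =
    PiTensorProduct.map (Function.update (fun _ => LinearMap.id) e t) := rfl

theorem onEdge_one (e : E) : (onEdge e 1 : Module.End ℂ (StateSpace E H)) = 1 := by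
  rw [onEdge_apply]
  have : Function.update (fun _ : E => (LinearMap.id : H →ₗ[ℂ] H)) e 1 = fun _ => LinearMap.id := by
    rw [Function.update_eq_self_iff]; rfl
  rw [this]
  exact PiTensorProduct.map_id

theorem onEdge_mul (e : E) (s t : Module.End ℂ H) :
    (onEdge e (s * t) : Module.End ℂ (StateSpace E H)) = onEdge e s * onEdge e t := by
  simp only [onEdge_apply, Module.End.mul_eq_comp]
  rw [← PiTensorProduct.map_comp]
  congr 1
  funext e'
  by_cases h : e' = e
  · subst h; simp
  · simp [h]

theorem onEdge_comm {e e' : E} (h : e ≠ e') (s t : Module.End ℂ H) :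
    (onEdge e s * onEdge e' t : Module.End ℂ (StateSpace E H)) = onEdge e' t * onEdge e s := by
  rw [onEdge_apply, onEdge_apply, Module.End.mul_eq_comp, Module.End.mul_eq_comp,
    ← PiTensorProduct.map_comp, ← PiTensorProduct.map_comp]
  congr 1
  funext e''
  by_cases h1 : e'' = e
  · subst h1; simp [h]
  · by_cases h2 : e'' = e'
    · subst h2; simp [h1]
    · simp [h1, h2]

/-- `onEdge` as an algebra map. -/
def edgeHom (E : Type*) [DecidableEq E] (H : Type*) [Ring H] [HopfAlgebra ℂ H] (e : E) :
    Module.End ℂ H →ₐ[ℂ] Module.End ℂ (StateSpace E H) :=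
  AlgHom.ofLinearMap (onEdge e) (onEdge_one e) (onEdge_mul e)

variable (hS : ∀ a : H, antipode ℂ (antipode ℂ a) = a)

/-- Operators on the edge of a dart, where the edge is directed along the dart. -/
def dartHom (d : Dart E) : Module.End ℂ H →ₐ[ℂ] Module.End ℂ (StateSpace E H) :=
  match d.2 with
  | true => edgeHom E H d.1
  | false => (edgeHom E H d.1).comp (conjAntipode hS)

theorem dartHom_rev (d : Dart E) (t : Module.End ℂ H) :
    dartHom hS (Dart.rev d) t = dartHom hS d (conjAntipode hS t) := by
  obtain ⟨e, b⟩ := d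
  cases b
  · simp [dartHom, Dart.rev, conjAntipode_conjAntipode]
  · simp [dartHom, Dart.rev]

theorem dartHom_comm {d d' : Dart E} (h : d.1 ≠ d'.1) (s t : Module.End ℂ H) :
    dartHom hS d s * dartHom hS d' t = dartHom hS d' t * dartHom hS d s := by
  obtain ⟨e, b⟩ := d
  obtain ⟨e', b'⟩ := d'
  cases b <;> cases b' <;> exact onEdge_comm h _ _

theorem onEdge_edgeL (d : Dart E) (a : H) :
    onEdge d.1 (edgeL d.2 a) = dartHom hS d (mulLeftOp a) := by
  obtain ⟨e, b⟩ := d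
  cases b
  · simp [dartHom, edgeL, edgeHom, conjAntipode_mulLeftOp]
  · rfl

theorem onEdge_edgeT (d : Dart E) (f : Module.Dual ℂ H) :
    onEdge d.1 (edgeT d.2 f) = dartHom hS d (readSnd f) := by
  obtain ⟨e, b⟩ := d
  cases b
  · simp [dartHom, edgeT, edgeHom, conjAntipode_readSnd]
  · rfl

theorem onEdge_directOp_clockwise (d : Dart E) (f : Module.Dual ℂ H) :
    onEdge d.1 (directOp .clockwise d.2 f) = dartHom hS d (readFst f) := by
  obtain ⟨e, b⟩ := d
  cases b
  · simp [dartHom, directOp, edgeHom, conjAntipode_readFst]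
  · rfl

theorem onEdge_directOp_counterclockwise (d : Dart E) (f : Module.Dual ℂ H) :
    onEdge d.1 (directOp .counterclockwise d.2 f) = dartHom hS d (readSnd f) := by
  obtain ⟨e, b⟩ := d
  cases b
  · simp [dartHom, directOp, edgeHom, conjAntipode_readSnd]
  · rfl

theorem onEdge_dualOp_clockwise (d : Dart E) (a : H) :
    onEdge d.1 (dualOp .clockwise d.2 a) = dartHom hS d (mulLeftOp a) := by
  obtain ⟨e, b⟩ := d
  cases b
  · simp [dartHom, dualOp, edgeHom, conjAntipode_mulLeftOp]
  · rfl

theorem onEdge_dualOp_counterclockwise (d : Dart E) (a : H) :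
    onEdge d.1 (dualOp .counterclockwise d.2 a) = dartHom hS d (mulLeftOp (antipode ℂ a)) := by
  obtain ⟨e, b⟩ := d
  cases b
  · simp [dartHom, dualOp, edgeHom, conjAntipode_mulLeftOp, hS]
  · rfl

end EdgeHom

/-! ### Universal ribbon operators -/

section RibbonElements

variable {E : Type*} [DecidableEq E] {H : Type*} [Ring H] [HopfAlgebra ℂ H]

/-- Operators on the state space with coefficients in the double. -/
abbrev DoubleOp (E H : Type*) [Ring H] [HopfAlgebra ℂ H] : Type _ :=
  DrinfeldDouble H ⊗[ℂ] Module.End ℂ (StateSpace E H)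

/-- Elements of the double as constant operators. -/
def coeffHom (E H : Type*) [Ring H] [HopfAlgebra ℂ H] : DrinfeldDouble H →ₐ[ℂ] DoubleOp E H :=
  Algebra.TensorProduct.includeLeft

/-- Operators with trivial coefficients. -/
def opHom (E H : Type*) [Ring H] [HopfAlgebra ℂ H] :
    Module.End ℂ (StateSpace E H) →ₐ[ℂ] DoubleOp E H :=
  Algebra.TensorProduct.includeRight

omit [DecidableEq E] in
theorem coeffHom_comm (m : DrinfeldDouble H) (t : Module.End ℂ (StateSpace E H)) :
    coeffHom E H m * opHom E H t = opHom E H t * coeffHom E H m := by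
  simp [coeffHom, opHom]

variable (hS : ∀ a : H, antipode ℂ (antipode ℂ a) = a)

/-- `dartHom` with values in the operators with coefficients in the double. -/
def dartOp (d : Dart E) : Module.End ℂ H →ₐ[ℂ] DoubleOp E H := (opHom E H).comp (dartHom hS d)

theorem coeffHom_comm_dartOp (d : Dart E) (m : DrinfeldDouble H) (t : Module.End ℂ H) :
    coeffHom E H m * dartOp hS d t = dartOp hS d t * coeffHom E H m := coeffHom_comm _ _

theorem dartOp_comm {d d' : Dart E} (h : d.1 ≠ d'.1) (s t : Module.End ℂ H) :
    dartOp hS d s * dartOp hS d' t = dartOp hS d' t * dartOp hS d s := by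
  simp only [dartOp, AlgHom.comp_apply, ← map_mul, dartHom_comm hS h]

theorem dartOp_rev (d : Dart E) (t : Module.End ℂ H) :
    dartOp hS (Dart.rev d) t = dartOp hS d (conjAntipode hS t) := by
  simp only [dartOp, AlgHom.comp_apply, dartHom_rev]

variable [FiniteDimensional ℂ H]

omit [FiniteDimensional ℂ H] in
theorem outA_rev (d : Dart E) : outA (dartOp hS (Dart.rev d)) = inA (dartOp hS d) := by
  ext a
  simp [outA, inA, dartOp_rev, conjAntipode_mulLeftOp]

theorem alongB_rev (d : Dart E) : alongB (dartOp hS (Dart.rev d)) = againstB (dartOp hS d) := by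
  simp only [alongB, againstB]
  congr 1
  ext1 f
  simp [dartOp_rev, conjAntipode_readSnd]

/-- The operator of a triangle as a single operator with coefficients in the double: the
operators `F^ξ(t)` arise from it by applying `ξ` to the coefficients. -/
def triangleElem {Γ : Lattice E} (t : Triangle Γ) : DoubleOp E H :=
  match t.type with
  | .direct => canon ((coeffHom E H).toLinearMap ∘ₗ inclH.toLinearMap)
      ((opHom E H).toLinearMap ∘ₗ onEdge t.dart.1 ∘ₗ directOp t.orientation t.dart.2)
  | .dual => canon ((opHom E H).toLinearMap ∘ₗ onEdge t.dart.1 ∘ₗ dualOp t.orientation t.dart.2)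
      ((coeffHom E H).toLinearMap ∘ₗ inclDual)

/-- The product of the operators of a sequence of triangles. -/
def ribbonElem {Γ : Lattice E} (l : List (Triangle Γ)) : DoubleOp E H :=
  (l.map triangleElem).prod

variable {Γ : Lattice E}

theorem triangleElem_direct_clockwise (σ : Γ.Site) :
    triangleElem (Γ := Γ) ⟨σ, .direct, .clockwise⟩ =
      directF (coeffHom E H) (dartOp hS (Γ.rot σ)) := by
  simp only [triangleElem, directF]
  congr 1
  ext1 f
  simp [dartOp, Triangle.dart, onEdge_directOp_clockwise hS]

theorem triangleElem_dual_clockwise (σ : Γ.Site) :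
    triangleElem (Γ := Γ) ⟨σ, .dual, .clockwise⟩ =
      dualF (coeffHom E H) (dartOp hS (Γ.rot σ)) := by
  simp only [triangleElem, dualF]
  congr 1
  ext1 f
  simp [dartOp, Triangle.dart, onEdge_dualOp_clockwise hS]

include hS in
/-- A counterclockwise triangle is inverse to the clockwise triangle that runs back. -/
theorem triangleElem_direct_inv (σ : Γ.Site) :
    triangleElem (H := H) (Γ := Γ) ⟨Γ.next σ, .direct, .clockwise⟩ *
      triangleElem (Γ := Γ) ⟨σ, .direct, .counterclockwise⟩ = 1 ∧
    triangleElem (H := H) (Γ := Γ) ⟨σ, .direct, .counterclockwise⟩ *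
      triangleElem (Γ := Γ) ⟨Γ.next σ, .direct, .clockwise⟩ = 1 := by
  have h := canon_isUnit ((coeffHom E H).comp inclH) ((dartOp hS σ).toLinearMap ∘ₗ readSnd)
    (fun f a => (coeffHom_comm_dartOp hS _ _ _).symm) (fun f g => by simp [readSnd_convProd])
    (by simp [readSnd_counit])
  have h1 : triangleElem (H := H) (Γ := Γ) ⟨σ, .direct, .counterclockwise⟩ =
      canon ((coeffHom E H).comp inclH).toLinearMap ((dartOp hS σ).toLinearMap ∘ₗ readSnd) := by
    simp only [triangleElem]
    congr 1
    ext1 f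
    simp [dartOp, Triangle.dart, onEdge_directOp_counterclockwise hS]
  have h2 : triangleElem (H := H) (Γ := Γ) ⟨Γ.next σ, .direct, .clockwise⟩ =
      canon ((coeffHom E H).comp inclH).toLinearMap
        (((dartOp hS σ).toLinearMap ∘ₗ readSnd) ∘ₗ dualAntipode) := by
    rw [triangleElem_direct_clockwise hS, directF]
    congr 1
    ext1 f
    have : Γ.rot (Γ.next σ) = Dart.rev σ := by simp [Lattice.next_apply]
    simp [this, dartOp_rev, conjAntipode_readFst]
  rw [h1, h2]
  exact ⟨h.2, h.1⟩

include hS in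
/-- A counterclockwise dual triangle is inverse to the clockwise one that runs back. -/
theorem triangleElem_dual_inv (σ : Γ.Site) :
    triangleElem (H := H) (Γ := Γ) ⟨Γ.rot⁻¹ σ, .dual, .clockwise⟩ *
      triangleElem (Γ := Γ) ⟨σ, .dual, .counterclockwise⟩ = 1 ∧
    triangleElem (H := H) (Γ := Γ) ⟨σ, .dual, .counterclockwise⟩ *
      triangleElem (Γ := Γ) ⟨Γ.rot⁻¹ σ, .dual, .clockwise⟩ = 1 := by
  have h := canon_isUnit ((dartOp hS σ).comp mulLeftHom) ((coeffHom E H).toLinearMap ∘ₗ inclDual)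
    (fun f a => coeffHom_comm_dartOp hS _ _ _) (fun f g => by simp [inclDual_mul])
    (by simp [inclDual_counit])
  have h1 : triangleElem (H := H) (Γ := Γ) ⟨σ, .dual, .counterclockwise⟩ =
      canon ((dartOp hS σ).comp mulLeftHom).toLinearMap
        (((coeffHom E H).toLinearMap ∘ₗ inclDual) ∘ₗ dualAntipode) := by
    refine Eq.trans ?_ (canon_comp_left _ _ _)
    simp only [triangleElem]
    congr 1
    ext1 a
    simp [dartOp, Triangle.dart, onEdge_dualOp_counterclockwise hS, mulLeftHom_apply]
  have h2 : triangleElem (H := H) (Γ := Γ) ⟨Γ.rot⁻¹ σ, .dual, .clockwise⟩ =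
      canon ((dartOp hS σ).comp mulLeftHom).toLinearMap
        ((coeffHom E H).toLinearMap ∘ₗ inclDual) := by
    rw [triangleElem_dual_clockwise hS, dualF]
    congr 1
    ext1 a
    simp [mulLeftHom_apply]
  rw [h1, h2]
  exact h

end RibbonElements

/-! ### Local steps of a ribbon -/

section Steps

variable {E : Type*} [DecidableEq E] {H : Type*} [Ring H] [HopfAlgebra ℂ H]
  [FiniteDimensional ℂ H] (hS : ∀ a : H, antipode ℂ (antipode ℂ a) = a) {Γ : Lattice E}

/-- The letters of vertex operators. -/
def vertexLetter (d : Dart E) : WithConv (H →ₗ[ℂ] DoubleOp E H) := outA (dartOp hS d)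

/-- The letters of face operators. The letter of a site belongs to the dart that ends there. -/
def faceLetter (Γ : Lattice E) (σ : Γ.Site) : H ⊗[ℂ] DoubleOp E H :=
  alongB (dartOp hS (Γ.next⁻¹ σ))

/-- An element that commutes with both families commutes with the image of the canonical element. -/
theorem canon_comm {X : Type*} [Ring X] [Algebra ℂ X] (ψ : H →ₗ[ℂ] X)
    (r : Module.Dual ℂ H →ₗ[ℂ] X) {x : X} (h1 : ∀ a, x * ψ a = ψ a * x)
    (h2 : ∀ f, x * r f = r f * x) : x * canon ψ r = canon ψ r * x := by
  simp only [canon, Finset.mul_sum, Finset.sum_mul]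
  refine Finset.sum_congr rfl fun k _ => ?_
  rw [← mul_assoc, h1, mul_assoc, h2, mul_assoc]

theorem dartOp_comm_directF {d d' : Dart E} (h : d.1 ≠ d'.1) (s : Module.End ℂ H) :
    dartOp hS d s * directF (coeffHom E H) (dartOp hS d') =
      directF (coeffHom E H) (dartOp hS d') * dartOp hS d s :=
  canon_comm _ _ (fun _ => (coeffHom_comm_dartOp hS _ _ _).symm) (fun _ => dartOp_comm hS h _ _)

theorem dartOp_comm_dualF {d d' : Dart E} (h : d.1 ≠ d'.1) (s : Module.End ℂ H) :
    dartOp hS d s * dualF (coeffHom E H) (dartOp hS d') =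
      dualF (coeffHom E H) (dartOp hS d') * dartOp hS d s :=
  canon_comm _ _ (fun _ => dartOp_comm hS h _ _) (fun _ => (coeffHom_comm_dartOp hS _ _ _).symm)

omit [FiniteDimensional ℂ H] in
theorem vertexLetter_comm {d : Dart E} {F : DoubleOp E H}
    (h : ∀ s, dartOp hS d s * F = F * dartOp hS d s) :
    vertexLetter hS d * constConv F = constConv F * vertexLetter hS d := by
  ext a
  rw [mul_constConv_apply, constConv_mul_apply]
  exact h _

theorem alongB_comm {d : Dart E} {F : DoubleOp E H}
    (h : ∀ s, dartOp hS d s * F = F * dartOp hS d s) :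
    alongB (dartOp hS d) * constTensor F = constTensor F * alongB (dartOp hS d) :=
  (constTensor_comm_encode _ _ fun _ => (h _).symm).symm

/-- A clockwise direct triangle takes the leg from the vertex at one end of its edge, where it is
absorbed, to the vertex at the other end. The two vertices are distinct. -/
theorem vertex_step_direct (σ : Γ.Site) :
    ForwardStep Γ.rot (vertexLetter hS) (legA (coeffHom E H)) σ (Γ.next⁻¹ σ)
      (constConv (triangleElem (Γ := Γ) ⟨σ, .direct, .clockwise⟩)) := by
  rw [triangleElem_direct_clockwise hS, Γ.next_inv_apply]
  have hc := coeffHom_comm_dartOp (E := E) hS (Γ.rot σ)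
  refine Or.inr ⟨fun h => Γ.ends_ne (Γ.rot σ) (Equiv.Perm.sameCycle_apply_left.2 h),
    legA_outA_directF hc, ?_,
    fun x h1 h2 => vertexLetter_comm hS fun s => dartOp_comm_directF hS ?_ s⟩
  · rw [vertexLetter, outA_rev]
    exact inA_directF hc
  · exact fun h => (Dart.eq_or_eq_rev h).elim h1 h2

/-- A clockwise dual triangle stays at its vertex, and the leg passes the crossed edge. -/
theorem vertex_step_dual (σ : Γ.Site) :
    ForwardStep Γ.rot (vertexLetter hS) (legA (coeffHom E H)) σ (Γ.rot σ)
      (constConv (triangleElem (Γ := Γ) ⟨σ, .dual, .clockwise⟩)) := by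
  rw [triangleElem_dual_clockwise hS]
  have hc := coeffHom_comm_dartOp (E := E) hS (Γ.rot σ)
  refine Or.inl ⟨rfl, legA_outA_dualF hc hS, fun x h1 => ?_⟩
  by_cases h2 : x = Dart.rev (Γ.rot σ)
  · rw [h2, vertexLetter, outA_rev]
    exact inA_dualF hc
  · exact vertexLetter_comm hS fun s =>
      dartOp_comm_dualF hS (fun h => (Dart.eq_or_eq_rev h).elim h1 h2) s

/-- A clockwise direct triangle stays in its face, and the leg passes its edge. -/
theorem face_step_direct (σ : Γ.Site) :
    BackwardStep Γ.next (faceLetter hS Γ) (legB (coeffHom E H)) σ (Γ.next⁻¹ σ)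
      (constTensor (triangleElem (Γ := Γ) ⟨σ, .direct, .clockwise⟩)) := by
  rw [triangleElem_direct_clockwise hS]
  have hc := coeffHom_comm_dartOp (E := E) hS (Γ.rot σ)
  refine Or.inl ⟨rfl, ?_, fun x h1 => ?_⟩
  · rw [faceLetter, Γ.next_inv_apply, alongB_rev]
    exact againstB_legB_directF hc hS
  · rw [faceLetter, Γ.next_inv_apply]
    by_cases h2 : Dart.rev (Γ.rot x) = Γ.rot σ
    · rw [h2]
      exact alongB_directF hc
    · refine alongB_comm hS fun s => dartOp_comm_directF hS (fun h => ?_) s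
      rcases Dart.eq_or_eq_rev h with h | h
      · exact h2 h
      · exact h1 (Γ.rot.injective (Dart.rev.injective h))

/-- A clockwise dual triangle takes the leg from one side of the crossed edge to the face on the
other side. The two faces are distinct. -/
theorem face_step_dual (σ : Γ.Site) :
    BackwardStep Γ.next (faceLetter hS Γ) (legB (coeffHom E H)) σ (Γ.rot σ)
      (constTensor (triangleElem (Γ := Γ) ⟨σ, .dual, .clockwise⟩)) := by
  rw [triangleElem_dual_clockwise hS]
  have hc := coeffHom_comm_dartOp (E := E) hS (Γ.rot σ)
  have h0 : faceLetter hS Γ (Γ.next (Γ.rot σ)) = alongB (dartOp hS (Γ.rot σ)) := by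
    simp [faceLetter]
  have h1 : faceLetter hS Γ σ = againstB (dartOp hS (Γ.rot σ)) := by
    rw [faceLetter, Γ.next_inv_apply, alongB_rev]
  refine Or.inr ⟨fun h => Γ.sides_ne (Γ.rot σ) ?_, ?_, ?_, fun x h2 h3 => ?_⟩
  · rw [← Γ.next_inv_apply]
    exact (Equiv.Perm.sameCycle_symm_apply_right.2 h.symm)
  · rw [h1]
    exact againstB_legB_dualF hc hS
  · rw [h0]
    exact alongB_dualF hc
  · refine alongB_comm hS fun s => dartOp_comm_dualF hS (fun h => ?_) s
    rcases Dart.eq_or_eq_rev h with h | h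
    · exact h3 (by rw [← h]; simp)
    · rw [← Γ.next_inv_apply] at h
      exact h2 (Γ.next⁻¹.injective h)

theorem vertex_step_clockwise (t : Triangle Γ) (ht : t.orientation = .clockwise) :
    ForwardStep Γ.rot (vertexLetter hS) (legA (coeffHom E H)) t.initial t.final
      (constConv (triangleElem t)) := by
  obtain ⟨σ, ty, or⟩ := t
  obtain rfl : or = .clockwise := ht
  cases ty
  · exact vertex_step_direct hS σ
  · exact vertex_step_dual hS σ

theorem face_step_clockwise (t : Triangle Γ) (ht : t.orientation = .clockwise) :
    BackwardStep Γ.next (faceLetter hS Γ) (legB (coeffHom E H)) t.initial t.final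
      (constTensor (triangleElem t)) := by
  obtain ⟨σ, ty, or⟩ := t
  obtain rfl : or = .clockwise := ht
  cases ty
  · exact face_step_direct hS σ
  · exact face_step_dual hS σ

/-- A counterclockwise triangle is inverse to a clockwise one, which turns forward into backward
steps. -/
theorem vertex_step_counterclockwise (t : Triangle Γ) (ht : t.orientation = .counterclockwise) :
    BackwardStep Γ.rot (vertexLetter hS) (legA (coeffHom E H)) t.initial t.final
      (constConv (triangleElem t)) := by
  obtain ⟨σ, ty, or⟩ := t
  obtain rfl : or = .counterclockwise := ht
  cases ty
  · obtain ⟨h1, h2⟩ := triangleElem_direct_inv (Γ := Γ) hS σ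
    have h := (vertex_step_direct hS (Γ.next σ)).inv (G := constConv (triangleElem ⟨σ, _, _⟩))
      (by rw [← map_mul, h1, map_one]) (by rw [← map_mul, h2, map_one])
    simpa [Triangle.final] using h
  · obtain ⟨h1, h2⟩ := triangleElem_dual_inv (Γ := Γ) hS σ
    have h := (vertex_step_dual hS (Γ.rot⁻¹ σ)).inv (G := constConv (triangleElem ⟨σ, _, _⟩))
      (by rw [← map_mul, h1, map_one]) (by rw [← map_mul, h2, map_one])
    simpa [Triangle.final] using h

theorem face_step_counterclockwise (t : Triangle Γ) (ht : t.orientation = .counterclockwise) :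
    ForwardStep Γ.next (faceLetter hS Γ) (legB (coeffHom E H)) t.initial t.final
      (constTensor (triangleElem t)) := by
  obtain ⟨σ, ty, or⟩ := t
  obtain rfl : or = .counterclockwise := ht
  cases ty
  · obtain ⟨h1, h2⟩ := triangleElem_direct_inv (Γ := Γ) hS σ
    have h := (face_step_direct hS (Γ.next σ)).inv (G := constTensor (triangleElem ⟨σ, _, _⟩))
      (by rw [← map_mul, h1, map_one]) (by rw [← map_mul, h2, map_one])
    simpa [Triangle.final] using h
  · obtain ⟨h1, h2⟩ := triangleElem_dual_inv (Γ := Γ) hS σ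
    have h := (face_step_dual hS (Γ.rot⁻¹ σ)).inv (G := constTensor (triangleElem ⟨σ, _, _⟩))
      (by rw [← map_mul, h1, map_one]) (by rw [← map_mul, h2, map_one])
    simpa [Triangle.final] using h

include hS in
/-- Every triangle operator is invertible. -/
theorem triangleElem_isUnit (t : Triangle Γ) : IsUnit (triangleElem (H := H) t) := by
  obtain ⟨σ, ty, or⟩ := t
  cases or <;> cases ty
  · obtain ⟨h1, h2⟩ := triangleElem_direct_inv (Γ := Γ) hS (Γ.next⁻¹ σ)
    rw [show Γ.next (Γ.next⁻¹ σ) = σ by simp] at h1 h2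
    exact ⟨⟨_, _, h1, h2⟩, rfl⟩
  · obtain ⟨h1, h2⟩ := triangleElem_dual_inv (Γ := Γ) hS (Γ.rot σ)
    rw [show Γ.rot⁻¹ (Γ.rot σ) = σ by simp] at h1 h2
    exact ⟨⟨_, _, h1, h2⟩, rfl⟩
  · obtain ⟨h1, h2⟩ := triangleElem_direct_inv (Γ := Γ) hS σ
    exact ⟨⟨_, _, h2, h1⟩, rfl⟩
  · obtain ⟨h1, h2⟩ := triangleElem_dual_inv (Γ := Γ) hS σ
    exact ⟨⟨_, _, h2, h1⟩, rfl⟩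

include hS in
theorem ribbonElem_isUnit (l : List (Triangle Γ)) : IsUnit (ribbonElem (H := H) l) := by
  induction l with
  | nil => simp [ribbonElem]
  | cons t l ih =>
    rw [ribbonElem, List.map_cons, List.prod_cons]
    exact (triangleElem_isUnit hS t).mul ih

end Steps

/-! ### Combinatorics of ribbons -/

section RibbonCombinatorics

variable {E : Type*} {Γ : Lattice E}

/-- The quarter in which a triangle of the given local orientation leaves its initial site. -/
def leavingCell (Γ : Lattice E) : LocalOrientation → Γ.Site → Dart E × Bool
  | .clockwise, σ => (Γ.rot σ, false)
  | .counterclockwise, σ => (σ, true)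

/-- The quarter in which a triangle of the given local orientation arrives at its terminal site. -/
def arrivingCell (Γ : Lattice E) : LocalOrientation → Γ.Site → Dart E × Bool
  | .clockwise, σ => (σ, true)
  | .counterclockwise, σ => (Γ.rot σ, false)

theorem leavingCell_mem (t : Triangle Γ) : leavingCell Γ t.orientation t.initial ∈ t.region := by
  obtain ⟨σ, ty, o⟩ := t
  cases ty <;> cases o <;> simp [leavingCell, Triangle.region, Triangle.dart]

theorem arrivingCell_mem (t : Triangle Γ) : arrivingCell Γ t.orientation t.final ∈ t.region := by
  obtain ⟨σ, ty, o⟩ := t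
  cases ty <;> cases o <;>
    simp [arrivingCell, Triangle.region, Triangle.dart, Triangle.final, Lattice.next_inv_apply,
      Lattice.next_apply, ← Equiv.Perm.inv_def]

/-- Triangles of different local orientation overlap if one starts where the other one ends. -/
theorem orientation_eq_of_disjoint {t t' : Triangle Γ} (h : t.final = t'.initial)
    (hd : Disjoint t.region t'.region) : t.orientation = t'.orientation := by
  by_contra hne
  refine Set.disjoint_left.1 hd (arrivingCell_mem t) ?_
  have : arrivingCell Γ t.orientation t.final = leavingCell Γ t'.orientation t'.initial := by
    rw [h]
    cases ho : t.orientation <;> cases ho' : t'.orientation <;> simp_all [arrivingCell, leavingCell]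
  rw [this]
  exact leavingCell_mem t'

variable {t : Triangle Γ} {ts : List (Triangle Γ)}
  (hch : (t :: ts).IsChain fun t t' => t.final = t'.initial)
  (hd : (t :: ts).Pairwise fun t t' => Disjoint t.region t'.region)

include hch hd

/-- All triangles of a ribbon have the same local orientation. -/
theorem orientation_eq_head : ∀ t' ∈ t :: ts, t'.orientation = t.orientation := by
  induction ts generalizing t with
  | nil => simp
  | cons u us ih =>
    rw [List.isChain_cons_cons] at hch
    rw [List.pairwise_cons] at hd
    have h := orientation_eq_of_disjoint hch.1 (hd.1 u (by simp))
    intro t' ht'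
    rcases List.mem_cons.1 ht' with rfl | ht'
    · rfl
    · rw [ih hch.2 hd.2 t' ht', h]

/-- A ribbon does not return to its initial site before its end, for it would leave that site
through the same quarter again. -/
theorem initial_ne_initial : ∀ t' ∈ ts, t'.initial ≠ t.initial := by
  intro t' ht' h
  have ho := orientation_eq_head hch hd t' (List.mem_cons_of_mem _ ht')
  refine Set.disjoint_left.1 ((List.pairwise_cons.1 hd).1 t' ht') (leavingCell_mem t) ?_
  rw [← h, ← ho]
  exact leavingCell_mem t'

/-- A ribbon does not pass its final site before its end, for it would arrive there through the same
quarter twice. -/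
theorem initial_ne_final :
    ∀ t' ∈ ts, t'.initial ≠ ((t :: ts).getLast (by simp)).final := by
  induction ts generalizing t with
  | nil => simp
  | cons u us ih =>
    have ho := orientation_eq_head hch hd
    rw [List.isChain_cons_cons] at hch
    rw [List.pairwise_cons] at hd
    intro t' ht'
    rw [List.getLast_cons (by simp)]
    rcases List.mem_cons.1 ht' with rfl | ht'
    · intro h
      have hl := List.getLast_mem (l := t' :: us) (by simp)
      refine Set.disjoint_left.1 (hd.1 _ hl) (arrivingCell_mem t) ?_
      rw [hch.1, h, ← ho _ (List.mem_cons_of_mem _ hl)]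
      exact arrivingCell_mem _
    · exact ih hch.2 hd.2 t' ht'

end RibbonCombinatorics

/-! ### Commutation of local operators with ribbon operators -/

section Words

open WithConv

variable {E : Type*} [DecidableEq E] {H : Type*} [Ring H] [HopfAlgebra ℂ H]
  [FiniteDimensional ℂ H] (hS : ∀ a : H, antipode ℂ (antipode ℂ a) = a) {Γ : Lattice E}

/-- The operators `A_a(s)` as an element of the convolution algebra. -/
def vertexWord (H : Type*) [Ring H] [HopfAlgebra ℂ H] (Γ : Lattice E) (s : Γ.Site) :
    WithConv (H →ₗ[ℂ] DoubleOp E H) :=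
  toConv ((opHom E H).toLinearMap ∘ₗ opA Γ s)

/-- The operators `B_f(s)`, encoded as an element of a tensor product. -/
def faceWord (H : Type*) [Ring H] [HopfAlgebra ℂ H] [FiniteDimensional ℂ H] (Γ : Lattice E)
    (s : Γ.Site) : H ⊗[ℂ] DoubleOp E H :=
  encode ((opHom E H).toLinearMap ∘ₗ opB Γ s)

omit [FiniteDimensional ℂ H] in
theorem vertexOpList_eq_prod (l : List (Dart E)) :
    toConv ((opHom E H).toLinearMap ∘ₗ vertexOpList l) = (l.map (vertexLetter hS)).prod := by
  induction l with
  | nil =>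
    ext a
    simp [vertexOpList, Algebra.algebraMap_eq_smul_one]
  | cons d l ih =>
    rw [List.map_cons, List.prod_cons, ← ih]
    ext a
    rw [(ℛ ℂ a).convMul_apply]
    simp only [vertexOpList, LinearMap.comp_apply]
    rw [← (ℛ ℂ a).eq]
    simp [vertexLetter, outA, dartOp, ← onEdge_edgeL hS]

theorem faceOpList_eq_prod (l : List (Dart E)) :
    encode ((opHom E H).toLinearMap ∘ₗ faceOpList l) =
      (l.map fun d => alongB (dartOp hS d)).prod := by
  induction l with
  | nil =>
    simp only [encode, faceOpList, LinearMap.comp_apply, LinearMap.smulRight_apply, map_smul]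
    simp only [← TensorProduct.smul_tmul, ← TensorProduct.sum_tmul]
    rw [List.map_nil, List.prod_nil, Algebra.TensorProduct.one_def]
    simp
  | cons d l ih =>
    rw [List.map_cons, List.prod_cons, ← ih, alongB]
    conv_rhs => rw [encode, Finset.sum_mul]
    simp only [tmul_mul_encode]
    rw [Finset.sum_comm]
    simp only [← TensorProduct.tmul_sum]
    refine Finset.sum_congr rfl fun k _ => ?_
    simp [faceOpList, dartOp, ← onEdge_edgeT hS]
    rfl

omit [FiniteDimensional ℂ H] in
theorem vertexWord_eq_prod (s : Γ.Site) :
    vertexWord H Γ s = (cycleWord Γ.rot (vertexLetter hS) s).prod := by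
  rw [vertexWord, opA, vertexOpList_eq_prod hS, cycleWord, Lattice.vertexDarts, List.map_map]
  rfl

theorem faceWord_eq_prod (s : Γ.Site) :
    faceWord H Γ s = (cycleWord Γ.next (faceLetter hS Γ) s).prod := by
  rw [faceWord, opB, faceOpList_eq_prod hS, cycleWord, Lattice.faceDarts, List.map_map]
  congr 2
  funext k
  simp [faceLetter, pow_succ']

/-- Homomorphisms, in particular constants, are applied to a ribbon operator triangle by triangle.
-/
theorem map_ribbonElem {M 𝓕 : Type*} [Monoid M] [FunLike 𝓕 (DoubleOp E H) M]
    [MonoidHomClass 𝓕 (DoubleOp E H) M] (c : 𝓕) (l : List (Triangle Γ)) :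
    (l.map fun t => c (triangleElem t)).prod = c (ribbonElem l) := by
  rw [ribbonElem, map_list_prod, List.map_map]; rfl

variable {t : Triangle Γ} {ts : List (Triangle Γ)} {s : Γ.Site} [Finite E]
  (hch : (t :: ts).IsChain fun t t' => t.final = t'.initial)
  (hd : (t :: ts).Pairwise fun t t' => Disjoint t.region t'.region)
  (hs : ((t :: ts).getLast (by simp)).final = s)

include hS hch hd hs

/-- The vertex operators at the initial site of a ribbon pick up an element of the double. -/
theorem vertexWord_initial (hv : ¬ Γ.rot.SameCycle t.initial s) :
    legA (coeffHom E H) * vertexWord H Γ t.initial * constConv (ribbonElem (t :: ts)) =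
        constConv (ribbonElem (t :: ts)) * vertexWord H Γ t.initial ∨
      vertexWord H Γ t.initial * legA (coeffHom E H) * constConv (ribbonElem (t :: ts)) =
        constConv (ribbonElem (t :: ts)) * vertexWord H Γ t.initial := by
  subst hs
  rw [vertexWord_eq_prod hS, ← map_ribbonElem constConv]
  cases ho : t.orientation
  · exact Or.inl (forward_initial hch
      (fun t' ht' => vertex_step_clockwise hS t' ((orientation_eq_head hch hd t' ht').trans ho))
      (initial_ne_initial hch hd) hv)
  · exact Or.inr (backward_initial hch (fun t' ht' =>
      vertex_step_counterclockwise hS t' ((orientation_eq_head hch hd t' ht').trans ho))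
      (initial_ne_initial hch hd) hv)

/-- The vertex operators at the final site of a ribbon leave an element of the double behind the
ribbon operator. -/
theorem vertexWord_final (hv : ¬ Γ.rot.SameCycle t.initial s) :
    vertexWord H Γ s * constConv (ribbonElem (t :: ts)) =
        constConv (ribbonElem (t :: ts)) * (vertexWord H Γ s * legA (coeffHom E H)) ∨
      vertexWord H Γ s * constConv (ribbonElem (t :: ts)) =
        constConv (ribbonElem (t :: ts)) * (legA (coeffHom E H) * vertexWord H Γ s) := by
  rw [vertexWord_eq_prod hS, ← map_ribbonElem constConv]
  have hne := initial_ne_final hch hd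
  rw [hs] at hne
  cases ho : t.orientation
  · exact Or.inl (forward_final hch
      (fun t' ht' => vertex_step_clockwise hS t' ((orientation_eq_head hch hd t' ht').trans ho))
      hs hne hv)
  · exact Or.inr (backward_final hch (fun t' ht' =>
      vertex_step_counterclockwise hS t' ((orientation_eq_head hch hd t' ht').trans ho)) hs hne hv)

/-- The face operators at the initial site of a ribbon pick up an element of the double. -/
theorem faceWord_initial (hp : ¬ Γ.next.SameCycle t.initial s) :
    legB (coeffHom E H) * faceWord H Γ t.initial * constTensor (ribbonElem (t :: ts)) =
        constTensor (ribbonElem (t :: ts)) * faceWord H Γ t.initial ∨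
      faceWord H Γ t.initial * legB (coeffHom E H) * constTensor (ribbonElem (t :: ts)) =
        constTensor (ribbonElem (t :: ts)) * faceWord H Γ t.initial := by
  subst hs
  rw [faceWord_eq_prod hS, ← map_ribbonElem constTensor]
  cases ho : t.orientation
  · exact Or.inr (backward_initial hch
      (fun t' ht' => face_step_clockwise hS t' ((orientation_eq_head hch hd t' ht').trans ho))
      (initial_ne_initial hch hd) hp)
  · exact Or.inl (forward_initial hch (fun t' ht' =>
      face_step_counterclockwise hS t' ((orientation_eq_head hch hd t' ht').trans ho))
      (initial_ne_initial hch hd) hp)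

/-- The face operators at the final site of a ribbon leave an element of the double behind the
ribbon operator. -/
theorem faceWord_final (hp : ¬ Γ.next.SameCycle t.initial s) :
    faceWord H Γ s * constTensor (ribbonElem (t :: ts)) =
        constTensor (ribbonElem (t :: ts)) * (faceWord H Γ s * legB (coeffHom E H)) ∨
      faceWord H Γ s * constTensor (ribbonElem (t :: ts)) =
        constTensor (ribbonElem (t :: ts)) * (legB (coeffHom E H) * faceWord H Γ s) := by
  rw [faceWord_eq_prod hS, ← map_ribbonElem constTensor]
  have hne := initial_ne_final hch hd
  rw [hs] at hne
  cases ho : t.orientation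
  · exact Or.inr (backward_final hch
      (fun t' ht' => face_step_clockwise hS t' ((orientation_eq_head hch hd t' ht').trans ho))
      hs hne hp)
  · exact Or.inl (forward_final hch (fun t' ht' =>
      face_step_counterclockwise hS t' ((orientation_eq_head hch hd t' ht').trans ho)) hs hne hp)

end Words

/-! ### Local operators on a ground state -/

section GroundState

variable {E : Type*} {Γ : Lattice E}

/-- A function that is injective on a cycle takes distinct values along that cycle. -/
theorem edges_nodup_of_cycle {S : Type*} (π : Equiv.Perm S) (g : S → E) (s : S)
    (h : ∀ x y, π.SameCycle s x → π.SameCycle s y → g x = g y → x = y) (j : ℕ) :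
    (((List.range (Function.minimalPeriod π s)).map fun k => (π ^ (k + j)) s).map g).Nodup := by
  rw [List.map_map]
  refine List.Nodup.map_on (fun k hk k' hk' hkk' => ?_) List.nodup_range
  have h1 := h _ _ ⟨((k + j : ℕ) : ℤ), by rw [zpow_natCast]⟩
    ⟨((k' + j : ℕ) : ℤ), by rw [zpow_natCast]⟩ hkk'
  simp only [add_comm _ j] at h1
  rw [pow_add, pow_add, Equiv.Perm.mul_apply, Equiv.Perm.mul_apply] at h1
  exact pow_injOn_period π (List.mem_range.1 hk) (List.mem_range.1 hk') ((π ^ j).injective h1)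

/-- Every edge has at most one end at a given vertex. -/
theorem vertexDarts_nodup (s : Γ.Site) : ((Γ.vertexDarts s).map Prod.fst).Nodup := by
  refine edges_nodup_of_cycle Γ.rot Prod.fst s (fun x y hx hy hxy => ?_) 1
  rcases Dart.eq_or_eq_rev hxy with rfl | rfl
  · rfl
  · exact absurd (hy.symm.trans hx) (Γ.ends_ne y)

/-- Every edge has at most one side in a given face. -/
theorem faceDarts_nodup (s : Γ.Site) : ((Γ.faceDarts s).map Prod.fst).Nodup := by
  refine edges_nodup_of_cycle Γ.next Prod.fst s (fun x y hx hy hxy => ?_) 0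
  rcases Dart.eq_or_eq_rev hxy with rfl | rfl
  · rfl
  · exact absurd (hy.symm.trans hx) (Γ.sides_ne y)

variable [DecidableEq E] {H : Type*} [Ring H] [HopfAlgebra ℂ H]

theorem commute_vertexOpList {e : E} {l : List (Dart E)} (h : e ∉ l.map Prod.fst)
    (t : Module.End ℂ H) (a : H) : Commute (onEdge e t) (vertexOpList l a) := by
  induction l generalizing a with
  | nil => exact (Commute.one_right _).smul_right _
  | cons d l ih =>
    simp only [List.map_cons, List.mem_cons, not_or] at h
    simp only [vertexOpList, LinearMap.comp_apply]
    rw [← (ℛ ℂ a).eq, map_sum, map_sum]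
    refine Commute.sum_right _ _ _ fun i _ => ?_
    exact Commute.mul_right (onEdge_comm h.1 _ _) (ih h.2 _)

theorem edgeL_hom (hS : ∀ a : H, antipode ℂ (antipode ℂ a) = a) (d : Dart E) :
    ∃ φ : H →ₐ[ℂ] Module.End ℂ (StateSpace E H), ∀ a, φ a = onEdge d.1 (edgeL d.2 a) :=
  ⟨(dartHom hS d).comp mulLeftHom, fun a => by rw [onEdge_edgeL hS]; rfl⟩

/-- Vertex operators on distinct edges are multiplicative. -/
theorem vertexOpList_hom (hS : ∀ a : H, antipode ℂ (antipode ℂ a) = a) {l : List (Dart E)}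
    (h : (l.map Prod.fst).Nodup) :
    ∃ φ : H →ₐ[ℂ] Module.End ℂ (StateSpace E H), ∀ a, φ a = vertexOpList l a := by
  induction l with
  | nil =>
    refine ⟨(Algebra.ofId ℂ _).comp (Bialgebra.counitAlgHom ℂ H), fun a => ?_⟩
    simp [vertexOpList, Algebra.ofId_apply, Algebra.algebraMap_eq_smul_one]
  | cons d l ih =>
    simp only [List.map_cons, List.nodup_cons] at h
    obtain ⟨φ, hφ⟩ := ih h.2
    obtain ⟨ψ, hψ⟩ := edgeL_hom hS d
    refine ⟨(Algebra.TensorProduct.lift ψ φ fun a b => ?_).comp (Bialgebra.comulAlgHom ℂ H),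
      fun a => ?_⟩
    · rw [hφ, hψ]
      exact commute_vertexOpList h.1 _ _
    · simp only [vertexOpList, LinearMap.comp_apply, AlgHom.comp_apply, Bialgebra.comulAlgHom_apply]
      rw [← (ℛ ℂ a).eq]
      simp [hφ, hψ]

theorem opA_mul (hS : ∀ a : H, antipode ℂ (antipode ℂ a) = a) (s : Γ.Site) (a b : H) :
    (opA Γ s (a * b) : Module.End ℂ (StateSpace E H)) = opA Γ s a * opA Γ s b := by
  obtain ⟨φ, hφ⟩ := vertexOpList_hom hS (vertexDarts_nodup s)
  simp only [opA, ← hφ, map_mul]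

variable [FiniteDimensional ℂ H]

theorem commute_faceOpList {e : E} {l : List (Dart E)} (h : e ∉ l.map Prod.fst)
    (t : Module.End ℂ H) (f : Module.Dual ℂ H) : Commute (onEdge e t) (faceOpList l f) := by
  induction l generalizing f with
  | nil => exact (Commute.one_right _).smul_right _
  | cons d l ih =>
    simp only [List.map_cons, List.mem_cons, not_or] at h
    simp only [faceOpList, LinearMap.sum_apply]
    refine Commute.sum_right _ _ _ fun i _ => ?_
    exact Commute.mul_right (onEdge_comm h.1 _ _) (ih h.2 _)

omit [FiniteDimensional ℂ H] in
theorem convProd_comp_mulLeft {ι : Type*} {x : H} (𝓡 : Coalgebra.Repr ℂ x ι)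
    (f g : Module.Dual ℂ H) : convProd f g ∘ₗ LinearMap.mulLeft ℂ x =
      ∑ i ∈ 𝓡.index, convProd (f ∘ₗ LinearMap.mulLeft ℂ (𝓡.left i))
        (g ∘ₗ LinearMap.mulLeft ℂ (𝓡.right i)) := by
  ext y
  simp [convProd, comul_mul_repr 𝓡 (ℛ ℂ y)]
  simp [← (ℛ ℂ y).eq]

/-- Face operators on distinct edges are multiplicative. -/
theorem faceOpList_convProd (hS : ∀ a : H, antipode ℂ (antipode ℂ a) = a) {l : List (Dart E)}
    (h : (l.map Prod.fst).Nodup) (f g : Module.Dual ℂ H) :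
    (faceOpList l (convProd f g) : Module.End ℂ (StateSpace E H)) =
      faceOpList l f * faceOpList l g := by
  induction l generalizing f g with
  | nil => simp [faceOpList, convProd, smul_smul, Bialgebra.comul_one,
      Algebra.TensorProduct.one_def, mul_comm]
  | cons d l ih =>
    simp only [List.map_cons, List.nodup_cons] at h
    let V (f : Module.Dual ℂ H) : H →ₗ[ℂ] Module.End ℂ (StateSpace E H) :=
      faceOpList l ∘ₗ { toFun := fun x => f ∘ₗ LinearMap.mulLeft ℂ x
                        map_add' := fun x y => by ext; simp [add_mul]
                        map_smul' := fun c x => by ext; simp }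
    have key := canonical_comul (H := H)
      ((LinearMap.mul ℂ (Module.End ℂ (StateSpace E H))).flip.compl₁₂
      (LinearMap.mul' ℂ _ ∘ₗ TensorProduct.map (V f) (V g)) (onEdge d.1 ∘ₗ edgeT d.2))
    have hL : ∀ f' : Module.Dual ℂ H, (faceOpList (d :: l) f' : Module.End ℂ (StateSpace E H)) =
        ∑ k, onEdge d.1 (edgeT d.2 ((Module.finBasis ℂ H).coord k)) *
          V f' (Module.finBasis ℂ H k) := by
      intro f'
      simp [faceOpList, V]
      rfl
    have hV : ∀ x, V (convProd f g) x =
        LinearMap.mul' ℂ _ (TensorProduct.map (V f) (V g) (comul (R := ℂ) x)) := by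
      intro x
      have : V (convProd f g) x = faceOpList l (convProd f g ∘ₗ LinearMap.mulLeft ℂ x) := rfl
      rw [this, convProd_comp_mulLeft (ℛ ℂ x), map_sum, ← (ℛ ℂ x).eq]
      simp only [ih h.2, map_sum, TensorProduct.map_tmul, LinearMap.mul'_apply]
      rfl
    simp only [LinearMap.compl₁₂_apply, LinearMap.comp_apply, LinearMap.flip_apply,
      LinearMap.mul_apply', TensorProduct.map_tmul, LinearMap.mul'_apply] at key
    rw [hL, hL, hL]
    simp only [hV, key, Finset.sum_mul_sum]
    refine Finset.sum_congr rfl fun i _ => Finset.sum_congr rfl fun j _ => ?_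
    have hT : (onEdge d.1 (edgeT d.2 (convProd ((Module.finBasis ℂ H).coord i)
        ((Module.finBasis ℂ H).coord j))) : Module.End ℂ (StateSpace E H)) =
        onEdge d.1 (edgeT d.2 ((Module.finBasis ℂ H).coord i)) *
          onEdge d.1 (edgeT d.2 ((Module.finBasis ℂ H).coord j)) := by
      rw [onEdge_edgeT hS, onEdge_edgeT hS, onEdge_edgeT hS, readSnd_convProd, map_mul]
    have hc : Commute (onEdge d.1 (edgeT d.2 ((Module.finBasis ℂ H).coord j)))
        (V f (Module.finBasis ℂ H i)) := commute_faceOpList h.1 _ _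
    rw [hT, mul_assoc, mul_assoc, ← mul_assoc (onEdge _ _) (V f _), hc.eq, mul_assoc]

theorem opB_convProd (hS : ∀ a : H, antipode ℂ (antipode ℂ a) = a) (s : Γ.Site)
    (f g : Module.Dual ℂ H) :
    (opB Γ s (convProd f g) : Module.End ℂ (StateSpace E H)) = opB Γ s f * opB Γ s g :=
  faceOpList_convProd hS (faceDarts_nodup s) f g

variable {Ω : StateSpace E H}

/-- All vertex operators act on a ground state by the counit: `A_a Ω = A_a A_{h₀} Ω = ε(a) Ω`. -/
theorem IsGroundState.opA_apply (hS : ∀ a : H, antipode ℂ (antipode ℂ a) = a)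
    (hΩ : IsGroundState Γ Ω) (s : Γ.Site) (a : H) : opA Γ s a Ω = counit (R := ℂ) a • Ω := by
  obtain ⟨_, h₀, φ, hh, _, h⟩ := hΩ
  conv_lhs => rw [← (h s).1, ← Module.End.mul_apply, ← opA_mul hS, (hh.1 a).1, map_smul,
    LinearMap.smul_apply, (h s).1]

/-- All face operators act on a ground state by the counit of `H*`. -/
theorem IsGroundState.opB_apply (hS : ∀ a : H, antipode ℂ (antipode ℂ a) = a)
    (hΩ : IsGroundState Γ Ω) (s : Γ.Site) (f : Module.Dual ℂ H) : opB Γ s f Ω = f 1 • Ω := by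
  obtain ⟨_, h₀, φ, _, hφ, h⟩ := hΩ
  conv_lhs => rw [← (h s).2, ← Module.End.mul_apply, ← opB_convProd hS, (hφ.1 f).1, map_smul,
    LinearMap.smul_apply, (h s).2]

end GroundState

/-! ### Local operators on the states of a ribbon -/

section RibbonStates

open WithConv

variable {E : Type*} [DecidableEq E] {H : Type*} [Ring H] [HopfAlgebra ℂ H]
  [FiniteDimensional ℂ H] (hS : ∀ a : H, antipode ℂ (antipode ℂ a) = a) {Γ : Lattice E}

/-- The action of operators with coefficients in the double on vectors with coefficients in the
double. -/
def opAction (E H : Type*) [Ring H] [HopfAlgebra ℂ H] :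
    DoubleOp E H →ₐ[ℂ] Module.End ℂ (DrinfeldDouble H ⊗[ℂ] StateSpace E H) :=
  Module.endTensorEndAlgHom.comp
    (Algebra.TensorProduct.map (Algebra.lmul ℂ (DrinfeldDouble H)) (AlgHom.id ℂ _))

omit [DecidableEq E] [FiniteDimensional ℂ H] in
theorem opAction_coeffHom (m n : DrinfeldDouble H) (Ω : StateSpace E H) :
    opAction E H (coeffHom E H m) (n ⊗ₜ Ω) = (m * n) ⊗ₜ Ω := by
  simp [opAction, coeffHom, Module.endTensorEndAlgHom]

omit [DecidableEq E] [FiniteDimensional ℂ H] in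
theorem opAction_opHom (t : Module.End ℂ (StateSpace E H)) (n : DrinfeldDouble H)
    (Ω : StateSpace E H) : opAction E H (opHom E H t) (n ⊗ₜ Ω) = n ⊗ₜ t Ω := by
  simp [opAction, opHom, Module.endTensorEndAlgHom]

omit [FiniteDimensional ℂ H] in
theorem convMul_comp_antipode {X : Type*} [Ring X] [Algebra ℂ X] {u v : WithConv (H →ₗ[ℂ] X)}
    (h : ∀ a b, u a * v b = v b * u a) :
    toConv ((u * v).ofConv ∘ₗ antipode ℂ) =
      toConv (v.ofConv ∘ₗ antipode ℂ) * toConv (u.ofConv ∘ₗ antipode ℂ) := by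
  ext a
  rw [(ℛ ℂ a).convMul_apply]
  refine ((antipodeRepr (ℛ ℂ a)).convMul_apply u v).trans ?_
  exact Finset.sum_congr rfl fun i _ => h _ _

omit [FiniteDimensional ℂ H] in
theorem mul_constConv_comp_antipode {X : Type*} [Ring X] [Algebra ℂ X] (F : X)
    (u : WithConv (H →ₗ[ℂ] X)) :
    toConv ((u * constConv F).ofConv ∘ₗ antipode ℂ) =
      toConv (u.ofConv ∘ₗ antipode ℂ) * constConv F := by
  ext a
  rw [mul_constConv_apply]
  exact mul_constConv_apply _ _ _

omit [FiniteDimensional ℂ H] in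
theorem constConv_mul_comp_antipode {X : Type*} [Ring X] [Algebra ℂ X] (F : X)
    (u : WithConv (H →ₗ[ℂ] X)) :
    toConv ((constConv F * u).ofConv ∘ₗ antipode ℂ) =
      constConv F * toConv (u.ofConv ∘ₗ antipode ℂ) := by
  ext a
  rw [constConv_mul_apply]
  exact constConv_mul_apply _ _ _

/-- Application of the antipode to the first factor of `H ⊗ X`. -/
def antipodeFst {X : Type*} [Ring X] [Algebra ℂ X] : H ⊗[ℂ] X →ₗ[ℂ] H ⊗[ℂ] X :=
  TensorProduct.map (antipode ℂ) .id

theorem antipodeFst_encode {X : Type*} [Ring X] [Algebra ℂ X] (r : Module.Dual ℂ H →ₗ[ℂ] X) :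
    antipodeFst (encode r) = encode (r ∘ₗ dualAntipode) := by
  have := canonical_transpose (antipode ℂ) ((TensorProduct.mk ℂ H X).compl₂ r)
  simp only [LinearMap.compl₂_apply, TensorProduct.mk_apply] at this
  simp only [antipodeFst, encode, map_sum, TensorProduct.map_tmul, LinearMap.id_apply]
  exact this

theorem antipodeFst_encode_mul {X : Type*} [Ring X] [Algebra ℂ X]
    {r r' : Module.Dual ℂ H →ₗ[ℂ] X} (h : ∀ f g, r f * r' g = r' g * r f) :
    antipodeFst (encode r * encode r') = antipodeFst (encode r') * antipodeFst (encode r) := by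
  simp only [antipodeFst, encode, Finset.sum_mul_sum, map_sum, TensorProduct.map_tmul,
    LinearMap.id_apply, Algebra.TensorProduct.tmul_mul_tmul, antipode_mul_antidistrib, h]
  exact Finset.sum_comm

omit [FiniteDimensional ℂ H] in
theorem antipodeFst_mul_constTensor {X : Type*} [Ring X] [Algebra ℂ X] (z : H ⊗[ℂ] X) (F : X) :
    antipodeFst (z * constTensor F) = antipodeFst z * constTensor F := by
  induction z with
  | zero => simp
  | add x y hx hy => simp only [add_mul, map_add, hx, hy]
  | tmul a x => simp [antipodeFst, constTensor]

omit [FiniteDimensional ℂ H] in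
theorem antipodeFst_constTensor_mul {X : Type*} [Ring X] [Algebra ℂ X] (z : H ⊗[ℂ] X) (F : X) :
    antipodeFst (constTensor F * z) = constTensor F * antipodeFst z := by
  induction z with
  | zero => simp
  | add x y hx hy => simp only [mul_add, map_add, hx, hy]
  | tmul a x => simp [antipodeFst, constTensor]

section Evaluation

variable {X Y : Type*} [Ring X] [Algebra ℂ X] [AddCommGroup Y] [Module ℂ Y]
  (act : X →ₐ[ℂ] Module.End ℂ Y)

/-- Evaluation at a vector of the second factor of `H ⊗ X`. -/
def evalSnd (y : Y) : H ⊗[ℂ] X →ₗ[ℂ] H ⊗[ℂ] Y :=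
  TensorProduct.map .id (act.toLinearMap.flip y)

omit [FiniteDimensional ℂ H] in
theorem evalSnd_mul_constTensor (y : Y) (z : H ⊗[ℂ] X) (F : X) :
    evalSnd act y (z * constTensor F) = evalSnd act (act F y) z := by
  induction z with
  | zero => simp
  | add x y hx hy => simp only [add_mul, map_add, hx, hy]
  | tmul a x => simp [evalSnd, constTensor]

omit [FiniteDimensional ℂ H] in
theorem evalSnd_constTensor_mul (y : Y) (z : H ⊗[ℂ] X) (F : X) :
    evalSnd act y (constTensor F * z) = TensorProduct.map .id (act F) (evalSnd act y z) := by
  induction z with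
  | zero => simp
  | add x y hx hy => simp only [mul_add, map_add, hx, hy]
  | tmul a x => simp [evalSnd, constTensor]

/-- A family that acts on `y` by the counit of `H*` disappears when applied to `y`. -/
theorem evalSnd_mul_encode {y : Y} (z : H ⊗[ℂ] X) {r : Module.Dual ℂ H →ₗ[ℂ] X}
    (h : ∀ f, act (r f) y = f 1 • y) : evalSnd act y (z * encode r) = evalSnd act y z := by
  induction z with
  | zero => simp
  | add x y hx hy => simp only [add_mul, map_add, hx, hy]
  | tmul a x =>
    rw [tmul_mul_encode]
    simp only [evalSnd, map_sum, TensorProduct.map_tmul, LinearMap.id_apply, LinearMap.flip_apply,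
      AlgHom.toLinearMap_apply, map_mul, Module.End.mul_apply, h, map_smul, LinearMap.comp_apply,
      LinearMap.mulLeft_apply, mul_one, ← TensorProduct.smul_tmul, ← TensorProduct.sum_tmul,
      sum_coord_smul]

theorem evalSnd_encode_apply (y : Y) (r : Module.Dual ℂ H →ₗ[ℂ] X) (f : Module.Dual ℂ H) :
    TensorProduct.lid ℂ Y (TensorProduct.map f .id (evalSnd act y (encode r))) = act (r f) y := by
  have h := congrArg (fun f => act (r f) y) (sum_smul_coord f)
  simp only [map_sum, map_smul, LinearMap.sum_apply, LinearMap.smul_apply] at h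
  rw [← h]
  simp [evalSnd, encode]

end Evaluation

/-- The leg of face operators is invertible, with inverse given by the antipode. -/
theorem legB_isUnit {X : Type*} [Ring X] [Algebra ℂ X] (iD : DrinfeldDouble H →ₐ[ℂ] X) :
    legB iD * antipodeFst (legB iD) = 1 ∧ antipodeFst (legB iD) * legB iD = 1 := by
  have h := canon_isUnit
    (Algebra.TensorProduct.includeLeft (R := ℂ) (S := ℂ) (A := H) (B := X))
    ((constTensor (H := H) (X := X)).toLinearMap ∘ₗ iD.toLinearMap ∘ₗ inclDual)
    (fun f a => by simp [constTensor]) (fun f g => by simp [inclDual_mul])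
    (by simp [inclDual_counit])
  rw [legB, antipodeFst_encode, encode_eq_canon, encode_eq_canon]
  exact h

/-- The state `∑ eₖ ⊗ F^{eᵏ}(τ) Ω`, with `eₖ` and `eᵏ` dual bases of `D(H)` and `D(H)*`, from which
`F^ξ(τ) Ω` is obtained by applying `ξ`. -/
def ribbonState (l : List (Triangle Γ)) (Ω : StateSpace E H) :
    DrinfeldDouble H ⊗[ℂ] StateSpace E H :=
  opAction E H (ribbonElem l) (1 ⊗ₜ Ω)

variable {t : Triangle Γ} {ts : List (Triangle Γ)} {s : Γ.Site} [Finite E]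
  (hch : (t :: ts).IsChain fun t t' => t.final = t'.initial)
  (hd : (t :: ts).Pairwise fun t t' => Disjoint t.region t'.region)
  (hs : ((t :: ts).getLast (by simp)).final = s)

include hS hch hd hs

/-- At the initial site, `A_a` acts on the ribbon states as left multiplication by `S(a)` on the
coefficients. For both local orientations this follows by inverting the leg in
`vertexWord_initial`. -/
theorem opA_initial_ribbonState (hv : ¬ Γ.rot.SameCycle t.initial s) {Ω : StateSpace E H}
    (hΩ : ∀ a, opA Γ t.initial a Ω = counit (R := ℂ) a • Ω) (a : H) :
    opAction E H (opHom E H (opA Γ t.initial a)) (ribbonState (t :: ts) Ω) =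
      opAction E H (coeffHom E H (inclH (antipode ℂ a))) (ribbonState (t :: ts) Ω) := by
  set F : DoubleOp E H := ribbonElem (t :: ts) with hF
  set W := vertexWord H Γ t.initial with hW
  have hΩ' : ∀ a, opAction E H (W a) (1 ⊗ₜ Ω) = counit (R := ℂ) a • (1 ⊗ₜ[ℂ] Ω) := fun a => by
    rw [hW, vertexWord]
    exact (opAction_opHom _ _ _).trans (by rw [hΩ, TensorProduct.tmul_smul])
  have h5 : toConv ((legA (coeffHom E H)).ofConv ∘ₗ antipode ℂ) * legA (coeffHom E H) = 1 :=
    conv_antipode_mul ((coeffHom E H).comp (inclH (H := H)))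
  have h6 : legA (coeffHom E H) * toConv ((legA (coeffHom E H)).ofConv ∘ₗ antipode ℂ) = 1 :=
    conv_mul_antipode ((coeffHom E H).comp (inclH (H := H)))
  rcases vertexWord_initial hS hch hd hs hv with h | h
  · have h2 : W * constConv F = toConv ((legA (coeffHom E H)).ofConv ∘ₗ antipode ℂ) *
        (constConv F * W) := by
      rw [← h, ← mul_assoc, ← mul_assoc, h5, one_mul]
    have h3 := congrArg (fun u : WithConv (H →ₗ[ℂ] DoubleOp E H) =>
      opAction E H (u a) (1 ⊗ₜ[ℂ] Ω)) h2
    simp only [mul_constConv_apply] at h3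
    simp only [(ℛ ℂ a).convMul_apply (_) (constConv F * W), constConv_mul_apply, map_sum, map_mul,
      LinearMap.sum_apply, Module.End.mul_apply] at h3
    refine h3.trans ?_
    have h4 := smul_counit_sum (ℛ ℂ a) ((opAction E H).toLinearMap.flip (ribbonState (t :: ts) Ω) ∘ₗ
      (coeffHom E H).toLinearMap ∘ₗ inclH.toLinearMap ∘ₗ antipode ℂ)
    refine Eq.trans (Finset.sum_congr rfl fun i _ => ?_) h4
    rw [hΩ', map_smul, map_smul]
    rfl
  · have h1 := congrArg (fun u : WithConv (H →ₗ[ℂ] DoubleOp E H) =>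
      toConv (u.ofConv ∘ₗ antipode ℂ)) h
    simp only [mul_constConv_comp_antipode, constConv_mul_comp_antipode] at h1
    rw [convMul_comp_antipode fun a b => (coeffHom_comm _ _).symm] at h1
    have h2 : toConv (W.ofConv ∘ₗ antipode ℂ) * constConv F = legA (coeffHom E H) *
        (constConv F * toConv (W.ofConv ∘ₗ antipode ℂ)) := by
      rw [← h1, ← mul_assoc, ← mul_assoc, h6, one_mul]
    have h3 := congrArg (fun u : WithConv (H →ₗ[ℂ] DoubleOp E H) =>
      opAction E H (u (antipode ℂ a)) (1 ⊗ₜ[ℂ] Ω)) h2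
    simp only [mul_constConv_apply] at h3
    simp only [(antipodeRepr (ℛ ℂ a)).convMul_apply, constConv_mul_apply, map_sum, map_mul,
      LinearMap.sum_apply, Module.End.mul_apply] at h3
    have h7 : W.ofConv (antipode ℂ (antipode ℂ a)) = opHom E H (opA Γ t.initial a) := by
      rw [hS]; rfl
    refine ((congrArg (fun x => opAction E H x (ribbonState (t :: ts) Ω)) h7).symm.trans
      h3).trans ?_
    have h4 := counit_smul_sum (ℛ ℂ a) ((opAction E H).toLinearMap.flip (ribbonState (t :: ts) Ω) ∘ₗ
      (coeffHom E H).toLinearMap ∘ₗ inclH.toLinearMap ∘ₗ antipode ℂ)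
    refine Eq.trans (Finset.sum_congr rfl fun i _ => ?_) h4
    have h8 : opAction E H ((toConv (W.ofConv ∘ₗ antipode ℂ)) ((antipodeRepr (ℛ ℂ a)).right i))
        (1 ⊗ₜ Ω) = counit (R := ℂ) ((ℛ ℂ a).left i) • (1 ⊗ₜ[ℂ] Ω) := by
      refine Eq.trans ?_ (hΩ' _)
      change opAction E H (W.ofConv (antipode ℂ (antipode ℂ _))) _ = _
      rw [hS]
    rw [h8, map_smul, map_smul]
    rfl

/-- At the final site, `A_a` acts on the ribbon states as right multiplication by `a` on the
coefficients. -/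
theorem opA_final_ribbonState (hv : ¬ Γ.rot.SameCycle t.initial s) {Ω : StateSpace E H}
    (hΩ : ∀ a, opA Γ s a Ω = counit (R := ℂ) a • Ω) (a : H) :
    opAction E H (opHom E H (opA Γ s a)) (ribbonState (t :: ts) Ω) =
      opAction E H (ribbonElem (t :: ts)) (inclH a ⊗ₜ Ω) := by
  have hΩ' : ∀ a m, opAction E H (vertexWord H Γ s a) (m ⊗ₜ Ω) =
      counit (R := ℂ) a • (m ⊗ₜ[ℂ] Ω) := fun a m => by
    rw [vertexWord]
    exact (opAction_opHom _ _ _).trans (by rw [hΩ, TensorProduct.tmul_smul])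
  have hl : ∀ a, opAction E H (legA (coeffHom E H) a) (1 ⊗ₜ Ω) = inclH a ⊗ₜ Ω := fun a =>
    (opAction_coeffHom (inclH a) 1 Ω).trans (by rw [mul_one])
  let g : H →ₗ[ℂ] DrinfeldDouble H ⊗[ℂ] StateSpace E H :=
    (TensorProduct.mk ℂ (DrinfeldDouble H) (StateSpace E H)).flip Ω ∘ₗ inclH.toLinearMap
  have key : ∀ u : WithConv (H →ₗ[ℂ] DoubleOp E H),
      vertexWord H Γ s * constConv (ribbonElem (t :: ts)) =
        constConv (ribbonElem (t :: ts)) * u →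
      opAction E H (u a) (1 ⊗ₜ Ω) = inclH a ⊗ₜ Ω →
      opAction E H (opHom E H (opA Γ s a)) (ribbonState (t :: ts) Ω) =
      opAction E H (ribbonElem (t :: ts)) (inclH a ⊗ₜ Ω) := by
    intro u h1 h2
    have h3 := congrArg (fun u : WithConv (H →ₗ[ℂ] DoubleOp E H) =>
      opAction E H (u a) (1 ⊗ₜ[ℂ] Ω)) h1
    simp only [mul_constConv_apply, constConv_mul_apply, map_mul, Module.End.mul_apply, h2] at h3
    exact h3
  rcases vertexWord_final hS hch hd hs hv with h | h
  · refine key _ h ?_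
    rw [(ℛ ℂ a).convMul_apply]
    simp only [map_sum, map_mul, LinearMap.sum_apply, Module.End.mul_apply, hl, hΩ']
    exact counit_smul_sum (ℛ ℂ a) g
  · refine key _ h ?_
    rw [(ℛ ℂ a).convMul_apply]
    simp only [map_sum, map_mul, LinearMap.sum_apply, Module.End.mul_apply, hl, hΩ', map_smul]
    exact smul_counit_sum (ℛ ℂ a) g

/-- At the initial site, `B_f` acts on the ribbon states as left multiplication by `S(f)`. -/
theorem opB_initial_ribbonState (hp : ¬ Γ.next.SameCycle t.initial s) {Ω : StateSpace E H}
    (hΩ : ∀ f, opB Γ t.initial f Ω = f 1 • Ω) (f : Module.Dual ℂ H) :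
    opAction E H (opHom E H (opB Γ t.initial f)) (ribbonState (t :: ts) Ω) =
      opAction E H (coeffHom E H (inclDual (dualAntipode f))) (ribbonState (t :: ts) Ω) := by
  set F : DoubleOp E H := ribbonElem (t :: ts) with hF
  have hΩ' : ∀ f, opAction E H (opHom E H (opB Γ t.initial f)) (1 ⊗ₜ Ω) = f 1 • (1 ⊗ₜ[ℂ] Ω) :=
    fun f => by rw [opAction_opHom, hΩ, TensorProduct.tmul_smul]
  have hΩ'' : ∀ f, opAction E H ((((opHom E H).toLinearMap ∘ₗ opB Γ t.initial) ∘ₗ dualAntipode) f)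
      (1 ⊗ₜ Ω) = f 1 • (1 ⊗ₜ[ℂ] Ω) := fun f =>
    (hΩ' _).trans (by rw [dualAntipode_apply, antipode_one])
  obtain ⟨h5, h6⟩ := legB_isUnit (coeffHom E H)
  rcases faceWord_initial hS hch hd hs hp with h | h
  · have h2 : faceWord H Γ t.initial * constTensor F =
        antipodeFst (legB (coeffHom E H)) * constTensor F * faceWord H Γ t.initial := by
      rw [mul_assoc (antipodeFst _), ← h, ← mul_assoc, ← mul_assoc, h6, one_mul]
    have h3 := congrArg (evalSnd (opAction E H) (1 ⊗ₜ[ℂ] Ω)) h2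
    rw [faceWord, evalSnd_mul_encode _ _ hΩ', evalSnd_mul_constTensor, evalSnd_mul_constTensor,
      legB, antipodeFst_encode] at h3
    have h4 := congrArg (fun z => TensorProduct.lid ℂ _ (TensorProduct.map f .id z)) h3
    simp only [evalSnd_encode_apply] at h4
    exact h4
  · have h1 := congrArg antipodeFst h
    rw [antipodeFst_mul_constTensor, antipodeFst_constTensor_mul, faceWord, legB,
      antipodeFst_encode_mul fun f g => (coeffHom_comm _ _).symm, ← legB] at h1
    have h2 : antipodeFst (faceWord H Γ t.initial) * constTensor F =
        legB (coeffHom E H) * constTensor F * antipodeFst (faceWord H Γ t.initial) := by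
      rw [faceWord, mul_assoc (legB _), ← h1, ← mul_assoc, ← mul_assoc, h5, one_mul]
    have h3 := congrArg (evalSnd (opAction E H) (1 ⊗ₜ[ℂ] Ω)) h2
    rw [faceWord, antipodeFst_encode, evalSnd_mul_encode _ _ hΩ'',
      evalSnd_mul_constTensor, evalSnd_mul_constTensor, legB] at h3
    have h4 := congrArg
      (fun z => TensorProduct.lid ℂ _ (TensorProduct.map (dualAntipode f) .id z)) h3
    simp only [evalSnd_encode_apply, LinearMap.comp_apply, dualAntipode_dualAntipode hS] at h4
    exact h4

/-- At the final site, `B_f` acts on the ribbon states as right multiplication by `f`. -/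
theorem opB_final_ribbonState (hp : ¬ Γ.next.SameCycle t.initial s) {Ω : StateSpace E H}
    (hΩ : ∀ f, opB Γ s f Ω = f 1 • Ω) (f : Module.Dual ℂ H) :
    opAction E H (opHom E H (opB Γ s f)) (ribbonState (t :: ts) Ω) =
      opAction E H (ribbonElem (t :: ts)) (inclDual f ⊗ₜ Ω) := by
  have hΩ' : ∀ f, opAction E H (opHom E H (opB Γ s f)) (1 ⊗ₜ Ω) = f 1 • (1 ⊗ₜ[ℂ] Ω) :=
    fun f => by rw [opAction_opHom, hΩ, TensorProduct.tmul_smul]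
  have hΩ'' : ∀ f, opAction E H ((((opHom E H).toLinearMap ∘ₗ opB Γ s) ∘ₗ dualAntipode) f)
      (1 ⊗ₜ Ω) = f 1 • (1 ⊗ₜ[ℂ] Ω) := fun f =>
    (hΩ' _).trans (by rw [dualAntipode_apply, antipode_one])
  have hl : ∀ f, opAction E H (coeffHom E H (inclDual f)) (1 ⊗ₜ Ω) = inclDual f ⊗ₜ Ω := fun a =>
    (opAction_coeffHom (inclDual a) 1 Ω).trans (by rw [mul_one])
  have hf : ∀ (f : Module.Dual ℂ H) (z : H ⊗[ℂ] (DrinfeldDouble H ⊗[ℂ] StateSpace E H)),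
      TensorProduct.lid ℂ _ (TensorProduct.map f .id
        (TensorProduct.map .id (opAction E H (ribbonElem (t :: ts))) z)) =
      opAction E H (ribbonElem (t :: ts))
        (TensorProduct.lid ℂ _ (TensorProduct.map f .id z)) := by
    intro f z
    induction z with
    | zero => simp
    | add x y hx hy => simp only [map_add, hx, hy]
    | tmul a y => simp
  rcases faceWord_final hS hch hd hs hp with h | h
  · have h1 := congrArg antipodeFst h
    rw [antipodeFst_mul_constTensor, antipodeFst_constTensor_mul, faceWord, legB,
      antipodeFst_encode_mul fun f g => (coeffHom_comm _ _).symm, antipodeFst_encode,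
      antipodeFst_encode] at h1
    have h3 := congrArg (evalSnd (opAction E H) (1 ⊗ₜ[ℂ] Ω)) h1
    rw [evalSnd_mul_constTensor, evalSnd_constTensor_mul,
      evalSnd_mul_encode _ _ hΩ''] at h3
    have h4 := congrArg
      (fun z => TensorProduct.lid ℂ _ (TensorProduct.map (dualAntipode f) .id z)) h3
    simp only [evalSnd_encode_apply, hf, LinearMap.comp_apply, dualAntipode_dualAntipode hS,
      AlgHom.toLinearMap_apply, hl] at h4
    exact h4
  · have h3 := congrArg (evalSnd (opAction E H) (1 ⊗ₜ[ℂ] Ω)) h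
    rw [faceWord, evalSnd_mul_constTensor, evalSnd_constTensor_mul,
      evalSnd_mul_encode _ _ hΩ', legB] at h3
    have h4 := congrArg (fun z => TensorProduct.lid ℂ _ (TensorProduct.map f .id z)) h3
    simp only [evalSnd_encode_apply, hf, LinearMap.comp_apply, AlgHom.toLinearMap_apply, hl] at h4
    exact h4

end RibbonStates

/-! ### The antipode of the double -/

section DoubleAntipode

variable {H : Type*} [Ring H] [HopfAlgebra ℂ H]

theorem DrinfeldDouble.antipode_mk (f : Module.Dual ℂ H) (a : H) :
    DrinfeldDouble.antipode (DrinfeldDouble.mk f a) =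
      inclH (HopfAlgebra.antipode ℂ a) * inclDual (dualAntipode f) := by
  simp only [DrinfeldDouble.antipode, DrinfeldDouble.mk, LinearMap.comp_apply, LinearEquiv.coe_coe,
    LinearEquiv.symm_apply_apply, TensorProduct.comm_tmul, TensorProduct.map_tmul,
    LinearMap.mul'_apply]
  rfl

theorem dualAntipode_convProd (f g : Module.Dual ℂ H) :
    dualAntipode (convProd f g) = convProd (dualAntipode g) (dualAntipode f) := by
  ext x
  simp only [dualAntipode_apply]
  simp [convProd, comul_antipode]
  rw [← (ℛ ℂ x).eq]
  simp [dualAntipode_apply, mul_comm]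

theorem dualAntipode_counit : dualAntipode (counit : H →ₗ[ℂ] ℂ) = counit := by
  ext x; simp [dualAntipode_apply]

theorem antipode_inclDual_mul (g : Module.Dual ℂ H) (x : DrinfeldDouble H) :
    DrinfeldDouble.antipode (inclDual g * x) =
      DrinfeldDouble.antipode x * inclDual (dualAntipode g) := by
  induction x using DrinfeldDouble.induction with
  | mk f a =>
    rw [← mul_assoc, ← inclDual_mul, inclDual_mul_inclH, inclDual_mul_inclH,
      DrinfeldDouble.antipode_mk, DrinfeldDouble.antipode_mk, dualAntipode_convProd, inclDual_mul,
      mul_assoc]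
  | add x y hx hy => rw [mul_add, map_add, map_add, add_mul, hx, hy]

theorem antipode_mul_inclH (b : H) (x : DrinfeldDouble H) :
    DrinfeldDouble.antipode (x * inclH b) =
      inclH (HopfAlgebra.antipode ℂ b) * DrinfeldDouble.antipode x := by
  induction x using DrinfeldDouble.induction with
  | mk f a =>
    rw [mul_assoc, ← map_mul, inclDual_mul_inclH, inclDual_mul_inclH,
      DrinfeldDouble.antipode_mk, DrinfeldDouble.antipode_mk, antipode_mul_antidistrib, map_mul,
      mul_assoc]
  | add x y hx hy => rw [add_mul, map_add, map_add, mul_add, hx, hy]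

variable (hS : ∀ a : H, HopfAlgebra.antipode ℂ (HopfAlgebra.antipode ℂ a) = a)

include hS

/-- A bilinear map of `H` and `H*` is determined by its values `B(a₁, g(a₂ ?))`, since `S² = id`
allows to undo the shift by the antipode. Hence it suffices to check identities in the double
after applying the exchange relation. -/
theorem eq_zero_of_sum_comp_mulLeft {M : Type*} [AddCommGroup M] [Module ℂ M]
    (B : H →ₗ[ℂ] Module.Dual ℂ H →ₗ[ℂ] M)
    (hB : ∀ a g, ∑ i ∈ (ℛ ℂ a).index,
      B ((ℛ ℂ a).left i) (g ∘ₗ LinearMap.mulLeft ℂ ((ℛ ℂ a).right i)) = 0) : B = 0 := by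
  ext a g
  let A (c : H) : H →ₗ[ℂ] Module.Dual ℂ H :=
    { toFun := fun y => g ∘ₗ LinearMap.mulLeft ℂ (HopfAlgebra.antipode ℂ c * y)
      map_add' := fun y y' => by ext; simp [mul_add, add_mul, mul_assoc]
      map_smul' := fun r y => by ext; simp [mul_assoc] }
  let T : H ⊗[ℂ] (H ⊗[ℂ] H) →ₗ[ℂ] M := trilin (fun x y z => B x (A z y))
    (fun x x' y z => by simp) (fun r x y z => by simp) (fun x y y' z => by simp)
    (fun r x y z => by simp)
    (fun x y z z' => by rw [← map_add]; congr 1; ext; simp [A, add_mul])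
    (fun r x y z => by rw [← map_smul]; congr 1; ext; simp [A])
  have hT : ∀ x (w : H ⊗[ℂ] H), T (x ⊗ₜ w) = B x (g ∘ₗ LinearMap.mulLeft ℂ (LinearMap.mul' ℂ H
      (TensorProduct.map (HopfAlgebra.antipode ℂ) .id (TensorProduct.comm ℂ H H w)))) := by
    intro x w
    induction w with
    | zero => simp
    | add w w' h h' =>
      rw [TensorProduct.tmul_add, map_add, h, h', ← map_add]
      congr 1; ext; simp [add_mul]
    | tmul y z => simp [T, A]
  -- evaluate `B a₁ (g (S a₃ * a₂ * ?))` in two ways, grouping `a₂` with `a₃` or with `a₁`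
  have h1 : T (comul₃ a) = B a g := by
    have h2 := smul_counit_sum (ℛ ℂ a) (B.flip g)
    simp only [comul₃, LinearMap.comp_apply]
    rw [← (ℛ ℂ a).eq]
    simp only [map_sum, TensorProduct.map_tmul, hT, LinearMap.id_apply]
    refine Eq.trans (Finset.sum_congr rfl fun i _ => ?_) h2
    have h3 := sum_antipode_right_mul_left hS (ℛ ℂ ((ℛ ℂ a).right i))
    rw [← (ℛ ℂ ((ℛ ℂ a).right i)).eq]
    simp only [map_sum, TensorProduct.comm_tmul, TensorProduct.map_tmul, LinearMap.mul'_apply,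
      LinearMap.id_apply]
    rw [h3, LinearMap.flip_apply, ← map_smul]
    congr 1
    ext; simp
  have h4 : T (comul₃ a) = 0 := by
    have h5 := Coalgebra.coassoc_apply (R := ℂ) a
    rw [LinearMap.lTensor] at h5
    simp only [comul₃, LinearMap.comp_apply]
    rw [← h5, ← (ℛ ℂ a).eq]
    simp only [map_sum, LinearMap.rTensor_tmul]
    refine Finset.sum_eq_zero fun i _ => ?_
    rw [← (ℛ ℂ ((ℛ ℂ a).left i)).eq]
    simp only [TensorProduct.sum_tmul, map_sum, TensorProduct.assoc_tmul]
    refine Eq.trans (Finset.sum_congr rfl fun j _ => ?_) (hB ((ℛ ℂ a).left i)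
      (g ∘ₗ LinearMap.mulLeft ℂ (HopfAlgebra.antipode ℂ ((ℛ ℂ a).right i))))
    simp only [T, A, trilin_tmul]
    congr 1
    ext; simp
  rw [← h1, h4]; rfl

/-- The antipode of the double is compatible with the exchange relation, which is carried by `S` to
the exchange relation read from right to left. -/
theorem antipode_inclH_mul_inclDual (a : H) (g : Module.Dual ℂ H) :
    DrinfeldDouble.antipode (inclH a * inclDual g) =
      inclDual (dualAntipode g) * inclH (HopfAlgebra.antipode ℂ a) := by
  let B : H →ₗ[ℂ] Module.Dual ℂ H →ₗ[ℂ] DrinfeldDouble H :=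
    ((LinearMap.mul ℂ (DrinfeldDouble H)).compl₁₂ inclH.toLinearMap inclDual).compr₂
        DrinfeldDouble.antipode -
      (LinearMap.mul ℂ (DrinfeldDouble H)).flip.compl₁₂
        (inclH.toLinearMap ∘ₗ HopfAlgebra.antipode ℂ) (inclDual ∘ₗ dualAntipode)
  have hB : B = 0 := eq_zero_of_sum_comp_mulLeft hS B fun a g => by
    simp only [B, LinearMap.sub_apply, LinearMap.compr₂_apply, LinearMap.compl₁₂_apply,
      LinearMap.flip_apply, LinearMap.mul_apply', LinearMap.comp_apply, AlgHom.toLinearMap_apply,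
      Finset.sum_sub_distrib]
    rw [sub_eq_zero, ← map_sum, exchange hS]
    have h := exchange hS (antipodeRepr (ℛ ℂ a)) (dualAntipode g)
    simp only [map_sum, inclDual_mul_inclH, DrinfeldDouble.antipode_mk]
    refine Eq.trans ?_ (h.trans ?_)
    · refine Finset.sum_congr rfl fun i _ => ?_
      congr 2
      ext x
      simp [dualAntipode_apply, antipodeRepr, antipode_mul_antidistrib, hS]
    · refine Finset.sum_congr rfl fun i _ => ?_
      rw [inclDual_mul_inclH, antipodeRepr]
      congr 1
      ext x
      simp [dualAntipode_apply, antipode_mul_antidistrib, hS]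
  have := congrArg (fun B => B a g) hB
  simpa [B, sub_eq_zero] using this

theorem DrinfeldDouble.antipode_mul (x y : DrinfeldDouble H) :
    DrinfeldDouble.antipode (x * y) = DrinfeldDouble.antipode y * DrinfeldDouble.antipode x := by
  induction x using DrinfeldDouble.induction with
  | add x x' hx hx' => rw [add_mul, map_add, map_add, mul_add, hx, hx']
  | mk f a =>
    induction y using DrinfeldDouble.induction with
    | add y y' hy hy' => rw [mul_add, map_add, map_add, add_mul, hy, hy']
    | mk g b =>
      rw [mul_assoc, antipode_inclDual_mul, ← mul_assoc (inclH a), antipode_mul_inclH,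
        antipode_inclH_mul_inclDual hS, inclDual_mul_inclH f, inclDual_mul_inclH g,
        DrinfeldDouble.antipode_mk, DrinfeldDouble.antipode_mk]
      simp only [mul_assoc]

theorem DrinfeldDouble.antipode_antipode (x : DrinfeldDouble H) :
    DrinfeldDouble.antipode (DrinfeldDouble.antipode x) = x := by
  induction x using DrinfeldDouble.induction with
  | add x x' hx hx' => rw [map_add, map_add, hx, hx']
  | mk f a =>
    rw [inclDual_mul_inclH, DrinfeldDouble.antipode_mk, antipode_inclH_mul_inclDual hS, hS,
      dualAntipode_dualAntipode hS, inclDual_mul_inclH]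

omit hS in
theorem DrinfeldDouble.antipode_one : DrinfeldDouble.antipode (1 : DrinfeldDouble H) = 1 := by
  change DrinfeldDouble.antipode (DrinfeldDouble.mk counit 1) = 1
  rw [DrinfeldDouble.antipode_mk, HopfAlgebra.antipode_one, dualAntipode_counit, map_one, one_mul,
    inclDual_counit]

theorem actL_mul (m n : DrinfeldDouble H) : actL (m * n) = actL m * actL n := by
  ext ξ x
  simp [actL, DrinfeldDouble.antipode_mul hS]

end DoubleAntipode

/-! ### Ribbon operators from universal ribbon operators -/

section RibbonOperators

variable {E : Type*} [DecidableEq E] {H : Type*} [Ring H] [HopfAlgebra ℂ H]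
  {V : Type*} [AddCommGroup V] [Module ℂ V]

theorem toDualDouble_apply (h : H) (f g : Module.Dual ℂ H) (a : H) :
    toDualDouble (h ⊗ₜ[ℂ] f) (inclDual g * inclH a) = g h * f a := by
  rw [inclDual_mul_inclH]
  simp [toDualDouble, DrinfeldDouble.mk]

theorem toDualDouble_inclH (h : H) (f : Module.Dual ℂ H) (a : H) :
    toDualDouble (h ⊗ₜ[ℂ] f) (inclH a) = counit (R := ℂ) h * f a := by
  rw [← one_mul (inclH a), ← inclDual_counit, toDualDouble_apply]

theorem toDualDouble_inclDual (h : H) (f g : Module.Dual ℂ H) :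
    toDualDouble (h ⊗ₜ[ℂ] f) (inclDual g) = g h * f 1 := by
  rw [← mul_one (inclDual g), ← map_one inclH, toDualDouble_apply]

/-- The duality between the straightening formula of `D(H)` and the comultiplication of `D(H)*`, on
three separated tensor factors. -/
theorem toDualDouble_adTriple (w : H ⊗[ℂ] (H ⊗[ℂ] H)) {h : H} (f g k : Module.Dual ℂ H) (b : H) :
    toDualDouble (h ⊗ₜ[ℂ] f) (DrinfeldDouble.of (mulFunctional g (adTriple w (k ⊗ₜ b)))) =
      ∑ i ∈ (ℛ ℂ h).index, g ((ℛ ℂ h).left i) *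
        toDualDouble (coadTriple w ((ℛ ℂ h).right i ⊗ₜ f)) (inclDual k * inclH b) := by
  induction w with
  | zero => simp
  | add w w' hw hw' =>
    simp only [map_add, LinearMap.add_apply, mul_add, Finset.sum_add_distrib, hw, hw']
  | tmul x w =>
    induction w with
    | zero => simp
    | add w w' hw hw' =>
      simp only [TensorProduct.tmul_add, map_add, LinearMap.add_apply, mul_add,
        Finset.sum_add_distrib, hw, hw']
    | tmul y z =>
      simp only [adTriple, coadTriple, trilin_tmul, TensorProduct.map_tmul, toDualDouble_apply,
        mulFunctional_tmul]
      rw [← DrinfeldDouble.mk, ← inclDual_mul_inclH, toDualDouble_apply]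
      have h1 : convProd g (twist x z k) h = ∑ i ∈ (ℛ ℂ h).index, g ((ℛ ℂ h).left i) *
          k (HopfAlgebra.antipode ℂ z * ((ℛ ℂ h).right i * x)) := by
        simp only [convProd, LinearMap.mk₂_apply, LinearMap.comp_apply]
        rw [← (ℛ ℂ h).eq]
        simp
      rw [h1, Finset.sum_mul]
      refine Finset.sum_congr rfl fun i _ => ?_
      simp [mul_assoc]

variable [FiniteDimensional ℂ H]

/-- The comultiplication of `D(H)*` is dual to the product of `D(H)`. -/
theorem toDualDouble_mul (ξ : H ⊗[ℂ] Module.Dual ℂ H) (x y : DrinfeldDouble H) :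
    toDualDouble ξ (x * y) = LinearMap.mul' ℂ ℂ
      (TensorProduct.map (LinearMap.applyₗ x ∘ₗ toDualDouble) (LinearMap.applyₗ y ∘ₗ toDualDouble)
        (dualDoubleComul ξ)) := by
  induction ξ with
  | zero => simp
  | add ξ ξ' h h' => simp only [map_add, LinearMap.add_apply, h, h']
  | tmul h f =>
    induction x using DrinfeldDouble.induction with
    | add x x' hx hx' => simp only [add_mul, map_add, hx, hx', LinearMap.add_comp,
        TensorProduct.map_add_left, LinearMap.add_apply]
    | mk g a =>
      induction y using DrinfeldDouble.induction with
      | add y y' hy hy' => simp only [mul_add, map_add, hy, hy', LinearMap.add_comp,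
          TensorProduct.map_add_right, LinearMap.add_apply]
      | mk k b =>
        have h1 : inclDual g * inclH a * (inclDual k * inclH b) =
            DrinfeldDouble.of (mulFunctional g (adTriple (comul₃ a) (k ⊗ₜ b))) := by
          rw [inclDual_mul_inclH, inclDual_mul_inclH]
          change DrinfeldDouble.of (doubleMul (g ⊗ₜ a) (k ⊗ₜ b)) = _
          rw [doubleMul_tmul]
          rfl
        rw [h1, toDualDouble_adTriple]
        have h2 : comul₃ a =
            ∑ i, (Module.finBasis ℂ H).coord i a • comul₃ (Module.finBasis ℂ H i) := by
          conv_lhs => rw [← sum_coord_smul a]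
          simp only [map_sum, map_smul]
        rw [h2]
        simp only [dualDoubleComul, LinearMap.sum_apply, LinearMap.comp_apply,
          TensorProduct.map_tmul]
        rw [← (ℛ ℂ h).eq]
        simp only [map_sum, TensorProduct.sum_tmul, map_smul, LinearMap.sum_apply,
          LinearMap.smul_apply, LinearEquiv.coe_coe, TensorProduct.assoc_tmul,
          TensorProduct.map_tmul, Finset.mul_sum, LinearMap.mul'_apply, LinearMap.comp_apply,
          LinearMap.applyₗ_apply_apply, LinearMap.flip_apply, TensorProduct.mk_apply,
          toDualDouble_apply, LinearMap.id_apply]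
        rw [Finset.sum_comm]
        refine Finset.sum_congr rfl fun i _ => Finset.sum_congr rfl fun j _ => ?_
        simp only [smul_eq_mul]
        ring

/-- Application of a functional to the coefficients in the double. -/
def evalFst (V : Type*) [AddCommGroup V] [Module ℂ V] (ξ : Module.Dual ℂ (DrinfeldDouble H)) :
    DrinfeldDouble H ⊗[ℂ] V →ₗ[ℂ] V :=
  (TensorProduct.lid ℂ V).toLinearMap ∘ₗ TensorProduct.map ξ .id

omit [FiniteDimensional ℂ H] in
@[simp] theorem evalFst_tmul (ξ : Module.Dual ℂ (DrinfeldDouble H)) (m : DrinfeldDouble H) (v : V) :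
    evalFst V ξ (m ⊗ₜ v) = ξ m • v := by
  simp [evalFst]

omit [FiniteDimensional ℂ H] in
theorem evalFst_add (ξ ξ' : Module.Dual ℂ (DrinfeldDouble H)) (z : DrinfeldDouble H ⊗[ℂ] V) :
    evalFst V (ξ + ξ') z = evalFst V ξ z + evalFst V ξ' z := by
  simp [evalFst, TensorProduct.map_add_left]

omit [FiniteDimensional ℂ H] in
theorem evalFst_smul (c : ℂ) (ξ : Module.Dual ℂ (DrinfeldDouble H)) (z : DrinfeldDouble H ⊗[ℂ] V) :
    evalFst V (c • ξ) z = c • evalFst V ξ z := by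
  simp [evalFst, TensorProduct.map_smul_left]

/-- The linear map `ξ ↦ evalFst ξ z`. -/
def evalAt (z : DrinfeldDouble H ⊗[ℂ] V) : Module.Dual ℂ (DrinfeldDouble H) →ₗ[ℂ] V where
  toFun ξ := evalFst V ξ z
  map_add' ξ ξ' := evalFst_add ξ ξ' z
  map_smul' c ξ := evalFst_smul c ξ z

omit [DecidableEq E] in
/-- The value of `ξ` on a product is computed with the comultiplication of `D(H)*`. -/
theorem evalFst_mul (ξ : H ⊗[ℂ] Module.Dual ℂ H) (z w : DoubleOp E H) :
    evalFst _ (toDualDouble ξ) (z * w) = LinearMap.mul' ℂ _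
      (TensorProduct.map (evalAt z ∘ₗ toDualDouble) (evalAt w ∘ₗ toDualDouble)
        (dualDoubleComul ξ)) := by
  have key : ∀ (x y : DrinfeldDouble H) (s t : Module.End ℂ (StateSpace E H))
      (u : (H ⊗[ℂ] Module.Dual ℂ H) ⊗[ℂ] (H ⊗[ℂ] Module.Dual ℂ H)),
      LinearMap.mul' ℂ _ (TensorProduct.map (evalAt (x ⊗ₜ[ℂ] s) ∘ₗ toDualDouble)
        (evalAt (y ⊗ₜ[ℂ] t) ∘ₗ toDualDouble) u) = LinearMap.mul' ℂ ℂ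
      (TensorProduct.map (LinearMap.applyₗ x ∘ₗ toDualDouble) (LinearMap.applyₗ y ∘ₗ toDualDouble)
        u) • (s * t) := by
    intro x y s t u
    induction u with
    | zero => simp
    | add u u' h h' => simp only [map_add, h, h', add_smul]
    | tmul p q => simp [evalAt, smul_smul, mul_comm]
  have hadd : ∀ z w : DoubleOp E H, evalAt (z + w) = evalAt z + evalAt w := fun z w => by
    ext1 ξ; simp [evalAt]
  induction z using TensorProduct.induction_on with
  | zero =>
    have : evalAt (0 : DoubleOp E H) = 0 := by ext1 ξ; simp [evalAt]
    simp [this]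
  | add z z' h h' => simp only [add_mul, map_add, h, h', hadd, LinearMap.add_comp,
      TensorProduct.map_add_left, LinearMap.add_apply]
  | tmul x s =>
    induction w using TensorProduct.induction_on with
    | zero =>
      have : evalAt (0 : DoubleOp E H) = 0 := by ext1 ξ; simp [evalAt]
      simp [this]
    | add z z' h h' => simp only [mul_add, map_add, h, h', hadd, LinearMap.add_comp,
        TensorProduct.map_add_right, LinearMap.add_apply]
    | tmul y t =>
      rw [key, ← toDualDouble_mul, Algebra.TensorProduct.tmul_mul_tmul, evalFst_tmul]

variable {Γ : Lattice E}

/-- The operators of a triangle arise from its universal operator. -/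
theorem triangleOp_eq (t : Triangle Γ) (ξ : H ⊗[ℂ] Module.Dual ℂ H) :
    triangleOp t ξ = evalFst _ (toDualDouble ξ) (triangleElem t : DoubleOp E H) := by
  induction ξ with
  | zero => simp [evalFst]
  | add ξ ξ' h h' => rw [map_add, map_add, evalFst_add, h, h']
  | tmul h f =>
    obtain ⟨σ, ty, o⟩ := t
    cases ty
    · simp only [triangleOp, triangleElem, canon, map_sum, LinearMap.comp_apply,
        TensorProduct.map_tmul]
      conv_lhs => rw [← sum_smul_coord f]
      simp only [map_sum, map_smul, TensorProduct.tmul_sum, TensorProduct.tmul_smul,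
        TensorProduct.smul_tmul', LinearMap.id_apply]
      refine Finset.sum_congr rfl fun k _ => ?_
      simp [coeffHom, opHom, toDualDouble_inclH, mul_comm]
    · simp only [triangleOp, triangleElem, canon, map_sum, LinearMap.comp_apply,
        TensorProduct.map_tmul]
      conv_lhs => rw [← sum_coord_smul h]
      simp only [map_sum, map_smul, TensorProduct.sum_tmul, LinearMap.id_apply]
      refine Finset.sum_congr rfl fun k _ => ?_
      simp [coeffHom, opHom, toDualDouble_inclDual, smul_smul, mul_comm]

/-- The ribbon operators arise from the universal ribbon operator, because the recursion for `F^ξ`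
is dual to multiplication in `D(H)`. -/
theorem ribbonOpList_eq (l : List (Triangle Γ)) (ξ : H ⊗[ℂ] Module.Dual ℂ H) :
    ribbonOpList l ξ = evalFst _ (toDualDouble ξ) (ribbonElem l : DoubleOp E H) := by
  induction l generalizing ξ with
  | nil =>
    rw [ribbonElem, List.map_nil, List.prod_nil, Algebra.TensorProduct.one_def, evalFst_tmul]
    have h1 : (1 : DrinfeldDouble H) = inclDual counit * inclH 1 := by
      rw [inclDual_counit, map_one, one_mul]
    simp only [ribbonOpList, LinearMap.smulRight_apply]
    congr 1
    induction ξ with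
    | zero => simp
    | add ξ ξ' h h' => rw [map_add, map_add, LinearMap.add_apply, h, h']
    | tmul h f =>
      rw [h1, toDualDouble_apply]
      simp [dualDoubleCounit]
  | cons t l ih =>
    have h1 : triangleOp t = evalAt (triangleElem t : DoubleOp E H) ∘ₗ toDualDouble :=
      LinearMap.ext fun ξ => triangleOp_eq t ξ
    have h2 : ribbonOpList l = evalAt (ribbonElem l : DoubleOp E H) ∘ₗ toDualDouble :=
      LinearMap.ext fun ξ => ih ξ
    have h3 : (ribbonElem (t :: l) : DoubleOp E H) = triangleElem t * ribbonElem l := by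
      rw [ribbonElem, List.map_cons, List.prod_cons, ribbonElem]
    rw [h3, evalFst_mul, ribbonOpList, h1, h2]
    rfl

end RibbonOperators

/-! ### The space of ribbon states -/

section RibbonSpace

variable {E : Type*} {H : Type*} [Ring H] [HopfAlgebra ℂ H]

instance [FiniteDimensional ℂ H] : FiniteDimensional ℂ (DrinfeldDouble H) :=
  inferInstanceAs (FiniteDimensional ℂ (Module.Dual ℂ H ⊗[ℂ] H))

theorem apply_evalFst (T : Module.End ℂ (StateSpace E H)) (ξ : Module.Dual ℂ (DrinfeldDouble H))
    (y : DrinfeldDouble H ⊗[ℂ] StateSpace E H) :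
    T (evalFst _ ξ y) = evalFst _ ξ (opAction E H (opHom E H T) y) := by
  induction y with
  | zero => simp
  | add x y hx hy => simp only [map_add, hx, hy]
  | tmul m v => rw [opAction_opHom, evalFst_tmul, evalFst_tmul, map_smul]

theorem evalFst_coeffHom (ξ : Module.Dual ℂ (DrinfeldDouble H)) (m : DrinfeldDouble H)
    (y : DrinfeldDouble H ⊗[ℂ] StateSpace E H) :
    evalFst _ ξ (opAction E H (coeffHom E H m) y) = evalFst _ (ξ ∘ₗ LinearMap.mulLeft ℂ m) y := by
  induction y with
  | zero => simp
  | add x y hx hy => simp only [map_add, hx, hy]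
  | tmul n v => rw [opAction_coeffHom, evalFst_tmul, evalFst_tmul]; rfl

theorem opAction_tmul (m n : DrinfeldDouble H) (T : Module.End ℂ (StateSpace E H))
    (v : StateSpace E H) : opAction E H (m ⊗ₜ T) (n ⊗ₜ v) = (m * n) ⊗ₜ T v := by
  have : m ⊗ₜ T = coeffHom E H m * opHom E H T := by simp [coeffHom, opHom]
  rw [this, map_mul, Module.End.mul_apply, opAction_opHom, opAction_coeffHom]

/-- Right multiplication on the coefficients commutes with all operators. -/
theorem evalFst_mulRight (ξ : Module.Dual ℂ (DrinfeldDouble H)) (z : DoubleOp E H)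
    (m n : DrinfeldDouble H) (v : StateSpace E H) :
    evalFst _ ξ (opAction E H z ((n * m) ⊗ₜ v)) =
      evalFst _ (ξ ∘ₗ LinearMap.mulRight ℂ m) (opAction E H z (n ⊗ₜ v)) := by
  induction z using TensorProduct.induction_on with
  | zero => simp
  | add x y hx hy => simp only [map_add, LinearMap.add_apply, hx, hy]
  | tmul x T =>
    rw [opAction_tmul, opAction_tmul, evalFst_tmul, evalFst_tmul, ← mul_assoc]; rfl

theorem evalFst_opAction_one (ξ : Module.Dual ℂ (DrinfeldDouble H)) (z : DoubleOp E H)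
    (v : StateSpace E H) : evalFst _ ξ (opAction E H z (1 ⊗ₜ v)) = evalFst _ ξ z v := by
  induction z using TensorProduct.induction_on with
  | zero => simp
  | add x y hx hy => simp only [map_add, LinearMap.add_apply, hx, hy]
  | tmul x T => rw [opAction_tmul, evalFst_tmul, evalFst_tmul, mul_one, LinearMap.smul_apply]

variable [DecidableEq E] {Γ : Lattice E} [FiniteDimensional ℂ H]

/-- The map `ξ ↦ F^ξ(τ) Ω` on `D(H)*`, for a sequence of triangles. -/
def stateMap (l : List (Triangle Γ)) (Ω : StateSpace E H) :
    Module.Dual ℂ (DrinfeldDouble H) →ₗ[ℂ] StateSpace E H :=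
  evalAt (ribbonState l Ω)

theorem stateMap_toDualDouble (l : List (Triangle Γ)) (Ω : StateSpace E H)
    (ξ : H ⊗[ℂ] Module.Dual ℂ H) : stateMap l Ω (toDualDouble ξ) = ribbonOpList l ξ Ω := by
  rw [ribbonOpList_eq]
  exact evalFst_opAction_one _ _ _

theorem toDualDouble_surjective : Function.Surjective (toDualDouble (H := H)) := by
  have h1 : Function.Surjective (TensorProduct.dualDistrib ℂ (Module.Dual ℂ H) H) :=
    (TensorProduct.dualDistribEquiv ℂ (Module.Dual ℂ H) H).surjective
  have h2 : Function.Surjective (TensorProduct.map (Module.Dual.eval ℂ H)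
      (LinearMap.id : Module.Dual ℂ H →ₗ[ℂ] Module.Dual ℂ H)) :=
    TensorProduct.map_surjective (Module.evalEquiv ℂ H).surjective Function.surjective_id
  exact (DrinfeldDouble.of (H := H)).symm.dualMap.surjective.comp (h1.comp h2)

/-- The ribbon states span `V_τ`. -/
theorem range_stateMap (τ : Ribbon Γ) (Ω : StateSpace E H) :
    LinearMap.range (stateMap τ.triangles Ω) = ribbonSpace τ Ω := by
  have h1 : LinearMap.range (stateMap τ.triangles Ω) =
      LinearMap.range (stateMap τ.triangles Ω ∘ₗ toDualDouble) := by
    rw [LinearMap.range_comp, LinearMap.range_eq_top.2 toDualDouble_surjective, Submodule.map_top]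
  rw [h1, LinearMap.range_eq_map, ← TensorProduct.span_tmul_eq_top, Submodule.map_span, ribbonSpace]
  congr 1
  ext v
  simp only [Set.mem_image, Set.mem_ofPred_eq, Set.mem_range, Prod.exists, LinearMap.comp_apply,
    stateMap_toDualDouble]
  constructor
  · rintro ⟨_, ⟨h, f, rfl⟩, rfl⟩
    exact ⟨h, f, rfl⟩
  · rintro ⟨h, f, rfl⟩
    exact ⟨_, ⟨h, f, rfl⟩, rfl⟩

variable (hS : ∀ a : H, HopfAlgebra.antipode ℂ (HopfAlgebra.antipode ℂ a) = a) [Finite E]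
  {Ω : StateSpace E H} (hΩ : IsGroundState Γ Ω) (τ : Ribbon Γ)

include hS hΩ

/-- The local operators at the initial site act on the ribbon states as the action `L`. -/
theorem opB_opA_initial (hv : ¬ Γ.SameVertex τ.initial τ.final)
    (hp : ¬ Γ.SameFace τ.initial τ.final) (t : Module.Dual ℂ H) (a : H)
    (ξ : Module.Dual ℂ (DrinfeldDouble H)) :
    opB Γ τ.initial t (opA Γ τ.initial a (stateMap τ.triangles Ω ξ)) =
      stateMap τ.triangles Ω (actL (DrinfeldDouble.mk t a) ξ) := by
  obtain ⟨l, hne, hch, hd⟩ := τ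
  obtain ⟨t₀, ts, rfl⟩ := List.exists_cons_of_ne_nil hne
  have hA := opA_initial_ribbonState hS hch hd rfl hv (hΩ.opA_apply hS t₀.initial) a
  have hB := opB_initial_ribbonState hS hch hd rfl hp (hΩ.opB_apply hS t₀.initial) t
  change opB Γ t₀.initial t (opA Γ t₀.initial a (evalFst _ ξ (ribbonState (t₀ :: ts) Ω))) =
    evalFst _ _ (ribbonState (t₀ :: ts) Ω)
  rw [apply_evalFst, hA, evalFst_coeffHom, apply_evalFst, hB, evalFst_coeffHom]
  congr 1
  ext x
  simp [actL, DrinfeldDouble.antipode_mk]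

/-- The local operators at the final site act on the ribbon states as the action `R`. -/
theorem opB_opA_final (hv : ¬ Γ.SameVertex τ.initial τ.final)
    (hp : ¬ Γ.SameFace τ.initial τ.final) (t : Module.Dual ℂ H) (a : H)
    (ξ : Module.Dual ℂ (DrinfeldDouble H)) :
    opB Γ τ.final t (opA Γ τ.final a (stateMap τ.triangles Ω ξ)) =
      stateMap τ.triangles Ω (actR (DrinfeldDouble.mk t a) ξ) := by
  obtain ⟨l, hne, hch, hd⟩ := τ
  obtain ⟨t₀, ts, rfl⟩ := List.exists_cons_of_ne_nil hne
  set s := ((t₀ :: ts).getLast hne).final with hs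
  have hA := opA_final_ribbonState hS hch hd rfl hv (hΩ.opA_apply hS s) a
  have hB := opB_final_ribbonState hS hch hd rfl hp (hΩ.opB_apply hS s) t
  change opB Γ s t (opA Γ s a (evalFst _ ξ (ribbonState (t₀ :: ts) Ω))) =
    evalFst _ _ (ribbonState (t₀ :: ts) Ω)
  rw [apply_evalFst, hA, ← one_mul (inclH a), evalFst_mulRight]
  change opB Γ s t (evalFst _ _ (ribbonState (t₀ :: ts) Ω)) = _
  rw [apply_evalFst, hB, ← one_mul (inclDual t), evalFst_mulRight]
  change evalFst _ _ (ribbonState (t₀ :: ts) Ω) = _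
  congr 1
  ext x
  simp [actR, ← inclDual_mul_inclH, mul_assoc]

/-- Ribbon states are determined by their functional. The kernel is invariant under `L`, so a
functional in the kernel vanishes on all left multiples of the ribbon state by operators with
coefficients. The universal ribbon operator is invertible, and inverting it leaves `ξ(n) Ω = 0` for
all `n`. -/
theorem stateMap_injective (hv : ¬ Γ.SameVertex τ.initial τ.final)
    (hp : ¬ Γ.SameFace τ.initial τ.final) : Function.Injective (stateMap τ.triangles Ω) := by
  rw [injective_iff_map_eq_zero]
  intro ξ hξ
  -- the kernel is invariant under `L`
  have h1 : ∀ m, stateMap τ.triangles Ω (actL m ξ) = 0 := by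
    intro m
    induction m using DrinfeldDouble.induction with
    | mk f a => rw [inclDual_mul_inclH, ← opB_opA_initial hS hΩ τ hv hp, hξ, map_zero, map_zero]
    | add x y hx hy =>
      have : actL (x + y) ξ = actL x ξ + actL y ξ := by ext z; simp [actL, add_mul]
      rw [this, map_add, hx, hy, add_zero]
  have h2 : ∀ m, evalFst _ ξ (opAction E H (coeffHom E H m) (ribbonState τ.triangles Ω)) = 0 := by
    intro m
    have h := h1 (DrinfeldDouble.antipode m)
    rw [evalFst_coeffHom]
    simp only [actL, DrinfeldDouble.antipode_antipode hS] at h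
    exact h
  have h3 : ∀ z, evalFst _ ξ (opAction E H z (ribbonState τ.triangles Ω)) = 0 := by
    intro z
    induction z using TensorProduct.induction_on with
    | zero => simp
    | add x y hx hy => simp only [map_add, LinearMap.add_apply, hx, hy, add_zero]
    | tmul m T =>
      have : m ⊗ₜ T = opHom E H T * coeffHom E H m := by simp [coeffHom, opHom]
      rw [this, map_mul, Module.End.mul_apply, ← apply_evalFst, h2, map_zero]
  -- undo the ribbon operator
  obtain ⟨u, hu⟩ := ribbonElem_isUnit (H := H) hS τ.triangles
  ext n
  have h4 := h3 (coeffHom E H n * ↑u⁻¹)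
  rw [ribbonState, ← Module.End.mul_apply, ← map_mul, ← hu, mul_assoc, Units.inv_mul, mul_one,
    opAction_coeffHom, mul_one, evalFst_tmul] at h4
  exact (smul_eq_zero.1 h4).resolve_right hΩ.1

end RibbonSpace

/-! ### Integrals and traces -/

section Integrals

open WithConv

variable {H : Type*} [Ring H] [HopfAlgebra ℂ H]
  (hS : ∀ a : H, HopfAlgebra.antipode ℂ (HopfAlgebra.antipode ℂ a) = a)
  {h₀ : H} {φ : Module.Dual ℂ H}

theorem apply_readSnd (f g : Module.Dual ℂ H) (x : H) : f (readSnd g x) = convProd f g x := by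
  rw [readSnd_repr (ℛ ℂ x)]
  simp only [convProd, LinearMap.mk₂_apply, LinearMap.comp_apply]
  rw [← (ℛ ℂ x).eq]
  simp [mul_comm]

theorem apply_readFst (f g : Module.Dual ℂ H) (x : H) : f (readFst g x) = convProd g f x := by
  rw [readFst_repr (ℛ ℂ x)]
  simp only [convProd, LinearMap.mk₂_apply, LinearMap.comp_apply]
  rw [← (ℛ ℂ x).eq]
  simp

theorem eq_of_forall_dual {V : Type*} [AddCommGroup V] [Module ℂ V] {x y : V}
    (h : ∀ f : Module.Dual ℂ V, f x = f y) : x = y :=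
  sub_eq_zero.1 ((Module.forall_dual_apply_eq_zero_iff ℂ (x - y)).1 fun f => by
    rw [map_sub, h, sub_self])

theorem IsDualHaarIntegral.readSnd (hφ : IsDualHaarIntegral φ) (x : H) :
    readSnd φ x = φ x • (1 : H) :=
  eq_of_forall_dual fun f => by
    rw [apply_readSnd, (hφ.1 f).1]; simp [mul_comm]

theorem IsDualHaarIntegral.readFst (hφ : IsDualHaarIntegral φ) (x : H) :
    readFst φ x = φ x • (1 : H) :=
  eq_of_forall_dual fun f => by
    rw [apply_readFst, (hφ.1 f).2]; simp [mul_comm]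

theorem IsHaarIntegral.antipode_mul (hS : ∀ a : H, antipode ℂ (antipode ℂ a) = a)
    (hh : IsHaarIntegral h₀) (a : H) : antipode ℂ h₀ * a = counit (R := ℂ) a • antipode ℂ h₀ := by
  have h := congrArg (antipode ℂ) (hh.1 (antipode ℂ a)).1
  rw [antipode_mul_antidistrib, hS] at h
  simpa using h

theorem IsHaarIntegral.mul_antipode (hS : ∀ a : H, antipode ℂ (antipode ℂ a) = a)
    (hh : IsHaarIntegral h₀) (a : H) : a * antipode ℂ h₀ = counit (R := ℂ) a • antipode ℂ h₀ := by
  have h := congrArg (antipode ℂ) (hh.1 (antipode ℂ a)).2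
  rw [antipode_mul_antidistrib, hS] at h
  simpa using h

/-- The invariance of the integral as a reconstruction formula: `∑ φ(a S(h₁)) h₂ = φ(S h₀) a`. -/
theorem sum_integral_mul_antipode (hS : ∀ a : H, antipode ℂ (antipode ℂ a) = a)
    (hh : IsHaarIntegral h₀) (hφ : IsDualHaarIntegral φ) (a : H) :
    ∑ i ∈ (ℛ ℂ h₀).index, φ (a * antipode ℂ ((ℛ ℂ h₀).left i)) • (ℛ ℂ h₀).right i =
      φ (antipode ℂ h₀) • a := by
  let U : WithConv (H →ₗ[ℂ] H) :=
    toConv ((φ ∘ₗ LinearMap.mulLeft ℂ a ∘ₗ antipode ℂ).smulRight (1 : H))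
  let V : WithConv (H →ₗ[ℂ] H) :=
    toConv ({ toFun := fun b => readSnd (φ ∘ₗ LinearMap.mulRight ℂ b) a
              map_add' := fun b b' => by
                rw [← LinearMap.add_apply, ← map_add]; congr 2; ext; simp [mul_add]
              map_smul' := fun c b => by
                rw [RingHom.id_apply, ← LinearMap.smul_apply, ← map_smul]; congr 2; ext; simp } ∘ₗ
                  antipode ℂ)
  have h1 : V * toConv (antipode ℂ) = U := by
    ext b
    rw [(ℛ ℂ b).convMul_apply]
    have h2 := hφ.readSnd (a * antipode ℂ b)
    rw [KitaevHopf.readSnd] at h2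
    simp only [LinearMap.coe_mk, AddHom.coe_mk, LinearMap.comp_apply] at h2
    rw [comul_mul_repr (ℛ ℂ a) (antipodeRepr (ℛ ℂ b))] at h2
    simp only [U, LinearMap.smulRight_apply, LinearMap.comp_apply, LinearMap.mulLeft_apply, ← h2]
    simp [V, readSnd_repr (ℛ ℂ a), antipodeRepr, Finset.sum_mul]
    exact Finset.sum_comm
  have h3 : U * toConv LinearMap.id = V := by
    have := conv_antipode_mul (AlgHom.id ℂ H)
    rw [← h1, mul_assoc]
    exact (congrArg (V * ·) this).trans (mul_one V)
  have h4 := congrArg (fun u : WithConv (H →ₗ[ℂ] H) => u h₀) h3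
  simp only [(ℛ ℂ h₀).convMul_apply] at h4
  have h5 : V h₀ = φ (antipode ℂ h₀) • a := by
    simp only [V, LinearMap.comp_apply, LinearMap.coe_mk, AddHom.coe_mk]
    have : φ ∘ₗ LinearMap.mulRight ℂ (antipode ℂ h₀) =
        φ (antipode ℂ h₀) • (counit : H →ₗ[ℂ] ℂ) := by
      ext x; simp [hh.mul_antipode hS, mul_comm]
    rw [this, map_smul, readSnd_counit]; rfl
  rw [← h5, ← h4]
  simp [U]

/-- The mirror image of `sum_integral_mul_antipode`: `∑ φ(S(h₂) a) h₁ = φ(S h₀) a`. -/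
theorem sum_integral_antipode_mul (hS : ∀ a : H, antipode ℂ (antipode ℂ a) = a)
    (hh : IsHaarIntegral h₀) (hφ : IsDualHaarIntegral φ) (a : H) :
    ∑ i ∈ (ℛ ℂ h₀).index, φ (antipode ℂ ((ℛ ℂ h₀).right i) * a) • (ℛ ℂ h₀).left i =
      φ (antipode ℂ h₀) • a := by
  let U : WithConv (H →ₗ[ℂ] H) :=
    toConv ((φ ∘ₗ LinearMap.mulRight ℂ a ∘ₗ antipode ℂ).smulRight (1 : H))
  let V : WithConv (H →ₗ[ℂ] H) :=
    toConv ({ toFun := fun b => readFst (φ ∘ₗ LinearMap.mulLeft ℂ b) a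
              map_add' := fun b b' => by
                rw [← LinearMap.add_apply, ← map_add]; congr 2; ext; simp [add_mul]
              map_smul' := fun c b => by
                rw [RingHom.id_apply, ← LinearMap.smul_apply, ← map_smul]; congr 2; ext; simp } ∘ₗ
                  antipode ℂ)
  have h1 : toConv (antipode ℂ) * V = U := by
    ext b
    rw [(ℛ ℂ b).convMul_apply]
    have h2 := hφ.readFst (antipode ℂ b * a)
    rw [KitaevHopf.readFst] at h2
    simp only [LinearMap.coe_mk, AddHom.coe_mk, LinearMap.comp_apply] at h2
    rw [comul_mul_repr (antipodeRepr (ℛ ℂ b)) (ℛ ℂ a)] at h2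
    simp only [U, LinearMap.smulRight_apply, LinearMap.comp_apply, LinearMap.mulRight_apply, ← h2]
    simp [V, readFst_repr (ℛ ℂ a), antipodeRepr, Finset.mul_sum]
  have h3 : toConv LinearMap.id * U = V := by
    have := conv_mul_antipode (AlgHom.id ℂ H)
    rw [← h1, ← mul_assoc]
    exact (congrArg (· * V) this).trans (one_mul V)
  have h4 := congrArg (fun u : WithConv (H →ₗ[ℂ] H) => u h₀) h3
  simp only [(ℛ ℂ h₀).convMul_apply] at h4
  have h5 : V h₀ = φ (antipode ℂ h₀) • a := by
    simp only [V, LinearMap.comp_apply, LinearMap.coe_mk, AddHom.coe_mk]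
    have : φ ∘ₗ LinearMap.mulLeft ℂ (antipode ℂ h₀) = φ (antipode ℂ h₀) • (counit : H →ₗ[ℂ] ℂ) := by
      ext x; simp [hh.antipode_mul hS, mul_comm]
    rw [this, map_smul, readFst_counit]; rfl
  rw [← h5, ← h4]
  simp [U]

section Traces

variable [FiniteDimensional ℂ H] (hh : IsHaarIntegral h₀) (hφ : IsDualHaarIntegral φ)

include hS hh hφ

/-- The trace of an operator in terms of the integrals, from the dual bases given by
`sum_integral_mul_antipode`. -/
theorem trace_eq_sum_left (T : Module.End ℂ H) : φ (antipode ℂ h₀) * LinearMap.trace ℂ H T =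
    ∑ i ∈ (ℛ ℂ h₀).index, φ (T ((ℛ ℂ h₀).right i) * antipode ℂ ((ℛ ℂ h₀).left i)) := by
  have h : φ (antipode ℂ h₀) • T = ∑ i ∈ (ℛ ℂ h₀).index,
      (φ ∘ₗ LinearMap.mulRight ℂ (antipode ℂ ((ℛ ℂ h₀).left i))).smulRight
        (T ((ℛ ℂ h₀).right i)) := by
    ext a
    rw [LinearMap.smul_apply, ← map_smul, ← sum_integral_mul_antipode hS hh hφ a]
    simp
  rw [← smul_eq_mul, ← map_smul, h, map_sum]
  simp [LinearMap.trace_smulRight]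

theorem trace_eq_sum_right (T : Module.End ℂ H) : φ (antipode ℂ h₀) * LinearMap.trace ℂ H T =
    ∑ i ∈ (ℛ ℂ h₀).index, φ (antipode ℂ ((ℛ ℂ h₀).right i) * T ((ℛ ℂ h₀).left i)) := by
  have h : φ (antipode ℂ h₀) • T = ∑ i ∈ (ℛ ℂ h₀).index,
      (φ ∘ₗ LinearMap.mulLeft ℂ (antipode ℂ ((ℛ ℂ h₀).right i))).smulRight
        (T ((ℛ ℂ h₀).left i)) := by
    ext a
    rw [LinearMap.smul_apply, ← map_smul, ← sum_integral_antipode_mul hS hh hφ a]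
    simp
  rw [← smul_eq_mul, ← map_smul, h, map_sum]
  simp [LinearMap.trace_smulRight]

/-- The integral of `H*` is the trace of the regular representation, up to a factor. -/
theorem trace_mulLeft (b : H) :
    φ (antipode ℂ h₀) * LinearMap.trace ℂ H (LinearMap.mulLeft ℂ b) = φ b := by
  rw [trace_eq_sum_left hS hh hφ]
  simp only [LinearMap.mulLeft_apply, mul_assoc]
  rw [← map_sum, ← Finset.mul_sum, sum_right_mul_antipode_left hS, hh.2]
  simp

/-- The integral of `H` is the trace of the coregular representation, up to a factor. -/
theorem trace_readFst (f : Module.Dual ℂ H) :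
    φ (antipode ℂ h₀) * LinearMap.trace ℂ H (readFst f) = f h₀ := by
  have h1 : toConv (antipode ℂ ∘ₗ readFst f) * toConv LinearMap.id = scalarConv f := by
    have := conv_antipode_mul (AlgHom.id ℂ H)
    rw [← scalarConv_mul_toConv, mul_assoc]
    exact (congrArg (scalarConv f * ·) this).trans (mul_one _)
  have h2 := congrArg (fun u : WithConv (H →ₗ[ℂ] H) => antipode ℂ (u h₀)) h1
  simp only [(ℛ ℂ h₀).convMul_apply, map_sum, antipode_mul_antidistrib, LinearMap.comp_apply, hS,
    LinearMap.id_apply] at h2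
  have h3 := congrArg φ h2
  rw [trace_eq_sum_right hS hh hφ, ← map_sum]
  refine h3.trans ?_
  simp [scalarConv, Algebra.algebraMap_eq_smul_one, antipode_one, hφ.2]

theorem integral_ne_zero : φ (antipode ℂ h₀) ≠ 0 := by
  intro h
  have := trace_mulLeft hS hh hφ 1
  rw [h, zero_mul, hφ.2] at this
  exact zero_ne_one this

theorem trace_convProd (f : Module.Dual ℂ H) :
    φ (antipode ℂ h₀) * LinearMap.trace ℂ (Module.Dual ℂ H) (convProd f) = f h₀ := by
  have : convProd f = Module.Dual.transpose (readFst f) := by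
    ext g x
    exact (apply_readFst g f x).symm
  rw [this, LinearMap.trace_transpose', trace_readFst hS hh hφ]

/-- The trace of the regular representation of the double. -/
theorem trace_doubleMul (f : Module.Dual ℂ H) (a : H) : φ (antipode ℂ h₀) ^ 2 *
    LinearMap.trace ℂ _ (doubleMul (f ⊗ₜ[ℂ] a)) = f h₀ * φ a := by
  let Θ : H ⊗[ℂ] (H ⊗[ℂ] H) →ₗ[ℂ] ℂ :=
    LinearMap.trace ℂ _ ∘ₗ LinearMap.mulLeft ℂ (mulFunctional f) ∘ₗ adTriple
  have h1 : ∀ x y z, φ (antipode ℂ h₀) * Θ (x ⊗ₜ (y ⊗ₜ z)) =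
      φ y * LinearMap.trace ℂ _ (convProd f ∘ₗ twist x z) := by
    intro x y z
    have : mulFunctional f * adTriple (x ⊗ₜ[ℂ] (y ⊗ₜ[ℂ] z)) =
        TensorProduct.map (convProd f ∘ₗ twist x z) (LinearMap.mulLeft ℂ y) := by
      ext g b; simp [adTriple]
    simp only [Θ, LinearMap.comp_apply, LinearMap.mulLeft_apply, this]
    rw [LinearMap.trace_tensorProduct', ← trace_mulLeft hS hh hφ y]
    ring
  have h2 : ∀ x (w : H ⊗[ℂ] H), φ (antipode ℂ h₀) * Θ (x ⊗ₜ w) = LinearMap.trace ℂ _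
      (convProd f ∘ₗ twist x (TensorProduct.lid ℂ H (TensorProduct.map φ .id w))) := by
    intro x w
    induction w with
    | zero =>
      have : twist x 0 = 0 := by ext; simp
      simp [this]
    | add w w' h h' =>
      rw [TensorProduct.tmul_add, map_add, mul_add, h, h', ← map_add, ← LinearMap.comp_add,
        ← twist_add_right, map_add, map_add]
    | tmul y z =>
      rw [h1]
      simp [twist_smul_right, LinearMap.comp_smul]
  have h3 : φ (antipode ℂ h₀) * Θ (comul₃ a) =
      φ a * LinearMap.trace ℂ (Module.Dual ℂ H) (convProd f) := by
    simp only [comul₃, LinearMap.comp_apply]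
    rw [← (ℛ ℂ a).eq]
    simp only [map_sum, TensorProduct.map_tmul, Finset.mul_sum, h2, LinearMap.id_apply]
    have h4 : ∀ i, TensorProduct.lid ℂ H (TensorProduct.map φ .id
        (comul (R := ℂ) ((ℛ ℂ a).right i))) = φ ((ℛ ℂ a).right i) • (1 : H) := fun i =>
      hφ.readFst _
    simp only [h4, twist_smul_right, ← twist_smul_left]
    have h5 := hφ.readSnd a
    rw [readSnd_repr (ℛ ℂ a)] at h5
    let G : H →ₗ[ℂ] ℂ :=
      { toFun := fun x => LinearMap.trace ℂ _ (convProd f ∘ₗ twist x 1)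
        map_add' := fun x y => by rw [twist_add_left, LinearMap.comp_add, map_add]
        map_smul' := fun c x => by rw [twist_smul_left, LinearMap.comp_smul, map_smul]; rfl }
    have h6 := congrArg G h5
    rw [map_sum, map_smul] at h6
    refine h6.trans ?_
    have h7 : twist (1 : H) 1 = LinearMap.id := by ext g x; simp
    simp [G, h7]
  have h8 : doubleMul (f ⊗ₜ[ℂ] a) = mulFunctional f * mulElement a := doubleMul_tmul f a
  have h9 : LinearMap.trace ℂ _ (doubleMul (f ⊗ₜ[ℂ] a)) = Θ (comul₃ a) := by rw [h8]; rfl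
  rw [h9, pow_two, mul_assoc, h3, mul_left_comm, trace_convProd hS hh hφ, mul_comm]

/-! ### Semisimplicity of the double -/

/-- The trace form of the double is nondegenerate. -/
theorem eq_zero_of_trace (x : DrinfeldDouble H)
    (h : ∀ f b, LinearMap.trace ℂ _ (LinearMap.mulLeft ℂ (inclDual f * x * inclH b)) = 0) :
    x = 0 := by
  set c := φ (antipode ℂ h₀) with hc
  have hc0 : c ≠ 0 := integral_ne_zero hS hh hφ
  let e := Module.finBasis ℂ H
  let τ (f : Module.Dual ℂ H) (b : H) : DrinfeldDouble H →ₗ[ℂ] ℂ :=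
    c ^ 2 • (LinearMap.trace ℂ _ ∘ₗ LinearMap.mul ℂ (DrinfeldDouble H) ∘ₗ
      LinearMap.mulRight ℂ (inclH b) ∘ₗ LinearMap.mulLeft ℂ (inclDual f))
  have hτ : ∀ f b g a, τ f b (inclDual g * inclH a) = convProd f g h₀ * φ (a * b) := by
    intro f b g a
    rw [← trace_doubleMul hS hh hφ]
    simp only [τ, LinearMap.smul_apply, LinearMap.comp_apply, LinearMap.mulLeft_apply,
      LinearMap.mulRight_apply, smul_eq_mul]
    rw [← mul_assoc (inclDual f), ← inclDual_mul, mul_assoc, ← map_mul, inclDual_mul_inclH]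
    rfl
  -- reconstruct `x` from the values of the trace form
  let G : DrinfeldDouble H →ₗ[ℂ] DrinfeldDouble H := ∑ k, ∑ i ∈ (ℛ ℂ h₀).index,
    (τ (φ ∘ₗ LinearMap.mulLeft ℂ (e k) ∘ₗ antipode ℂ) (antipode ℂ ((ℛ ℂ h₀).left i))).smulRight
      (inclDual (e.coord k) * inclH ((ℛ ℂ h₀).right i))
  have hG : G = c ^ 2 • LinearMap.id := by
    refine DrinfeldDouble.hom_ext fun g a => ?_
    have h1 : ∀ y, convProd (φ ∘ₗ LinearMap.mulLeft ℂ y ∘ₗ antipode ℂ) g h₀ = c * g y := by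
      intro y
      have := congrArg g (sum_integral_mul_antipode hS hh hφ y)
      rw [map_smul, map_sum, smul_eq_mul] at this
      rw [← this, ← apply_readFst, readFst_repr (ℛ ℂ h₀)]
      simp
    have h2 : ∑ k, g (e k) • e.coord k = g := sum_smul_coord g
    have h3 := sum_integral_mul_antipode hS hh hφ a
    simp only [G, LinearMap.sum_apply, LinearMap.smulRight_apply, hτ, h1]
    have h4 : c ^ 2 • (inclDual g * inclH a) = (c • inclDual (∑ k, g (e k) • e.coord k)) *
        inclH (c • a) := by
      rw [h2, map_smul, smul_mul_smul_comm, pow_two]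
    rw [LinearMap.smul_apply, LinearMap.id_apply, h4, ← h3, map_sum, map_sum, Finset.smul_sum,
      Finset.sum_mul_sum]
    refine Finset.sum_congr rfl fun k _ => Finset.sum_congr rfl fun i _ => ?_
    rw [map_smul, map_smul, smul_smul, smul_mul_smul_comm]
  have h0 : G x = 0 := by
    simp only [G, LinearMap.sum_apply, LinearMap.smulRight_apply]
    refine Finset.sum_eq_zero fun k _ => Finset.sum_eq_zero fun i _ => ?_
    have : τ (φ ∘ₗ LinearMap.mulLeft ℂ (e k) ∘ₗ antipode ℂ)
        (antipode ℂ ((ℛ ℂ h₀).left i)) x = 0 := by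
      have := h (φ ∘ₗ LinearMap.mulLeft ℂ (e k) ∘ₗ antipode ℂ) (antipode ℂ ((ℛ ℂ h₀).left i))
      simp only [τ, LinearMap.smul_apply, LinearMap.comp_apply]
      exact smul_eq_zero_of_right _ this
    rw [this, zero_smul]
  rw [hG] at h0
  exact (smul_eq_zero.1 h0).resolve_left (pow_ne_zero 2 hc0)

/-- The double is semisimple: elements of the Jacobson radical are nilpotent, so the trace form
vanishes on them, and it is nondegenerate. -/
theorem isSemisimpleRing_double : IsSemisimpleRing (DrinfeldDouble H) := by
  have : IsArtinianRing (DrinfeldDouble H) := IsArtinianRing.of_finite ℂ _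
  rw [IsArtinianRing.isSemisimpleRing_iff_jacobson, eq_bot_iff]
  intro x hx
  refine eq_zero_of_trace hS hh hφ x fun f b => ?_
  have h1 : inclDual f * x * inclH b ∈ Ring.jacobson (DrinfeldDouble H) :=
    Ideal.mul_mem_right _ _ (Ideal.mul_mem_left _ _ hx)
  obtain ⟨n, hn⟩ := IsSemiprimaryRing.isNilpotent (R := DrinfeldDouble H)
  have h2 : IsNilpotent (inclDual f * x * inclH b) := by
    have := Ideal.pow_mem_pow h1 n
    rw [hn] at this
    exact ⟨n, this⟩
  exact (LinearMap.isNilpotent_trace_of_isNilpotent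
    (h2.map (Algebra.lmul ℂ (DrinfeldDouble H)))).eq_zero

end Traces

end Integrals

/-! ### Irreducible representations of the double -/

section Blocks

variable {H : Type*} [Ring H] [HopfAlgebra ℂ H] {n : ℕ} {d : Fin n → ℕ}
  (e : DrinfeldDouble H ≃ₐ[ℂ] ∀ i, Matrix (Fin (d i)) (Fin (d i)) ℂ)

/-- The representation on column vectors given by one block of an isomorphism of `D(H)` with a
product of matrix algebras. -/
def blockRep (i : Fin n) : DoubleRep H (Fin (d i) → ℂ) :=
  (Matrix.toLinAlgEquiv' (R := ℂ) (n := Fin (d i))).toAlgHom.comp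
    ((Pi.evalAlgHom ℂ (fun i => Matrix (Fin (d i)) (Fin (d i)) ℂ) i).comp e.toAlgHom)

theorem blockRep_apply (i : Fin n) (m : DrinfeldDouble H) (v : Fin (d i) → ℂ) :
    blockRep e i m v = (e m i).mulVec v := rfl

/-- The element of `D(H)` given by a matrix in one block. -/
def blockElem (i : Fin n) : Matrix (Fin (d i)) (Fin (d i)) ℂ →ₗ[ℂ] DrinfeldDouble H :=
  e.symm.toLinearMap ∘ₗ LinearMap.single ℂ (fun i => Matrix (Fin (d i)) (Fin (d i)) ℂ) i

theorem apply_blockElem (i : Fin n) (M : Matrix (Fin (d i)) (Fin (d i)) ℂ) :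
    e (blockElem e i M) = Pi.single i M :=
  e.apply_symm_apply _

theorem blockRep_blockElem (i : Fin n) (M : Matrix (Fin (d i)) (Fin (d i)) ℂ)
    (v : Fin (d i) → ℂ) : blockRep e i (blockElem e i M) v = M.mulVec v := by
  rw [blockRep_apply, apply_blockElem, Pi.single_eq_same]

theorem blockRep_blockElem_of_ne {i j : Fin n} (h : j ≠ i)
    (M : Matrix (Fin (d i)) (Fin (d i)) ℂ) : blockRep e j (blockElem e i M) = 0 := by
  refine LinearMap.ext fun v => ?_
  rw [blockRep_apply, apply_blockElem, Pi.single_eq_of_ne h, Matrix.zero_mulVec]; rfl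

theorem mul_blockElem (i : Fin n) (m : DrinfeldDouble H) (M : Matrix (Fin (d i)) (Fin (d i)) ℂ) :
    m * blockElem e i M = blockElem e i (e m i * M) := by
  apply e.injective
  rw [map_mul, apply_blockElem, apply_blockElem]
  ext1 j
  rcases eq_or_ne j i with rfl | h
  · simp
  · simp [Pi.single_eq_of_ne h]

theorem sum_blockElem (x : DrinfeldDouble H) : ∑ i, blockElem e i (e x i) = x := by
  apply e.injective
  rw [map_sum]
  simp only [apply_blockElem]
  exact Finset.univ_sum_single _

theorem sum_smul_blockElem_single (x : DrinfeldDouble H) :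
    ∑ i, ∑ j, ∑ k, e x i j k • blockElem e i (Matrix.single j k 1) = x := by
  conv_rhs => rw [← sum_blockElem e x]
  refine Finset.sum_congr rfl fun i _ => ?_
  conv_rhs => rw [Matrix.matrix_eq_sum_single (e x i)]
  simp only [map_sum]
  refine Finset.sum_congr rfl fun j _ => Finset.sum_congr rfl fun k _ => ?_
  rw [← map_smul, Matrix.smul_single, smul_eq_mul, mul_one]

theorem isIrreducible_blockRep (i : Fin n) [NeZero (d i)] : (blockRep e i).IsIrreducible := by
  refine ⟨⟨0, Pi.single 0 1, fun h => ?_⟩, fun U hU => ?_⟩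
  · simpa using congrFun h 0
  · refine or_iff_not_imp_left.2 fun hne => ?_
    obtain ⟨u, hu, hu0⟩ := Submodule.exists_mem_ne_zero_of_ne_bot hne
    obtain ⟨k, hk⟩ := Function.ne_iff.1 hu0
    rw [eq_top_iff]
    rintro w -
    -- the rank-one matrix `w ⊗ (u k)⁻¹ eₖ` carries `u` to `w`
    have h := hU (blockElem e i (Matrix.vecMulVec w (Pi.single k (u k)⁻¹))) u hu
    rw [blockRep_blockElem, Matrix.vecMulVec_mulVec] at h
    have hk' : u k ≠ 0 := hk
    simpa [hk'] using h

/-- The blocks of a product of matrix algebras give all irreducible representations. -/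
theorem isCompleteIrreps_blockRep [∀ i, NeZero (d i)] : IsCompleteIrreps (blockRep e) := by
  refine ⟨fun i => isIrreducible_blockRep e i, fun i j ⟨g, hg⟩ => ?_, fun k ν hν => ?_⟩
  · by_contra hij
    have h := hg (blockElem e i 1) (Pi.single 0 1)
    rw [blockRep_blockElem, Matrix.one_mulVec, blockRep_blockElem_of_ne e (Ne.symm hij),
      LinearMap.zero_apply, g.map_eq_zero_iff] at h
    simpa using congrFun h 0
  · -- a diagonal matrix unit that does not act by zero gives an intertwiner
    obtain ⟨hnt, hmin⟩ := hν
    obtain ⟨w, hw⟩ := exists_ne (0 : Fin k → ℂ)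
    have h1 : ∑ i, ∑ j, ν (blockElem e i (Matrix.single j j 1)) w = w := by
      have h2 := congrArg (fun x => ν x w) (sum_smul_blockElem_single e 1)
      simpa [Matrix.one_apply, map_sum, LinearMap.sum_apply] using h2
    obtain ⟨i, -, hi⟩ := Finset.exists_ne_zero_of_sum_ne_zero (h1.trans_ne hw)
    obtain ⟨j, -, hj⟩ := Finset.exists_ne_zero_of_sum_ne_zero hi
    let T : (Fin (d i) → ℂ) →ₗ[ℂ] (Fin k → ℂ) :=
      { toFun := fun v => ν (blockElem e i (Matrix.vecMulVec v (Pi.single j 1))) w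
        map_add' := fun v v' => by rw [Matrix.add_vecMulVec, map_add, map_add]; rfl
        map_smul' := fun c v => by rw [Matrix.smul_vecMulVec, map_smul, map_smul]; rfl }
    have hT : ∀ m v, T (blockRep e i m v) = ν m (T v) := fun m v => by
      change ν _ w = ν m (ν _ w)
      rw [← Module.End.mul_apply, ← map_mul, mul_blockElem, Matrix.mul_vecMulVec, blockRep_apply]
    have hT0 : T (Pi.single j 1) ≠ 0 := by
      change ν (blockElem e i (Matrix.vecMulVec (Pi.single j 1) (Pi.single j 1))) w ≠ 0
      rwa [← Matrix.single_eq_single_vecMulVec_single]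
    have hker : LinearMap.ker T = ⊥ := by
      refine ((isIrreducible_blockRep e i).2 (LinearMap.ker T) fun m u hu => ?_).resolve_right ?_
      · rw [LinearMap.mem_ker] at hu ⊢
        rw [hT, hu, map_zero]
      · intro h
        exact hT0 (LinearMap.mem_ker.1 (h ▸ Submodule.mem_top))
    have hran : LinearMap.range T = ⊤ := by
      refine (hmin (LinearMap.range T) ?_).resolve_left ?_
      · rintro m _ ⟨u, rfl⟩
        exact ⟨_, hT m u⟩
      · intro h
        exact hT0 ((Submodule.mem_bot ℂ).1 (h ▸ LinearMap.mem_range_self T _))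
    let g := LinearEquiv.ofBijective T ⟨LinearMap.ker_eq_bot.1 hker, LinearMap.range_eq_top.1 hran⟩
    refine ⟨i, g.symm, fun m u => ?_⟩
    rw [g.symm_apply_eq]
    refine Eq.trans ?_ (hT m _).symm
    rw [show T (g.symm u) = u from g.apply_symm_apply u]

end Blocks

/-! ### The Peter–Weyl decomposition of the dual of the double -/

section PeterWeyl

variable {H : Type*} [Ring H] [HopfAlgebra ℂ H]

/-- The matrix coefficient `x ↦ l (μ (S x) w)` of a representation `μ`, bilinear in the vector `w`
and the functional `l`. -/
def matrixCoeff {W : Type*} [AddCommGroup W] [Module ℂ W] (μ : DoubleRep H W) :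
    W ⊗[ℂ] Module.Dual ℂ W →ₗ[ℂ] Module.Dual ℂ (DrinfeldDouble H) :=
  TensorProduct.lift <| LinearMap.mk₂ ℂ
    (fun w l => l ∘ₗ LinearMap.applyₗ w ∘ₗ μ.toLinearMap ∘ₗ DrinfeldDouble.antipode)
    (fun w w' l => by ext; simp) (fun c w l => by ext; simp)
    (fun w l l' => by ext; simp) (fun c w l => by ext; simp)

theorem matrixCoeff_tmul {W : Type*} [AddCommGroup W] [Module ℂ W] (μ : DoubleRep H W) (w : W)
    (l : Module.Dual ℂ W) (x : DrinfeldDouble H) :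
    matrixCoeff μ (w ⊗ₜ l) x = l (μ (DrinfeldDouble.antipode x) w) := rfl

section Equivariance

variable (hS : ∀ a : H, HopfAlgebra.antipode ℂ (HopfAlgebra.antipode ℂ a) = a)

include hS

/-- The action on the first factor corresponds to `L`. -/
theorem matrixCoeff_map_left {W : Type*} [AddCommGroup W] [Module ℂ W] (μ : DoubleRep H W)
    (m : DrinfeldDouble H) (y : W ⊗[ℂ] Module.Dual ℂ W) :
    matrixCoeff μ (TensorProduct.map (μ m) .id y) = actL m (matrixCoeff μ y) := by
  induction y with
  | zero => simp
  | add y y' h h' => simp only [map_add, h, h']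
  | tmul w l =>
    ext1 x
    simp [actL, matrixCoeff_tmul, DrinfeldDouble.antipode_mul hS,
      DrinfeldDouble.antipode_antipode hS]

/-- The dual action on the second factor corresponds to `R`. -/
theorem matrixCoeff_map_right {W : Type*} [AddCommGroup W] [Module ℂ W] (μ : DoubleRep H W)
    (m : DrinfeldDouble H) (y : W ⊗[ℂ] Module.Dual ℂ W) :
    matrixCoeff μ (TensorProduct.map .id (μ.dualAction m) y) = actR m (matrixCoeff μ y) := by
  induction y with
  | zero => simp
  | add y y' h h' => simp only [map_add, h, h']
  | tmul w l =>
    ext1 x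
    simp [actR, matrixCoeff_tmul, DrinfeldDouble.antipode_mul hS, DoubleRep.dualAction]

end Equivariance

variable {n : ℕ} {d : Fin n → ℕ}
  (e : DrinfeldDouble H ≃ₐ[ℂ] ∀ i, Matrix (Fin (d i)) (Fin (d i)) ℂ)

/-- The expansion of a functional on `D(H)` in matrix coefficients. -/
def fourier : Module.Dual ℂ (DrinfeldDouble H) →ₗ[ℂ]
    ∀ i, (Fin (d i) → ℂ) ⊗[ℂ] Module.Dual ℂ (Fin (d i) → ℂ) where
  toFun ξ i := ∑ j, ∑ k, ξ (DrinfeldDouble.antipode (blockElem e i (Matrix.single j k 1))) •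
    ((Pi.single k 1 : Fin (d i) → ℂ) ⊗ₜ[ℂ] (LinearMap.proj j : Module.Dual ℂ (Fin (d i) → ℂ)))
  map_add' ξ ξ' := by
    ext1 i
    simp [add_smul, Finset.sum_add_distrib]
  map_smul' c ξ := by
    ext1 i
    simp [mul_smul, Finset.smul_sum]

/-- The sum of the matrix coefficient maps of all blocks. -/
def synthesis : (∀ i, (Fin (d i) → ℂ) ⊗[ℂ] Module.Dual ℂ (Fin (d i) → ℂ)) →ₗ[ℂ]
    Module.Dual ℂ (DrinfeldDouble H) :=
  ∑ i, matrixCoeff (blockRep e i) ∘ₗ LinearMap.proj i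

/-- Fourier inversion, from the expansion of `S x` in matrix units and `S² = id` on the double. -/
theorem synthesis_fourier
    (hS : ∀ a : H, HopfAlgebra.antipode ℂ (HopfAlgebra.antipode ℂ a) = a)
    (ξ : Module.Dual ℂ (DrinfeldDouble H)) :
    synthesis e (fourier e ξ) = ξ := by
  ext1 x
  have h := congrArg (fun y => ξ (DrinfeldDouble.antipode y))
    (sum_smul_blockElem_single e (DrinfeldDouble.antipode x))
  simp only [DrinfeldDouble.antipode_antipode hS, map_sum, map_smul] at h
  rw [← h]
  simp only [synthesis, fourier, LinearMap.sum_apply, LinearMap.comp_apply, LinearMap.proj_apply,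
    LinearMap.coe_mk, AddHom.coe_mk, map_sum, map_smul, LinearMap.smul_apply, matrixCoeff_tmul,
    blockRep_apply, Matrix.mulVec_single_one, Matrix.col_apply, smul_eq_mul]
  refine Finset.sum_congr rfl fun i _ => Finset.sum_congr rfl fun j _ =>
    Finset.sum_congr rfl fun k _ => mul_comm _ _

variable [FiniteDimensional ℂ H]

omit [FiniteDimensional ℂ H] in
include e in
theorem finrank_dual_double :
    Module.finrank ℂ (Module.Dual ℂ (DrinfeldDouble H)) =
      Module.finrank ℂ (∀ i, (Fin (d i) → ℂ) ⊗[ℂ] Module.Dual ℂ (Fin (d i) → ℂ)) := by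
  rw [Subspace.dual_finrank_eq, e.toLinearEquiv.finrank_eq, Module.finrank_pi_fintype,
    Module.finrank_pi_fintype]
  refine Finset.sum_congr rfl fun i _ => ?_
  rw [Module.finrank_tensorProduct, Subspace.dual_finrank_eq, Module.finrank_matrix]
  simp

variable (hS : ∀ a : H, HopfAlgebra.antipode ℂ (HopfAlgebra.antipode ℂ a) = a)

/-- The Peter–Weyl isomorphism of `D(H)*` with the sum of the spaces `μᵢ ⊗ μᵢ*`. -/
def peterWeyl : Module.Dual ℂ (DrinfeldDouble H) ≃ₗ[ℂ]
    ∀ i, (Fin (d i) → ℂ) ⊗[ℂ] Module.Dual ℂ (Fin (d i) → ℂ) :=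
  LinearMap.linearEquivOfInjective (fourier e)
    (Function.LeftInverse.injective (synthesis_fourier e hS)) (finrank_dual_double e)

include hS in
theorem synthesis_injective : Function.Injective (synthesis e) := fun y y' h => by
  obtain ⟨ξ, rfl⟩ := (peterWeyl e hS).surjective y
  obtain ⟨ξ', rfl⟩ := (peterWeyl e hS).surjective y'
  have h1 := synthesis_fourier e hS ξ
  have h2 := synthesis_fourier e hS ξ'
  change synthesis e (fourier e ξ) = synthesis e (fourier e ξ') at h
  rw [h1, h2] at h
  rw [h]

theorem synthesis_peterWeyl (ξ : Module.Dual ℂ (DrinfeldDouble H)) :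
    synthesis e (peterWeyl e hS ξ) = ξ :=
  synthesis_fourier e hS ξ

theorem peterWeyl_actL (m : DrinfeldDouble H) (ξ : Module.Dual ℂ (DrinfeldDouble H)) (i : Fin n) :
    peterWeyl e hS (actL m ξ) i =
      TensorProduct.map (blockRep e i m) .id (peterWeyl e hS ξ i) := by
  suffices h : peterWeyl e hS (actL m ξ) =
      fun i => TensorProduct.map (blockRep e i m) .id (peterWeyl e hS ξ i) from congrFun h i
  apply synthesis_injective e hS
  rw [synthesis_peterWeyl]
  conv_lhs => rw [← synthesis_peterWeyl e hS ξ]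
  simp [synthesis, matrixCoeff_map_left hS]

theorem peterWeyl_actR (m : DrinfeldDouble H) (ξ : Module.Dual ℂ (DrinfeldDouble H)) (i : Fin n) :
    peterWeyl e hS (actR m ξ) i =
      TensorProduct.map .id ((blockRep e i).dualAction m) (peterWeyl e hS ξ i) := by
  suffices h : peterWeyl e hS (actR m ξ) =
      fun i => TensorProduct.map .id ((blockRep e i).dualAction m) (peterWeyl e hS ξ i) from
    congrFun h i
  apply synthesis_injective e hS
  rw [synthesis_peterWeyl]
  conv_lhs => rw [← synthesis_peterWeyl e hS ξ]
  simp [synthesis, matrixCoeff_map_right hS]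

end PeterWeyl

/-! ### Invariant subspaces -/

section TensorCoordinates

variable {k : ℕ}

/-- The coordinates of a tensor with respect to the standard basis and its dual. -/
def tensorCoord (b c : Fin k) : (Fin k → ℂ) ⊗[ℂ] Module.Dual ℂ (Fin k → ℂ) →ₗ[ℂ] ℂ :=
  LinearMap.mul' ℂ ℂ ∘ₗ TensorProduct.map (LinearMap.proj b) (LinearMap.applyₗ (Pi.single c 1))

theorem sum_apply_single_smul_proj (l : Module.Dual ℂ (Fin k → ℂ)) :
    ∑ c, l (Pi.single c 1) • (LinearMap.proj c : Module.Dual ℂ (Fin k → ℂ)) = l := by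
  refine LinearMap.ext fun v => ?_
  conv_rhs => rw [← Finset.univ_sum_single v, map_sum]
  simp only [LinearMap.sum_apply, LinearMap.smul_apply, LinearMap.proj_apply, smul_eq_mul]
  refine Finset.sum_congr rfl fun c _ => ?_
  rw [mul_comm, ← smul_eq_mul, ← map_smul, ← Pi.single_smul, smul_eq_mul, mul_one]

theorem sum_tensorCoord_smul (x : (Fin k → ℂ) ⊗[ℂ] Module.Dual ℂ (Fin k → ℂ)) :
    ∑ b, ∑ c, tensorCoord b c x • ((Pi.single b 1 : Fin k → ℂ) ⊗ₜ[ℂ]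
      (LinearMap.proj c : Module.Dual ℂ (Fin k → ℂ))) = x := by
  induction x with
  | zero => simp
  | add x y hx hy => simp only [map_add, add_smul, Finset.sum_add_distrib, hx, hy]
  | tmul w l =>
    conv_rhs => rw [← sum_apply_single_smul_proj l, ← Finset.univ_sum_single w]
    rw [TensorProduct.sum_tmul]
    refine Finset.sum_congr rfl fun b _ => ?_
    rw [TensorProduct.tmul_sum]
    refine Finset.sum_congr rfl fun c _ => ?_
    have h : (Pi.single b (w b) : Fin k → ℂ) = w b • Pi.single b 1 := by
      rw [← Pi.single_smul, smul_eq_mul, mul_one]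
    rw [h, TensorProduct.smul_tmul_smul]
    rfl

theorem exists_tensorCoord_ne_zero {x : (Fin k → ℂ) ⊗[ℂ] Module.Dual ℂ (Fin k → ℂ)}
    (hx : x ≠ 0) : ∃ b c, tensorCoord b c x ≠ 0 := by
  by_contra! h
  rw [← sum_tensorCoord_smul x] at hx
  simp [h] at hx

/-- Matrix units acting on both factors pick out one coordinate of a tensor. -/
theorem map_single_tmul (a b c f : Fin k) (x : (Fin k → ℂ) ⊗[ℂ] Module.Dual ℂ (Fin k → ℂ)) :
    TensorProduct.map (Matrix.toLin' (Matrix.single a b (1 : ℂ)))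
      (Matrix.toLin' (Matrix.single c f (1 : ℂ))).dualMap x =
    tensorCoord b c x • ((Pi.single a 1 : Fin k → ℂ) ⊗ₜ[ℂ]
      (LinearMap.proj f : Module.Dual ℂ (Fin k → ℂ))) := by
  induction x with
  | zero => simp
  | add x y hx hy => simp only [map_add, add_smul, hx, hy]
  | tmul w l =>
    have h1 : Matrix.toLin' (Matrix.single a b (1 : ℂ)) w = w b • Pi.single a 1 := by
      rw [Matrix.toLin'_apply, Matrix.single_mulVec, ← Pi.single_smul]
      simp [Pi.single]
    have h2 : (Matrix.toLin' (Matrix.single c f (1 : ℂ))).dualMap l =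
        l (Pi.single c 1) • (LinearMap.proj f : Module.Dual ℂ (Fin k → ℂ)) := by
      refine LinearMap.ext fun v => ?_
      have h3 : Matrix.toLin' (Matrix.single c f (1 : ℂ)) v = v f • Pi.single c 1 := by
        rw [Matrix.toLin'_apply, Matrix.single_mulVec, ← Pi.single_smul]
        simp [Pi.single]
      rw [LinearMap.dualMap_apply, h3, map_smul]
      simp [mul_comm]
    rw [TensorProduct.map_tmul, h1, h2, TensorProduct.smul_tmul_smul]
    rfl

end TensorCoordinates

section Sectors

variable {H : Type*} [Ring H] [HopfAlgebra ℂ H] {n : ℕ} {d : Fin n → ℕ}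
  (e : DrinfeldDouble H ≃ₐ[ℂ] ∀ i, Matrix (Fin (d i)) (Fin (d i)) ℂ)
  (hS : ∀ a : H, HopfAlgebra.antipode ℂ (HopfAlgebra.antipode ℂ a) = a)
  {V : Type*} [AddCommGroup V] [Module ℂ V] {ρ₀ ρ₁ : DoubleRep H V}
  (Ψ : V ≃ₗ[ℂ] ∀ i, (Fin (d i) → ℂ) ⊗[ℂ] Module.Dual ℂ (Fin (d i) → ℂ))

/-- The part of `V` that corresponds to one summand. -/
def summand (i : Fin n) : Submodule ℂ V where
  carrier := {v | ∀ j, j ≠ i → Ψ v j = 0}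
  add_mem' := fun h h' j hj => by rw [map_add, Pi.add_apply, h j hj, h' j hj, add_zero]
  zero_mem' := fun j _ => by rw [map_zero, Pi.zero_apply]
  smul_mem' := fun c v h j hj => by rw [map_smul, Pi.smul_apply, h j hj, smul_zero]

theorem mem_summand {i : Fin n} {v : V} : v ∈ summand Ψ i ↔ ∀ j, j ≠ i → Ψ v j = 0 := Iff.rfl

theorem summand_ne_bot (i : Fin n) [NeZero (d i)] : summand Ψ i ≠ ⊥ := by
  intro h
  have h1 : Ψ.symm (Pi.single i ((Pi.single 0 1 : Fin (d i) → ℂ) ⊗ₜ[ℂ]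
      (LinearMap.proj 0 : Module.Dual ℂ (Fin (d i) → ℂ)))) ∈ summand Ψ i := fun j hj => by
    rw [Ψ.apply_symm_apply, Pi.single_eq_of_ne hj]
  rw [h, Submodule.mem_bot, LinearEquiv.map_eq_zero_iff, Pi.single_eq_zero_iff] at h1
  have h2 := congrArg (tensorCoord 0 0) h1
  simp [tensorCoord] at h2

variable (h₀ : ∀ m v i, Ψ (ρ₀ m v) i = TensorProduct.map (blockRep e i m) LinearMap.id (Ψ v i))
  (h₁ : ∀ m v i,
    Ψ (ρ₁ m v) i = TensorProduct.map LinearMap.id ((blockRep e i).dualAction m) (Ψ v i))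

include h₀ h₁

theorem summand_invariant (i : Fin n) :
    (∀ m, ∀ u ∈ summand Ψ i, ρ₀ m u ∈ summand Ψ i) ∧
      ∀ m, ∀ u ∈ summand Ψ i, ρ₁ m u ∈ summand Ψ i :=
  ⟨fun m u hu j hj => by rw [h₀, hu j hj, map_zero],
    fun m u hu j hj => by rw [h₁, hu j hj, map_zero]⟩

include hS

/-- An invariant subspace contains every summand on which it does not vanish. -/
theorem summand_le {U : Submodule ℂ V} (hU₀ : ∀ m, ∀ u ∈ U, ρ₀ m u ∈ U)
    (hU₁ : ∀ m, ∀ u ∈ U, ρ₁ m u ∈ U) {i : Fin n} {v : V} (hv : v ∈ U) (hi : Ψ v i ≠ 0) :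
    summand Ψ i ≤ U := by
  obtain ⟨b, c, hbc⟩ := exists_tensorCoord_ne_zero hi
  have key : ∀ a f, Ψ.symm (Pi.single i ((Pi.single a 1 : Fin (d i) → ℂ) ⊗ₜ[ℂ]
      (LinearMap.proj f : Module.Dual ℂ (Fin (d i) → ℂ)))) ∈ U := by
    intro a f
    have h := hU₀ (blockElem e i (Matrix.single a b 1)) _
      (hU₁ (DrinfeldDouble.antipode (blockElem e i (Matrix.single c f 1))) v hv)
    rw [← U.smul_mem_iff hbc]
    convert h using 1
    rw [← map_smul, LinearEquiv.symm_apply_eq, ← Pi.single_smul]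
    ext1 j
    rw [h₀, h₁, DoubleRep.dualAction, DrinfeldDouble.antipode_antipode hS]
    rcases eq_or_ne j i with rfl | hj
    · have hr : ∀ M, blockRep e j (blockElem e j M) = Matrix.toLin' M := fun M =>
        LinearMap.ext (blockRep_blockElem e j M)
      rw [Pi.single_eq_same, ← map_single_tmul, ← LinearMap.comp_apply, ← TensorProduct.map_comp,
        LinearMap.comp_id, LinearMap.id_comp, hr, hr]
    · rw [Pi.single_eq_of_ne hj, blockRep_blockElem_of_ne e hj, TensorProduct.map_zero_left,
        LinearMap.zero_apply]
  intro u hu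
  have h2 : Ψ u = Pi.single i (Ψ u i) := by
    ext1 j
    rcases eq_or_ne j i with rfl | hj
    · rw [Pi.single_eq_same]
    · rw [Pi.single_eq_of_ne hj, hu j hj]
  have h3 : u = ∑ a, ∑ f, tensorCoord a f (Ψ u i) • Ψ.symm (Pi.single i
      ((Pi.single a 1 : Fin (d i) → ℂ) ⊗ₜ[ℂ]
        (LinearMap.proj f : Module.Dual ℂ (Fin (d i) → ℂ)))) := by
    apply Ψ.injective
    conv_lhs => rw [h2, ← sum_tensorCoord_smul (Ψ u i)]
    ext1 j
    rcases eq_or_ne j i with rfl | hj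
    · simp
    · simp [Pi.single_eq_of_ne hj]
  rw [h3]
  exact U.sum_mem fun a _ => U.sum_mem fun f _ => U.smul_mem _ (key a f)

/-- The minimal invariant subspaces are the summands. -/
theorem isSector_iff [∀ i, NeZero (d i)] (U : Submodule ℂ V) :
    IsSector ρ₀ ρ₁ U ↔ ∃ i, ∀ v, v ∈ U ↔ ∀ j, j ≠ i → Ψ v j = 0 := by
  have hsec : ∀ i, IsSector ρ₀ ρ₁ (summand Ψ i) := fun i => by
    refine ⟨⟨summand_ne_bot Ψ i, summand_invariant e Ψ h₀ h₁ i⟩, ?_⟩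
    rintro U' ⟨hne, hU₀, hU₁⟩ hle
    obtain ⟨u, hu, hu0⟩ := Submodule.exists_mem_ne_zero_of_ne_bot hne
    refine summand_le e hS Ψ h₀ h₁ hU₀ hU₁ hu fun hi => hu0 ?_
    rw [← Ψ.map_eq_zero_iff]
    ext1 j
    rcases eq_or_ne j i with rfl | hj
    · exact hi
    · exact hle hu j hj
  constructor
  · rintro ⟨⟨hne, hU₀, hU₁⟩, hmin⟩
    obtain ⟨u, hu, hu0⟩ := Submodule.exists_mem_ne_zero_of_ne_bot hne
    obtain ⟨i, hi⟩ := Function.ne_iff.1 (mt Ψ.map_eq_zero_iff.1 hu0)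
    have hle := summand_le e hS Ψ h₀ h₁ hU₀ hU₁ hu hi
    have heq : U = summand Ψ i := le_antisymm (hmin (hsec i).1 hle) hle
    exact ⟨i, fun v => by rw [heq, mem_summand]⟩
  · rintro ⟨i, hi⟩
    have heq : U = summand Ψ i := Submodule.ext fun v => (hi v).trans (mem_summand Ψ).symm
    exact heq ▸ hsec i

end Sectors

/-! ### The regular representations on the dual of the double -/

section RegularRep

variable {H : Type*} [Ring H] [HopfAlgebra ℂ H]

/-- The action `L` as a representation. -/
def leftRep (hS : ∀ a : H, HopfAlgebra.antipode ℂ (HopfAlgebra.antipode ℂ a) = a) :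
    DoubleRep H (Module.Dual ℂ (DrinfeldDouble H)) :=
  AlgHom.ofLinearMap
    { toFun := actL
      map_add' := fun m m' => by ext; simp [actL, add_mul]
      map_smul' := fun c m => by ext; simp [actL] }
    (by ext; simp [actL, DrinfeldDouble.antipode_one]) (actL_mul hS)

/-- The action `R` as a representation. -/
def rightRep : DoubleRep H (Module.Dual ℂ (DrinfeldDouble H)) :=
  AlgHom.ofLinearMap
    { toFun := actR
      map_add' := fun m m' => by ext; simp [actR, mul_add]
      map_smul' := fun c m => by ext; simp [actR] }
    (by ext; simp [actR]) (fun m m' => by ext; simp [actR, mul_assoc])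

/-- The decomposition of a bimodule isomorphic to `D(H)*` into its sectors, for a semisimple double.
-/
theorem exists_dual_decomposition [FiniteDimensional ℂ H]
    (hS : ∀ a : H, HopfAlgebra.antipode ℂ (HopfAlgebra.antipode ℂ a) = a)
    [IsSemisimpleRing (DrinfeldDouble H)] {V : Type*} [AddCommGroup V] [Module ℂ V]
    (Φ : Module.Dual ℂ (DrinfeldDouble H) ≃ₗ[ℂ] V) (ρ₀ ρ₁ : DoubleRep H V)
    (hL : ∀ m ξ, ρ₀ m (Φ ξ) = Φ (actL m ξ)) (hR : ∀ m ξ, ρ₁ m (Φ ξ) = Φ (actR m ξ)) :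
    ∃ (n : ℕ) (d : Fin n → ℕ) (μ : ∀ i, DoubleRep H (Fin (d i) → ℂ))
      (Ψ : V ≃ₗ[ℂ] (∀ i, (Fin (d i) → ℂ) ⊗[ℂ] Module.Dual ℂ (Fin (d i) → ℂ))),
      IsCompleteIrreps μ ∧
      (∀ m v i, Ψ (ρ₀ m v) i = TensorProduct.map (μ i m) LinearMap.id (Ψ v i)) ∧
      (∀ m v i, Ψ (ρ₁ m v) i = TensorProduct.map LinearMap.id ((μ i).dualAction m) (Ψ v i)) ∧
      ∀ U : Submodule ℂ V, IsSector ρ₀ ρ₁ U ↔ ∃ i, ∀ v, v ∈ U ↔ ∀ j, j ≠ i → Ψ v j = 0 := by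
  obtain ⟨n, d, hd, ⟨e⟩⟩ :=
    IsSemisimpleRing.exists_algEquiv_pi_matrix_of_isAlgClosed ℂ (DrinfeldDouble H)
  have h₀ : ∀ m v i, (Φ.symm ≪≫ₗ peterWeyl e hS) (ρ₀ m v) i =
      TensorProduct.map (blockRep e i m) .id ((Φ.symm ≪≫ₗ peterWeyl e hS) v i) := by
    intro m v i
    obtain ⟨ξ, rfl⟩ := Φ.surjective v
    simp only [hL, LinearEquiv.trans_apply, Φ.symm_apply_apply, peterWeyl_actL]
  have h₁ : ∀ m v i, (Φ.symm ≪≫ₗ peterWeyl e hS) (ρ₁ m v) i =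
      TensorProduct.map .id ((blockRep e i).dualAction m) ((Φ.symm ≪≫ₗ peterWeyl e hS) v i) := by
    intro m v i
    obtain ⟨ξ, rfl⟩ := Φ.surjective v
    simp only [hR, LinearEquiv.trans_apply, Φ.symm_apply_apply, peterWeyl_actR]
  exact ⟨n, d, blockRep e, _, isCompleteIrreps_blockRep e, h₀, h₁, isSector_iff e hS _ h₀ h₁⟩

end RegularRep

end

end KitaevHopf

theorem mainTheorem4 {H : Type*} [Ring H] [HopfAlgebra ℂ H] [FiniteDimensional ℂ H]
    (hS : ∀ a : H, HopfAlgebra.antipode ℂ (HopfAlgebra.antipode ℂ a) = a)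
    {E : Type*} [Fintype E] [DecidableEq E] (Γ : KitaevHopf.Lattice E)
    (Ω : KitaevHopf.StateSpace E H) (hΩ : KitaevHopf.IsGroundState Γ Ω)
    (τ : KitaevHopf.Ribbon Γ)
    (hv : ¬ Γ.SameVertex τ.initial τ.final) (hp : ¬ Γ.SameFace τ.initial τ.final) :
    -- the identification of `D(H)*` with `V_τ`, and the two actions of local operators on `V_τ`
    ∃ (Φ : Module.Dual ℂ (KitaevHopf.DrinfeldDouble H) ≃ₗ[ℂ] KitaevHopf.ribbonSpace τ Ω)
      (ρ₀ ρ₁ : KitaevHopf.DoubleRep H (KitaevHopf.ribbonSpace τ Ω)),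
      (∀ (h : H) (f : Module.Dual ℂ H),
        (Φ (KitaevHopf.toDualDouble (h ⊗ₜ[ℂ] f)) : KitaevHopf.StateSpace E H) =
          KitaevHopf.ribbonOp τ (h ⊗ₜ[ℂ] f) Ω) ∧
      (∀ (t : Module.Dual ℂ H) (a : H) (v : KitaevHopf.ribbonSpace τ Ω),
        (ρ₀ (KitaevHopf.DrinfeldDouble.mk t a) v : KitaevHopf.StateSpace E H) =
          KitaevHopf.opB Γ τ.initial t (KitaevHopf.opA Γ τ.initial a v)) ∧
      (∀ (t : Module.Dual ℂ H) (a : H) (v : KitaevHopf.ribbonSpace τ Ω),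
        (ρ₁ (KitaevHopf.DrinfeldDouble.mk t a) v : KitaevHopf.StateSpace E H) =
          KitaevHopf.opB Γ τ.final t (KitaevHopf.opA Γ τ.final a v)) ∧
      -- these actions are `L` and `R`
      (∀ m ξ, ρ₀ m (Φ ξ) = Φ (KitaevHopf.actL m ξ)) ∧
      (∀ m ξ, ρ₁ m (Φ ξ) = Φ (KitaevHopf.actR m ξ)) ∧
      -- decomposition into sectors, labelled by the irreducible representations of `D(H)`
      ∃ (n : ℕ) (d : Fin n → ℕ) (μ : ∀ i, KitaevHopf.DoubleRep H (Fin (d i) → ℂ))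
        (Ψ : KitaevHopf.ribbonSpace τ Ω ≃ₗ[ℂ]
          (∀ i, (Fin (d i) → ℂ) ⊗[ℂ] Module.Dual ℂ (Fin (d i) → ℂ))),
        KitaevHopf.IsCompleteIrreps μ ∧
        (∀ m v i, Ψ (ρ₀ m v) i = TensorProduct.map (μ i m) LinearMap.id (Ψ v i)) ∧
        (∀ m v i, Ψ (ρ₁ m v) i = TensorProduct.map LinearMap.id ((μ i).dualAction m) (Ψ v i)) ∧
        ∀ U : Submodule ℂ (KitaevHopf.ribbonSpace τ Ω), KitaevHopf.IsSector ρ₀ ρ₁ U ↔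
          ∃ i, ∀ v, v ∈ U ↔ ∀ j, j ≠ i → Ψ v j = 0 := by
  obtain ⟨-, h₀, φ, hh, hφ, -⟩ := id hΩ
  have := KitaevHopf.isSemisimpleRing_double hS hh hφ
  let Φ : Module.Dual ℂ (KitaevHopf.DrinfeldDouble H) ≃ₗ[ℂ] KitaevHopf.ribbonSpace τ Ω :=
    (LinearEquiv.ofInjective _ (KitaevHopf.stateMap_injective hS hΩ τ hv hp)).trans
      (LinearEquiv.ofEq _ _ (KitaevHopf.range_stateMap τ Ω))
  have hΦ : ∀ ξ, (Φ ξ : KitaevHopf.StateSpace E H) = KitaevHopf.stateMap τ.triangles Ω ξ :=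
    fun ξ => rfl
  let ρ₀ : KitaevHopf.DoubleRep H (KitaevHopf.ribbonSpace τ Ω) :=
    (Φ.conjAlgEquiv ℂ).toAlgHom.comp (KitaevHopf.leftRep hS)
  let ρ₁ : KitaevHopf.DoubleRep H (KitaevHopf.ribbonSpace τ Ω) :=
    (Φ.conjAlgEquiv ℂ).toAlgHom.comp KitaevHopf.rightRep
  have hL : ∀ m ξ, ρ₀ m (Φ ξ) = Φ (KitaevHopf.actL m ξ) := fun m ξ =>
    congrArg (fun ζ => Φ (KitaevHopf.actL m ζ)) (Φ.symm_apply_apply ξ)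
  have hR : ∀ m ξ, ρ₁ m (Φ ξ) = Φ (KitaevHopf.actR m ξ) := fun m ξ =>
    congrArg (fun ζ => Φ (KitaevHopf.actR m ζ)) (Φ.symm_apply_apply ξ)
  refine ⟨Φ, ρ₀, ρ₁, fun h f => ?_, fun t a v => ?_, fun t a v => ?_, hL, hR,
    KitaevHopf.exists_dual_decomposition hS Φ ρ₀ ρ₁ hL hR⟩
  · rw [hΦ, KitaevHopf.stateMap_toDualDouble]
    rfl
  · obtain ⟨ξ, rfl⟩ := Φ.surjective v
    rw [hL, hΦ, hΦ, KitaevHopf.opB_opA_initial hS hΩ τ hv hp]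
  · obtain ⟨ξ, rfl⟩ := Φ.surjective v
    rw [hR, hΦ, hΦ, KitaevHopf.opB_opA_final hS hΩ τ hv hp]
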